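/- Let $d\ge 2$ and let $g(x)=(g_{jk}(x))_{j,k=1}^d$ be a smooth Riemannian metric on $\mathbb R^d$. Write $(g^{jk}(x))=g(x)^{-1}$, $|g(x)|=\sqrt{\det g(x)}$, $d_gx=|g(x)|\,dx$, $\langle x\rangle=(1+|x|^2)^{1/2}$. Assume that $g$ is (elliptic) there is $C>0$ with $C^{-1}|\xi|^2\le\sum_{j,k}g^{jk}(x)\xi_j\xi_k\le C|\xi|^2$ for all $x,\xi\in\mathbb R^d$; (long range) there is $\rho>0$ such that for every multi-index $\alpha\in\mathbb N^d$ there is $C_\alpha>0$ with $|\partial^\alpha(g^{jk}(x)-\delta_{jk})|\le C_\alpha\langle x\rangle^{-\rho-|\alpha|}$ for all $x\in\mathbb R^d$ and all $j,k$. Let $\Delta_g=\sum_{j,k}|g|^{-1}\partial_{x_j}\big(g^{jk}|g|\,\partial_{x_k}\big)$. Then the closure $P$ of $-\Delta_g$ on $C_c^\infty(\mathbb R^d)$ in $L^2(\mathbb R^d,d_gx)$ is self-adjoint (so $P$ is the unique self-adjoint extension of $-\Delta_g$), $-P$ generates a strongly continuous semigroup $(e^{-tP})_{t\ge0}$ on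 $L^2(\mathbb R^d,d_gx)$, and there is a real-valued function $K(t,x,y)$ on $(0,\infty)\times\mathbb R^d\times\mathbb R^d$ (the heat kernel), necessarily unique, that is continuous in $(x,y)$ for each $t>0$ and satisfies, for every $t>0$ and $u\in L^2(\mathbb R^d,d_gx)$, $$e^{-tP}u(x)=\int_{\mathbb R^d}K(t,x,y)\,u(y)\,dy\quad\text{for almost every }x,$$ with absolutely convergent integral. Moreover there is a constant $C>0$ such that for all $t>0$ and all $x,y\in\mathbb R^d$ $$K(t,x,x)\le C\,t^{-d/2},\qquad K(t,x,y)\le C\,t^{-d/2}\exp\Big(-\frac{|x-y|^2}{Ct}\Big),$$ and, for every $t>0$, $e^{-tP}$ restricted to $L^1\cap L^2$ extends to a bounded operator from $L^1(\mathbb R^d)$ to $L^\infty(\mathbb R^d)$ with $$\|e^{-tP}\|_{L^1\to L^\infty}\le C\,t^{-d/2}.$$ -/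

import Mathlib

open MeasureTheory Filter Topology
open scoped ContDiff ENNReal

namespace HeatKernel

/-- `ℝ^d` with its Euclidean norm. -/
abbrev Space (d : ℕ) : Type := EuclideanSpace ℝ (Fin d)

/-- The partial derivative `∂_j f`. -/
noncomputable def partialDeriv {d : ℕ} {F : Type*} [NormedAddCommGroup F] [NormedSpace ℝ F]
    (j : Fin d) (f : Space d → F) (x : Space d) : F :=
  fderiv ℝ f x (EuclideanSpace.single j (1 : ℝ))

/-- A smooth Riemannian metric `g(x) = (g_{jk}(x))` on `ℝ^d`. -/
structure Metric (d : ℕ) where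
  /-- the matrix `(g_{jk}(x))` -/
  mat : Space d → Matrix (Fin d) (Fin d) ℝ
  smooth : ∀ j k, ContDiff ℝ ∞ (fun x => mat x j k)
  posDef : ∀ x, (mat x).PosDef

namespace Metric

variable {d : ℕ} (g : Metric d)

/-- The coefficient `g^{jk}(x)` of the inverse matrix. -/
noncomputable def inv (j k : Fin d) (x : Space d) : ℝ := (g.mat x)⁻¹ j k

/-- The Riemannian density `|g(x)| = √(det g(x))`. -/
noncomputable def density (x : Space d) : ℝ := Real.sqrt (g.mat x).det

/-- The Riemannian volume `d_g x = |g(x)| dx`. -/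
noncomputable def vol : Measure (Space d) :=
  volume.withDensity (fun x => ENNReal.ofReal (g.density x))

/-- `C⁻¹ |ξ|² ≤ ∑ g^{jk}(x) ξ_j ξ_k ≤ C |ξ|²` for all `x, ξ`. -/
def IsElliptic : Prop :=
  ∃ C : ℝ, 0 < C ∧ ∀ x ξ : Space d,
    C⁻¹ * ‖ξ‖ ^ 2 ≤ ∑ j, ∑ k, g.inv j k x * ξ j * ξ k ∧
      ∑ j, ∑ k, g.inv j k x * ξ j * ξ k ≤ C * ‖ξ‖ ^ 2

/-- There is `ρ > 0` such that all derivatives of order `n` of `g^{jk} - δ_{jk}` are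
`O(⟨x⟩^{-ρ-n})` on `ℝ^d`, where `⟨x⟩ = (1 + |x|²)^{1/2}`. -/
def IsLongRange : Prop :=
  ∃ ρ : ℝ, 0 < ρ ∧ ∀ n : ℕ, ∃ C : ℝ, 0 < C ∧ ∀ (j k : Fin d) (x : Space d),
    ‖iteratedFDeriv ℝ n (fun y => g.inv j k y - (1 : Matrix (Fin d) (Fin d) ℝ) j k) x‖ ≤
      C * Real.sqrt (1 + ‖x‖ ^ 2) ^ (-ρ - (n : ℝ))

/-- The Laplace-Beltrami operator
`Δ_g φ = ∑_{j,k} |g|⁻¹ ∂_j (g^{jk} |g| ∂_k φ)`. -/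
noncomputable def laplaceBeltrami (φ : Space d → ℂ) (x : Space d) : ℂ :=
  ∑ j, ∑ k, (g.density x)⁻¹ •
    partialDeriv j (fun y => (g.inv j k y * g.density y) • partialDeriv k φ y) x

lemma contDiff_det {M : Space d → Matrix (Fin d) (Fin d) ℝ}
    (h : ∀ j k, ContDiff ℝ ∞ (fun x => M x j k)) : ContDiff ℝ ∞ (fun x => (M x).det) := by
  simp only [Matrix.det_apply]
  exact ContDiff.sum fun σ _ => (contDiff_prod fun i _ => h _ _).const_smul _

lemma contDiff_density : ContDiff ℝ ∞ g.density :=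
  (contDiff_det g.smooth).sqrt fun x => (g.posDef x).det_pos.ne'

lemma density_pos (x : Space d) : 0 < g.density x := Real.sqrt_pos.2 (g.posDef x).det_pos

lemma contDiff_inv (j k : Fin d) : ContDiff ℝ ∞ (g.inv j k) := by
  have h : g.inv j k = fun x => ((g.mat x).det)⁻¹ * (g.mat x).adjugate j k := by
    ext x
    simp [inv, Matrix.inv_def]
  rw [h]
  refine ((contDiff_det g.smooth).inv fun x => (g.posDef x).det_pos.ne').mul ?_
  simp only [Matrix.adjugate_apply]
  refine contDiff_det fun a b => ?_
  by_cases hak : a = k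
  · subst hak
    simpa using contDiff_const
  · simpa [Matrix.updateRow_ne hak] using g.smooth a b

end Metric

/-- `C_c^∞(ℝ^d)`, as a subspace of the complex functions on `ℝ^d`. -/
def testFunctions (d : ℕ) : Submodule ℂ (Space d → ℂ) where
  carrier := {φ | ContDiff ℝ ∞ φ ∧ HasCompactSupport φ}
  add_mem' h₁ h₂ := ⟨h₁.1.add h₂.1, h₁.2.add h₂.2⟩
  zero_mem' := ⟨contDiff_const, HasCompactSupport.zero⟩
  smul_mem' c _ h := ⟨h.1.const_smul c, h.2.smul_left (f := fun _ => c)⟩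

lemma partialDeriv_add {d : ℕ} (j : Fin d) {φ ψ : Space d → ℂ} (hφ : ContDiff ℝ ∞ φ)
    (hψ : ContDiff ℝ ∞ ψ) (x : Space d) :
    partialDeriv j (fun y => φ y + ψ y) x = partialDeriv j φ x + partialDeriv j ψ x := by
  simp only [partialDeriv]
  rw [fderiv_fun_add (hφ.differentiable (by simp) x) (hψ.differentiable (by simp) x)]
  rfl

lemma partialDeriv_smul {d : ℕ} (j : Fin d) (c : ℂ) {φ : Space d → ℂ} (hφ : ContDiff ℝ ∞ φ)
    (x : Space d) : partialDeriv j (fun y => c • φ y) x = c • partialDeriv j φ x := by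
  simp only [partialDeriv]
  rw [fderiv_fun_const_smul (hφ.differentiable (by simp) x)]
  rfl

lemma contDiff_partialDeriv {d : ℕ} (j : Fin d) {φ : Space d → ℂ} (h : ContDiff ℝ ∞ φ) :
    ContDiff ℝ ∞ (partialDeriv j φ) :=
  (h.fderiv_right (by simp)).clm_apply contDiff_const

namespace Metric

variable {d : ℕ} (g : Metric d)

lemma contDiff_flux (j k : Fin d) {φ : Space d → ℂ} (h : ContDiff ℝ ∞ φ) :
    ContDiff ℝ ∞ (fun y => (g.inv j k y * g.density y) • partialDeriv k φ y) :=
  ((g.contDiff_inv j k).mul g.contDiff_density).smul (contDiff_partialDeriv k h)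

lemma laplaceBeltrami_mem {φ : Space d → ℂ} (h : φ ∈ testFunctions d) :
    g.laplaceBeltrami φ ∈ testFunctions d := by
  have hs : g.laplaceBeltrami φ = ∑ j, ∑ k, fun x => (g.density x)⁻¹ •
      partialDeriv j (fun y => (g.inv j k y * g.density y) • partialDeriv k φ y) x := by
    ext x
    simp [laplaceBeltrami, Finset.sum_apply]
  rw [hs]
  refine Submodule.sum_mem _ fun j _ => Submodule.sum_mem _ fun k _ => ⟨?_, ?_⟩
  · exact (g.contDiff_density.inv fun x => (g.density_pos x).ne').smul
      (contDiff_partialDeriv j (g.contDiff_flux j k h.1))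
  · have h1 : HasCompactSupport (partialDeriv k φ) := h.2.fderiv_apply ℝ _
    have h2 : HasCompactSupport
        (fun y => (g.inv j k y * g.density y) • partialDeriv k φ y) :=
      h1.smul_left (f := fun y => g.inv j k y * g.density y)
    have h3 : HasCompactSupport (partialDeriv j
        (fun y => (g.inv j k y * g.density y) • partialDeriv k φ y)) := h2.fderiv_apply ℝ _
    exact h3.smul_left (f := fun x => (g.density x)⁻¹)

/-- `-Δ_g` as a linear map of `C_c^∞(ℝ^d)`. -/
noncomputable def minusLaplaceTest : testFunctions d →ₗ[ℂ] testFunctions d where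
  toFun φ := ⟨-g.laplaceBeltrami φ, Submodule.neg_mem _ (g.laplaceBeltrami_mem φ.2)⟩
  map_add' φ ψ := by
    ext x
    change -g.laplaceBeltrami (fun y => (φ : Space d → ℂ) y + (ψ : Space d → ℂ) y) x =
      -g.laplaceBeltrami φ x + -g.laplaceBeltrami ψ x
    simp only [laplaceBeltrami, partialDeriv_add _ φ.2.1 ψ.2.1, smul_add,
      partialDeriv_add _ (g.contDiff_flux _ _ φ.2.1) (g.contDiff_flux _ _ ψ.2.1),
      Finset.sum_add_distrib, neg_add]
  map_smul' c φ := by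
    ext x
    change -g.laplaceBeltrami (fun y => c • (φ : Space d → ℂ) y) x =
      c • -g.laplaceBeltrami φ x
    simp only [laplaceBeltrami, partialDeriv_smul _ c φ.2.1, smul_comm _ c,
      partialDeriv_smul _ c (g.contDiff_flux _ _ φ.2.1), smul_neg, Finset.smul_sum]

instance : IsLocallyFiniteMeasure g.vol :=
  IsLocallyFiniteMeasure.withDensity_ofReal g.contDiff_density.continuous

lemma volume_absolutelyContinuous_vol : (volume : Measure (Space d)) ≪ g.vol := by
  refine withDensity_absolutelyContinuous' ?_ ?_
  · exact g.contDiff_density.continuous.measurable.ennreal_ofReal.aemeasurable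
  · exact Eventually.of_forall fun x => by simpa using g.density_pos x

/-- The Hilbert space `L²(ℝ^d, d_g x)` of complex functions. -/
abbrev L2 : Type := Lp ℂ 2 g.vol

lemma memLp_test (φ : testFunctions d) : MemLp (φ : Space d → ℂ) 2 g.vol :=
  φ.2.1.continuous.memLp_of_hasCompactSupport φ.2.2

/-- The inclusion of `C_c^∞(ℝ^d)` into `L²(ℝ^d, d_g x)`. -/
noncomputable def testToL2 : testFunctions d →ₗ[ℂ] g.L2 where
  toFun φ := (g.memLp_test φ).toLp
  map_add' _ _ := rfl
  map_smul' _ _ := rfl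

lemma testToL2_injective : Function.Injective g.testToL2 := by
  intro φ ψ h
  have h1 : (φ : Space d → ℂ) =ᵐ[g.vol] ψ :=
    (MemLp.toLp_eq_toLp_iff (g.memLp_test φ) (g.memLp_test ψ)).1 h
  have h2 : (φ : Space d → ℂ) =ᵐ[volume] ψ := g.volume_absolutelyContinuous_vol.ae_le h1
  exact Subtype.ext ((φ.2.1.continuous.ae_eq_iff_eq volume ψ.2.1.continuous).1 h2)

/-- The operator `-Δ_g` in `L²(ℝ^d, d_g x)` with domain `C_c^∞(ℝ^d)`. -/
noncomputable def minusLaplace : g.L2 →ₗ.[ℂ] g.L2 where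
  domain := LinearMap.range g.testToL2
  toFun := (g.testToL2 ∘ₗ g.minusLaplaceTest) ∘ₗ
    (LinearEquiv.ofInjective g.testToL2 g.testToL2_injective).symm.toLinearMap

/-- On `C_c^∞(ℝ^d)` the operator is given by the differential expression. -/
lemma minusLaplace_apply (φ : testFunctions d) :
    g.minusLaplace ⟨g.testToL2 φ, LinearMap.mem_range_self _ φ⟩ =ᵐ[g.vol]
      fun x => -g.laplaceBeltrami φ x := by
  have h : g.minusLaplace ⟨g.testToL2 φ, LinearMap.mem_range_self _ φ⟩ =
      g.testToL2 (g.minusLaplaceTest φ) := by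
    exact congrArg (fun ψ => g.testToL2 (g.minusLaplaceTest ψ))
      ((LinearEquiv.ofInjective g.testToL2 g.testToL2_injective).symm_apply_apply φ)
  rw [h]
  exact MemLp.coeFn_toLp (g.memLp_test (g.minusLaplaceTest φ))

/-- The operator `P`: the closure of `-Δ_g` on `C_c^∞(ℝ^d)`. When it is self-adjoint, it is
the unique self-adjoint extension of `-Δ_g`. -/
noncomputable def P : g.L2 →ₗ.[ℂ] g.L2 := g.minusLaplace.closure

end Metric

/-- `T t`, `t ≥ 0`, is the strongly continuous semigroup with generator `A` (including its
domain), that is `T t = e^{tA}`. -/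
structure IsSemigroupGeneratedBy {H : Type*} [NormedAddCommGroup H] [NormedSpace ℂ H]
    (A : H →ₗ.[ℂ] H) (T : ℝ → H →L[ℂ] H) : Prop where
  map_zero : T 0 = ContinuousLinearMap.id ℂ H
  map_add : ∀ s t : ℝ, 0 ≤ s → 0 ≤ t → T (s + t) = (T s).comp (T t)
  continuousOn : ∀ u : H, ContinuousOn (fun t => T t u) (Set.Ici 0)
  generator : ∀ u v : H, (u, v) ∈ A.graph ↔
    Tendsto (fun t : ℝ => t⁻¹ • (T t u - u)) (𝓝[>] 0) (𝓝 v)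

/-- `K` is the integral kernel of the operators `T t`, `t > 0`, continuous in the space
variables: `(T t u)(x) = ∫ K(t,x,y) u(y) dy` for `u ∈ L²`. There is at most one such `K` on
`(0,∞) × ℝ^d × ℝ^d`. -/
structure IsContinuousKernel {d : ℕ} (g : Metric d) (T : ℝ → g.L2 →L[ℂ] g.L2)
    (K : ℝ → Space d → Space d → ℝ) : Prop where
  continuous : ∀ t : ℝ, 0 < t → Continuous (fun p : Space d × Space d => K t p.1 p.2)
  integral_eq : ∀ t : ℝ, 0 < t → ∀ u : g.L2, ∀ᵐ x,
    Integrable (fun y => (K t x y : ℂ) * u y) ∧ T t u x = ∫ y, (K t x y : ℂ) * u y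

end HeatKernel

/-! ### Closures of nonnegative symmetric operators on a Hilbert space -/

namespace HeatKernel

set_option linter.unusedSectionVars false

section Abstract

variable {H : Type*} [NormedAddCommGroup H] [InnerProductSpace ℂ H] [CompleteSpace H]

local notation "⟪" x ", " y "⟫" => inner ℂ x y

/-! Write `ρ` for the density. From the two hypotheses on the metric only uniform bounds are kept
(`Metric.exists_bounds`): the metric, its inverse and `ρ` are bounded, the quadratic forms and `ρ`
are bounded below, `g^{jk}` is Lipschitz, and the first order coefficients of `Δ_g` are bounded.
Everything else follows from these bounds and from smoothness.

Self-adjointness. By Green's formula `-Δ_g` is symmetric and nonnegative on test functions, so its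
closure is self-adjoint once `l - Δ_g` has dense range for some `l > 0`, that is, once the only `u ∈
L²` with `Δ_g u = l u` in the sense of distributions is `0`. This is done by Friedrichs
mollification. The function `W = ρ u` solves a double divergence equation. Its mollification `v`
satisfies `l v = ∑ ∂_j (∑ g^{jk} ∂_k v + Q_j)`, where the commutator `Q` is bounded in `L²` by a
multiple of `W`, uniformly in the scale, because the coefficients are Lipschitz. The energy identity
gives `l ‖v‖² ≤ q ‖W‖²` with `q` independent of `l` and of the scale; letting the scale tend to zero
with `l = q + 1` forces `W = 0` (`Metric.integral_moll_le`, `Metric.exists_eq_zero_of_weakEq`).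

Semigroup. The continuous functional calculus of the bounded operator `R = (1 + P/l)⁻¹` yields
`e^{-tP}`, its smoothing property and Euler's formula `(1 + tP/n)^{-n} → e^{-tP}`
(`exists_heatSemigroup`). Euler's formula carries two facts from the resolvents to the semigroup:
contractivity in `L¹`, which comes from accretivity of `P` against the regularised phase `u / √(ε +
|u|²)`, and commutation with complex conjugation (`Metric.exists_heatFlow`).

On-diagonal bound. The Gagliardo-Nirenberg-Sobolev inequality applied to `|u|²` gives Nash's
inequality (`Metric.nash`). Inserted in the differential inequality for `‖e^{-tP} f‖²` it gives
`‖e^{-tP} f‖_2 ≤ A t^{-d/4} ‖f‖_1`, hence by duality a bound from `L²` to `L^∞`.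

Gaussian decay. Davies' exponentially weighted energy estimate gives off-diagonal `L²` decay between
half-spaces (`IsHeatFlow.exists_gaffney`). Iterating it along the times `t/2^n`, together with the
Nash bound, upgrades it to decay from `L¹` to `L²` (`IsHeatFlow.exists_norm_inner_le`).

Continuity of the kernel. If `u` and `Δ_g u` are bounded, the averages of `ρ u` against a bump of
radius `r`, radial for the metric frozen at `x`, are Lipschitz in `r`: the `r`-derivative of the
bump is a Laplacian up to an error that is integrable uniformly in `r`. The limits at `r = 0`
therefore give a continuous representative, with a modulus depending only on the bounds
(`Metric.exists_continuous_representative`). So `e^{-tP} u (x) = ⟪k x, u⟫` with `k` continuous in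
norm, and with `k` taken at time `t/2` the kernel is `ρ(y) ⟪k x, k y⟫`. Its Gaussian bound comes
from cutting space along the hyperplane bisecting the segment from `x` to `y`
(`IsHeatFlow.exists_norm_inner_evaluation_le`). -/

lemma mem_graph_adjoint_iff {A : H →ₗ.[ℂ] H} (hd : Dense (A.domain : Set H)) (u w : H) :
    (u, w) ∈ A.adjoint.graph ↔ ∀ p ∈ A.graph, ⟪p.2, u⟫ = ⟪p.1, w⟫ := by
  rw [LinearPMap.adjoint_graph_eq_graph_adjoint hd, Submodule.mem_adjoint_iff]
  simp only [sub_eq_zero, Prod.forall]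

lemma isClosable_of_symmetric {A : H →ₗ.[ℂ] H} (hd : Dense (A.domain : Set H))
    (hsym : A.IsFormalAdjoint A) : A.IsClosable :=
  (LinearPMap.adjoint_isClosed hd).isClosable.leIsClosable (hsym.le_adjoint hd)

/-- A closed relation that contains the graph of a closable operator contains the graph of its
closure. -/
lemma closure_graph_induction {A : H →ₗ.[ℂ] H} (hc : A.IsClosable) {S : Set (H × H)}
    (hS : IsClosed S) (h : ∀ p ∈ A.graph, p ∈ S) : ∀ p ∈ A.closure.graph, p ∈ S := by
  intro p hp
  rw [← hc.graph_closure_eq_closure_graph] at hp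
  exact closure_minimal (fun q hq => h q hq) hS hp

lemma graph_symmetric {A : H →ₗ.[ℂ] H} (hsym : A.IsFormalAdjoint A) :
    ∀ p ∈ A.graph, ∀ q ∈ A.graph, ⟪p.2, q.1⟫ = ⟪p.1, q.2⟫ := by
  intro p hp q hq
  obtain ⟨x, hx1, hx2⟩ := (LinearPMap.mem_graph_iff A).1 hp
  obtain ⟨y, hy1, hy2⟩ := (LinearPMap.mem_graph_iff A).1 hq
  rw [← hx1, ← hx2, ← hy1, ← hy2]
  exact hsym x y

lemma closure_graph_symmetric {A : H →ₗ.[ℂ] H} (hd : Dense (A.domain : Set H))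
    (hsym : A.IsFormalAdjoint A) :
    ∀ p ∈ A.closure.graph, ∀ q ∈ A.closure.graph, ⟪p.2, q.1⟫ = ⟪p.1, q.2⟫ := by
  have hc := isClosable_of_symmetric hd hsym
  have h1 : ∀ p ∈ A.graph, ∀ q ∈ A.closure.graph, ⟪p.2, q.1⟫ = ⟪p.1, q.2⟫ := fun p hp =>
    closure_graph_induction hc (S := {q | ⟪p.2, q.1⟫ = ⟪p.1, q.2⟫})
      (isClosed_eq (by fun_prop) (by fun_prop)) fun q hq => graph_symmetric hsym p hp q hq
  exact fun p hp q hq => closure_graph_induction hc (S := {p | ⟪p.2, q.1⟫ = ⟪p.1, q.2⟫})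
    (isClosed_eq (by fun_prop) (by fun_prop)) (fun p hp => h1 p hp q hq) p hp

lemma closure_graph_nonneg {A : H →ₗ.[ℂ] H} (hc : A.IsClosable)
    (hpos : ∀ p ∈ A.graph, 0 ≤ (⟪p.1, p.2⟫).re) : ∀ p ∈ A.closure.graph, 0 ≤ (⟪p.1, p.2⟫).re :=
  closure_graph_induction hc (S := {p | 0 ≤ (⟪p.1, p.2⟫).re})
    (isClosed_le continuous_const (Complex.continuous_re.comp (by fun_prop))) hpos

/-- Pair `l u + w` with `u` and use Cauchy-Schwarz. This one estimate gives injectivity of `l + B`,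
closedness of its range and contractivity of `l (l + B)⁻¹`. -/
lemma mul_norm_le_of_nonneg {l : ℝ} {u w : H} (h : 0 ≤ (⟪u, w⟫).re) :
    l * ‖u‖ ≤ ‖l • u + w‖ := by
  rcases eq_or_ne u 0 with rfl | hu
  · simp
  have h1 : l * ‖u‖ ^ 2 ≤ ‖u‖ * ‖l • u + w‖ := by
    calc l * ‖u‖ ^ 2 ≤ (⟪u, l • u + w⟫).re := by
          have : (⟪u, u⟫).re = ‖u‖ ^ 2 := by
            rw [inner_self_eq_norm_sq_to_K]; norm_cast
          rw [inner_add_right, inner_smul_right_eq_smul, Complex.add_re, Complex.smul_re, this,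
            smul_eq_mul]
          linarith
      _ ≤ ‖⟪u, l • u + w⟫‖ := Complex.re_le_norm _
      _ ≤ _ := norm_inner_le_norm _ _
  have hu' : 0 < ‖u‖ := norm_pos_iff.2 hu
  nlinarith

/-- Solvability of `l u + A u = f` for the closure of a nonnegative operator with dense range. -/
lemma exists_closure_graph_of_dense_range {A : H →ₗ.[ℂ] H} (hc : A.IsClosable)
    (hpos : ∀ p ∈ A.graph, 0 ≤ (⟪p.1, p.2⟫).re) {l : ℝ} (hl : 0 < l)
    (hr : ∀ u : H, (∀ p ∈ A.graph, ⟪l • p.1 + p.2, u⟫ = 0) → u = 0) (f : H) :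
    ∃ p ∈ A.closure.graph, l • p.1 + p.2 = f := by
  have hcl : IsClosed (A.closure.graph : Set (H × H)) := hc.closure_isClosed
  let L : H × H →L[ℂ] H := ((l : ℂ) • ContinuousLinearMap.fst ℂ H H) + ContinuousLinearMap.snd ℂ H H
  have hL : ∀ p, L p = l • p.1 + p.2 := fun p => by simp [L]
  have hpos' := closure_graph_nonneg hc hpos
  let V : Submodule ℂ H := A.closure.graph.map (L : H × H →ₗ[ℂ] H)
  -- The range is closed: if `l u_n + w_n` converges, `mul_norm_le_of_nonneg` makes `u_n` Cauchy,
  -- then `w_n` converges too, and the graph is closed.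
  have hV : IsClosed (V : Set H) := by
    refine isClosed_of_closure_subset fun f hf => ?_
    obtain ⟨x, hx, hxf⟩ := mem_closure_iff_seq_limit.1 hf
    choose p hp hpx using hx
    have hpx' : ∀ n, l • (p n).1 + (p n).2 = x n := fun n => by rw [← hL]; exact hpx n
    have hcau : CauchySeq fun n => (p n).1 := by
      have h1 := hxf.cauchySeq
      rw [Metric.cauchySeq_iff] at h1 ⊢
      intro ε hε
      obtain ⟨N, hN⟩ := h1 (l * ε) (by positivity)
      refine ⟨N, fun m hm n hn => ?_⟩
      have h2 := hN m hm n hn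
      rw [dist_eq_norm, ← hpx', ← hpx'] at h2
      have h3 := mul_norm_le_of_nonneg (l := l) (hpos' _ (A.closure.graph.sub_mem (hp m) (hp n)))
      rw [dist_eq_norm]
      have h4 : l • (p m - p n).1 + (p m - p n).2 =
          l • (p m).1 + (p m).2 - (l • (p n).1 + (p n).2) := by
        simp only [Prod.fst_sub, Prod.snd_sub, smul_sub]; abel
      rw [h4] at h3
      exact lt_of_mul_lt_mul_left (h3.trans_lt h2) hl.le
    obtain ⟨u, hu⟩ := cauchySeq_tendsto_of_complete hcau
    have hw : Tendsto (fun n => (p n).2) atTop (𝓝 (f - l • u)) := by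
      have : (fun n => (p n).2) = fun n => x n - l • (p n).1 := by
        ext n; rw [← hpx']; abel
      rw [this]
      exact hxf.sub (hu.const_smul l)
    refine ⟨(u, f - l • u), hcl.mem_of_tendsto (hu.prodMk_nhds hw)
      (Eventually.of_forall hp), ?_⟩
    change L _ = f
    rw [hL]; simp
  have : V = ⊤ := by
    have : CompleteSpace V := hV.completeSpace_coe
    rw [← Submodule.orthogonal_eq_bot_iff, Submodule.eq_bot_iff]
    intro u hu
    refine hr u fun p hp => ?_
    rw [← hL]
    exact (Submodule.mem_orthogonal V u).1 hu _ ⟨p, LinearPMap.le_graph_of_le A.le_closure hp, rfl⟩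
  have hf : f ∈ V := this ▸ Submodule.mem_top
  obtain ⟨p, hp, hpf⟩ := hf
  exact ⟨p, hp, by rw [← hL]; exact hpf⟩

/-- A symmetric operator `B` such that `l + B` is surjective is self-adjoint. -/
lemma isSelfAdjoint_of_surjective {B : H →ₗ.[ℂ] H} (hd : Dense (B.domain : Set H))
    (hsym : ∀ p ∈ B.graph, ∀ q ∈ B.graph, ⟪p.2, q.1⟫ = ⟪p.1, q.2⟫) {l : ℝ}
    (hsurj : ∀ f, ∃ p ∈ B.graph, l • p.1 + p.2 = f) : IsSelfAdjoint B := by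
  rw [LinearPMap.isSelfAdjoint_def]
  refine LinearPMap.eq_of_eq_graph ?_
  ext ⟨u, w⟩
  rw [mem_graph_adjoint_iff hd]
  refine ⟨fun h => ?_, fun h p hp => hsym p hp _ h⟩
  -- Here `(u, w)` lies in the graph of the adjoint. If `q` in the graph of `B` solves the same
  -- equation, then `u - q.1` is orthogonal to the range of `l + B`, which is the whole space.
  obtain ⟨q, hq, hqf⟩ := hsurj (l • u + w)
  obtain ⟨p, hp, hpf⟩ := hsurj (u - q.1)
  have h1 : u - q.1 = 0 := by
    rw [← inner_self_eq_zero (𝕜 := ℂ)]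
    nth_rewrite 1 [← hpf]
    have h2 : w = l • q.1 + q.2 - l • u := by rw [hqf]; abel
    have h3 := h p hp
    have h4 := hsym p hp q hq
    rw [h2] at h3
    simp only [inner_add_left, inner_sub_right, inner_add_right, inner_smul_left_eq_smul,
      inner_smul_right_eq_smul] at h3 ⊢
    rw [h3, h4]
    abel
  have h5 : u = q.1 := sub_eq_zero.1 h1
  have h6 : w = q.2 := by rw [h5] at hqf; simpa using hqf.symm
  rw [h5, h6]
  exact hq

end Abstract
end HeatKernel

/-! ### The scalar functions behind the functional calculus -/

namespace HeatKernel

/-- The function `exp (-t l (1 - r) / r)` of the contraction `r = (1 + p / l)⁻¹`, equal to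
`exp (-t p)`. -/
noncomputable def heatSymbol (l t r : ℝ) : ℝ := Real.exp (t * l) * expNegInvGlue (r / (t * l))

lemma heatSymbol_zero (l t : ℝ) : heatSymbol l t 0 = 0 := by
  simp [heatSymbol, expNegInvGlue]

lemma heatSymbol_of_pos {l t r : ℝ} (hl : 0 < l) (ht : 0 < t) (hr : 0 < r) :
    heatSymbol l t r = Real.exp (-(t * (l * (1 - r) / r))) := by
  have : ¬ r / (t * l) ≤ 0 := not_le.2 (by positivity)
  simp only [heatSymbol, expNegInvGlue, this, if_false, ← Real.exp_add]
  congr 1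
  field_simp
  ring

lemma continuous_heatSymbol (l t : ℝ) : Continuous (heatSymbol l t) :=
  continuous_const.mul
    ((expNegInvGlue.contDiff (n := 0)).continuous.comp (continuous_id.div_const _))

/-- With `r = (1 + p/l)⁻¹` this function is `(1 + p/l) e^{-tp}`. Its continuity at `r = 0` is the
smoothing property: `e^{-tP}` factors through `R` and so maps into the domain of `P`. -/
lemma continuous_heatSymbol_inv (l t : ℝ) : Continuous fun r => r⁻¹ * heatSymbol l t r := by
  rcases eq_or_ne (t * l) 0 with h | h
  · have : (fun r : ℝ => r⁻¹ * heatSymbol l t r) = fun _ => 0 := by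
      ext r; simp [heatSymbol, h, expNegInvGlue]
    rw [this]; exact continuous_const
  have h1 := (expNegInvGlue.continuous_polynomial_eval_inv_mul Polynomial.X).comp
    (continuous_id.div_const (t * l))
  have : (fun r : ℝ => r⁻¹ * heatSymbol l t r) = fun r => (t * l)⁻¹ * Real.exp (t * l) *
      (Polynomial.eval (r / (t * l))⁻¹ Polynomial.X * expNegInvGlue (r / (t * l))) := by
    ext r
    simp only [heatSymbol, Polynomial.eval_X, inv_div]
    rcases eq_or_ne r 0 with rfl | hr
    · simp
    · field_simp
      rw [mul_div_cancel_left₀ _ h]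
  rw [this]
  exact continuous_const.mul h1

lemma heatSymbol_mul {l s t r : ℝ} (hl : 0 < l) (hs : 0 < s) (ht : 0 < t) (hr : 0 ≤ r) :
    heatSymbol l (s + t) r = heatSymbol l s r * heatSymbol l t r := by
  rcases hr.eq_or_lt with rfl | hr
  · simp [heatSymbol_zero]
  · rw [heatSymbol_of_pos hl (by positivity) hr, heatSymbol_of_pos hl hs hr,
      heatSymbol_of_pos hl ht hr, ← Real.exp_add]
    congr 1; ring

lemma heatSymbol_nonneg (l t r : ℝ) : 0 ≤ heatSymbol l t r :=
  mul_nonneg (Real.exp_pos _).le (expNegInvGlue.nonneg _)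

lemma heatSymbol_le_one {l t r : ℝ} (hl : 0 < l) (ht : 0 < t) (hr : r ∈ Set.Icc (0 : ℝ) 1) :
    heatSymbol l t r ≤ 1 := by
  rcases hr.1.eq_or_lt with rfl | h
  · simp [heatSymbol_zero]
  · rw [heatSymbol_of_pos hl ht h, Real.exp_le_one_iff, neg_nonpos]
    have := sub_nonneg.2 hr.2
    positivity

/-- `|r (e^{-tp} - 1)| ≤ t l (1 - r)`. -/
lemma heatSymbol_sub_one_le {l t r : ℝ} (hl : 0 < l) (ht : 0 < t) (hr : r ∈ Set.Icc (0 : ℝ) 1) :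
    |r * (heatSymbol l t r - 1)| ≤ t * (l * (1 - r)) := by
  have h1 := sub_nonneg.2 hr.2
  rcases hr.1.eq_or_lt with rfl | h
  · simp only [zero_mul, abs_zero]; positivity
  · have h2 := heatSymbol_le_one hl ht hr
    rw [abs_of_nonpos (mul_nonpos_of_nonneg_of_nonpos h.le (by linarith))]
    have h3 : 1 - t * (l * (1 - r) / r) ≤ heatSymbol l t r := by
      rw [heatSymbol_of_pos hl ht h]
      have := Real.add_one_le_exp (-(t * (l * (1 - r) / r)))
      linarith
    calc -(r * (heatSymbol l t r - 1)) = r * (1 - heatSymbol l t r) := by ring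
      _ ≤ r * (t * (l * (1 - r) / r)) := by gcongr; linarith
      _ = _ := by field_simp

lemma abs_exp_neg_sub_one_add_le {x : ℝ} (hx : 0 ≤ x) : |Real.exp (-x) - 1 + x| ≤ x ^ 2 := by
  have h1 := Real.add_one_le_exp (-x)
  rw [abs_of_nonneg (by linarith)]
  have h2 := Real.add_one_le_exp x
  have h3 : Real.exp (-x) * (1 + x) ≤ 1 := by
    rw [Real.exp_neg]
    rw [inv_mul_le_iff₀ (Real.exp_pos _)]; linarith
  have : Real.exp (-x) ≤ 1 - x + x ^ 2 := by
    have h4 : (1 : ℝ) ≤ (1 - x + x ^ 2) * (1 + x) := by nlinarith [pow_nonneg hx 3]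
    have h5 : 0 < 1 + x := by linarith
    nlinarith
  linarith

/-- Second order expansion of the semigroup on the square of the resolvent. -/
lemma heatSymbol_expansion {l t r : ℝ} (hl : 0 < l) (ht : 0 < t) (hr : r ∈ Set.Icc (0 : ℝ) 1) :
    |r * (t⁻¹ * (r * (heatSymbol l t r - 1)) + l * (1 - r))| ≤ t * l ^ 2 := by
  have h1 := sub_nonneg.2 hr.2
  rcases hr.1.eq_or_lt with rfl | h
  · simp only [zero_mul, abs_zero]; positivity
  · set p := l * (1 - r) / r with hp
    have hp0 : 0 ≤ p := by positivity
    have h2 := abs_exp_neg_sub_one_add_le (x := t * p) (by positivity)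
    rw [heatSymbol_of_pos hl ht h]
    have h3 : r * (t⁻¹ * (r * (Real.exp (-(t * p)) - 1)) + l * (1 - r)) =
        r ^ 2 * t⁻¹ * (Real.exp (-(t * p)) - 1 + t * p) := by
      rw [hp]; field_simp
    rw [h3, abs_mul, abs_of_nonneg (by positivity)]
    calc _ ≤ r ^ 2 * t⁻¹ * (t * p) ^ 2 := by gcongr
      _ = t * (l * (1 - r)) ^ 2 := by rw [hp]; field_simp
      _ ≤ _ := by
        gcongr
        nlinarith [hr.1]

/-- The bound is uniform in `x ≥ 0`, so Euler's formula will hold in operator norm. With `y = x/n`,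
the bases `a = (1+y)⁻¹` and `e^{-y}` differ by at most `a y²`, so the powers differ by at most `x²
aⁿ / n`. Bernoulli's inequality, applied with `⌊n/2⌋ ≥ n/3` and squared, bounds `x² aⁿ` by `9`. -/
lemma abs_inv_one_add_pow_sub_exp_le {x : ℝ} (hx : 0 ≤ x) {n : ℕ} (hn : 2 ≤ n) :
    |((1 + x / n)⁻¹) ^ n - Real.exp (-x)| ≤ 9 / n := by
  have hn0 : (0 : ℝ) < n := by positivity
  set y := x / n with hy
  have hy0 : 0 ≤ y := by positivity
  have hxy : Real.exp (-x) = (Real.exp (-y)) ^ n := by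
    rw [← Real.exp_nat_mul]; congr 1; rw [hy]; field_simp
  set a := (1 + y)⁻¹ with ha
  set b := Real.exp (-y) with hb
  have hb0 : 0 ≤ b := (Real.exp_pos _).le
  have ha0 : 0 < a := by positivity
  have h1 : 1 - y ≤ b := by have := Real.add_one_le_exp (-y); linarith
  have hay : a * (1 + y) = 1 := inv_mul_cancel₀ (by positivity)
  have hba : b ≤ a := by
    rw [hb, ha, Real.exp_neg]
    exact inv_anti₀ (by positivity) (by linarith [Real.add_one_le_exp y])
  have hab : a - b ≤ a * y ^ 2 := by nlinarith
  have hab0 : a ^ n - b ^ n ≤ n * (a - b) * a ^ (n - 1) := by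
    have := pow_le_pow_left₀ hb0 hba
    have h2 := abs_pow_sub_pow_le a b n
    rw [abs_of_nonneg (sub_nonneg.2 (this n)), abs_of_nonneg (sub_nonneg.2 hba),
      abs_of_nonneg ha0.le, abs_of_nonneg hb0, max_eq_left hba] at h2
    linarith
  have hcx : (x / 3) ^ 2 ≤ (1 + y) ^ n := by
    have h4 : (n : ℝ) / 3 ≤ ((n / 2 : ℕ) : ℝ) := by
      rw [div_le_iff₀ (by norm_num)]
      exact_mod_cast (by omega : n ≤ n / 2 * 3)
    calc (x / 3) ^ 2 = (n / 3 * y) ^ 2 := by rw [hy]; field_simp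
      _ ≤ (1 + (n / 2 : ℕ) * y) ^ 2 := by gcongr; nlinarith
      _ ≤ ((1 + y) ^ (n / 2)) ^ 2 := by
            gcongr
            exact one_add_mul_le_pow (by linarith) _
      _ = (1 + y) ^ (n / 2 * 2) := by rw [← pow_mul]
      _ ≤ _ := pow_le_pow_right₀ (by linarith) (Nat.div_mul_le_self n 2)
  have hxa : x ^ 2 * a ^ n ≤ 9 := by
    have h5 : a ^ n * (1 + y) ^ n = 1 := by rw [← mul_pow, hay, one_pow]
    have h6 : 0 < a ^ n := by positivity
    nlinarith
  rw [hxy, abs_of_nonneg (sub_nonneg.2 (pow_le_pow_left₀ hb0 hba n))]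
  calc a ^ n - b ^ n ≤ n * (a - b) * a ^ (n - 1) := hab0
    _ ≤ n * (a * y ^ 2) * a ^ (n - 1) := by gcongr
    _ = n * y ^ 2 * (a * a ^ (n - 1)) := by ring
    _ = n * y ^ 2 * a ^ n := by rw [mul_pow_sub_one (by omega)]
    _ = x ^ 2 * a ^ n / n := by rw [hy]; field_simp
    _ ≤ 9 / n := by gcongr

/-! ### The resolvent as a self-adjoint contraction -/

section Abstract

variable {H : Type*} [NormedAddCommGroup H] [InnerProductSpace ℂ H] [CompleteSpace H]

local notation "⟪" x ", " y "⟫" => inner ℂ x y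

/-- The contraction `R = (1 + B / l)⁻¹`. -/
lemma exists_resolvent {B : H →ₗ.[ℂ] H}
    (hsym : ∀ p ∈ B.graph, ∀ q ∈ B.graph, ⟪p.2, q.1⟫ = ⟪p.1, q.2⟫)
    (hpos : ∀ p ∈ B.graph, 0 ≤ (⟪p.1, p.2⟫).re) {l : ℝ} (hl : 0 < l)
    (hsurj : ∀ f, ∃ p ∈ B.graph, l • p.1 + p.2 = f) :
    ∃ R : H →L[ℂ] H, IsSelfAdjoint R ∧ (∀ r ∈ spectrum ℝ R, r ∈ Set.Icc (0 : ℝ) 1) ∧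
      (∀ f, (R f, l • (f - R f)) ∈ B.graph) ∧
      ∀ p ∈ B.graph, R (p.1 + l⁻¹ • p.2) = p.1 := by
  choose p hp hpf using hsurj
  -- A pair in the graph is determined by `l q.1 + q.2`; this makes the chosen solution map linear.
  have huniq : ∀ q ∈ B.graph, q = p (l • q.1 + q.2) := by
    intro q hq
    set f := l • q.1 + q.2 with hf
    have h1 := B.graph.sub_mem hq (hp f)
    have h2 := mul_norm_le_of_nonneg (l := l) (hpos _ h1)
    have h3 : l • (q - p f).1 + (q - p f).2 = 0 := by
      have : l • (q - p f).1 + (q - p f).2 = f - (l • (p f).1 + (p f).2) := by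
        rw [hf]; simp only [Prod.fst_sub, Prod.snd_sub, smul_sub]; abel
      rw [this, hpf, sub_self]
    rw [h3, norm_zero] at h2
    have h4 : (q - p f).1 = 0 := norm_le_zero_iff.1 (by
      by_contra h; push Not at h; nlinarith)
    rw [h4, smul_zero, zero_add] at h3
    exact sub_eq_zero.1 (Prod.ext h4 h3)
  have hadd : ∀ f g, p (f + g) = p f + p g := by
    intro f g
    rw [huniq (p f + p g) (B.graph.add_mem (hp f) (hp g))]
    congr 1
    conv_lhs => rw [← hpf f, ← hpf g]
    simp only [Prod.fst_add, Prod.snd_add, smul_add]; abel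
  have hsmul : ∀ (c : ℂ) f, p (c • f) = c • p f := by
    intro c f
    rw [huniq (c • p f) (B.graph.smul_mem c (hp f))]
    congr 1
    conv_lhs => rw [← hpf f]
    simp only [Prod.smul_fst, Prod.smul_snd, smul_add, smul_comm c l]
  let R₀ : H →ₗ[ℂ] H :=
    { toFun := fun f => l • (p f).1
      map_add' := fun f g => by simp [hadd]
      map_smul' := fun c f => by simp [hsmul, smul_comm c l] }
  let R : H →L[ℂ] H := R₀.mkContinuous 1 fun f => by
    have h2 := mul_norm_le_of_nonneg (l := l) (hpos _ (hp f))
    rw [hpf] at h2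
    change ‖l • (p f).1‖ ≤ _
    rw [norm_smul, Real.norm_of_nonneg hl.le]
    linarith
  have hR : ∀ f, R f = l • (p f).1 := fun f => rfl
  have hRf : ∀ f, f - R f = (p f).2 := fun f => by
    rw [hR]; nth_rewrite 1 [← hpf f]; abel
  have hgr : ∀ f, (R f, l • (f - R f)) ∈ B.graph := by
    intro f
    have : (R f, l • (f - R f)) = (l : ℂ) • p f := by
      rw [hRf, hR]
      ext <;> simp
    rw [this]
    exact B.graph.smul_mem _ (hp f)
  have hRsym : ∀ f g, ⟪R f, g⟫ = ⟪f, R g⟫ := by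
    intro f g
    have h1 := hsym _ (hgr f) _ (hgr g)
    simp only [inner_smul_left_eq_smul, inner_smul_right_eq_smul, inner_sub_left,
      inner_sub_right] at h1
    have h2 := smul_right_injective ℂ hl.ne' h1
    linear_combination -h2
  have hRsa : IsSelfAdjoint R := ContinuousLinearMap.isSelfAdjoint_iff_isSymmetric.2 hRsym
  -- Both `0 ≤ R` and `R ≤ 1` come from nonnegativity at the pair `(R f, l (f - R f))`, that is from
  -- `Re ⟪R f, f - R f⟫ ≥ 0`. They place the spectrum of `R` in `[0, 1]`.
  have hR0 : 0 ≤ R := by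
    rw [ContinuousLinearMap.nonneg_iff_isPositive]
    refine ⟨hRsym, fun f => ?_⟩
    have h1 := hpos _ (hgr f)
    simp only [inner_smul_right_eq_smul, inner_sub_right, Complex.smul_re, Complex.sub_re,
      smul_eq_mul] at h1
    have h2 : (⟪R f, R f⟫).re = ‖R f‖ ^ 2 := by rw [inner_self_eq_norm_sq_to_K]; norm_cast
    rw [h2] at h1
    have h3 := nonneg_of_mul_nonneg_right h1 hl
    change 0 ≤ (⟪R f, f⟫).re
    nlinarith [sq_nonneg ‖R f‖]
  have hR1 : 0 ≤ 1 - R := by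
    rw [ContinuousLinearMap.nonneg_iff_isPositive]
    have hs : ∀ f g, ⟪(1 - R) f, g⟫ = ⟪f, (1 - R) g⟫ := fun f g => by
      simp [hRsym]
    refine ⟨hs, fun f => ?_⟩
    have h1 := hpos _ (hgr f)
    simp only [inner_smul_right_eq_smul, Complex.smul_re, smul_eq_mul] at h1
    have h3 := nonneg_of_mul_nonneg_right h1 hl
    change 0 ≤ (⟪(1 - R) f, f⟫).re
    have h2 : (⟪(1 - R) f, (1 - R) f⟫).re = ‖(1 - R) f‖ ^ 2 := by
      rw [inner_self_eq_norm_sq_to_K]; norm_cast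
    have h4 : ⟪(1 - R) f, f⟫ = ⟪(1 - R) f, (1 - R) f⟫ + ⟪R f, f - R f⟫ := by
      simp only [sub_apply, one_apply_eq_self, inner_sub_left, inner_sub_right, hRsym, map_sub]
      ring
    rw [h4, Complex.add_re, h2]
    positivity
  refine ⟨R, hRsa, fun r hr => ⟨spectrum_nonneg_of_nonneg hR0 hr, ?_⟩, hgr, fun q hq => ?_⟩
  · have : 1 - r ∈ spectrum ℝ (1 - R) := by
      have := spectrum.singleton_sub_eq (R := ℝ) R 1
      rw [map_one] at this
      rw [← this]
      exact Set.sub_mem_sub rfl hr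
    have := spectrum_nonneg_of_nonneg hR1 this
    linarith
  · have h1 : p (p q.1).1 = p (p q.1).1 := rfl
    have h2 : (q.1 + l⁻¹ • q.2) = ((l⁻¹ : ℝ) : ℂ) • (l • q.1 + q.2) := by
      rw [Complex.coe_smul, smul_add, smul_smul, inv_mul_cancel₀ hl.ne', one_smul]
    rw [h2, map_smul, hR, ← huniq q hq, Complex.coe_smul, smul_smul, inv_mul_cancel₀ hl.ne',
      one_smul]

end Abstract

end HeatKernel

/-! ### The heat semigroup by functional calculus -/

namespace HeatKernel

set_option linter.unusedSectionVars false

section Abstract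

variable {H : Type*} [NormedAddCommGroup H] [InnerProductSpace ℂ H] [CompleteSpace H]

local notation "⟪" x ", " y "⟫" => inner ℂ x y

/-- Reduces strong limits to the range of `R`, on which the scalar estimates give explicit rates. -/
lemma tendsto_apply_of_dense {ι : Type*} {F : Filter ι} {E : ι → H →L[ℂ] H} {E₀ : H →L[ℂ] H} {C : ℝ}
    (hC : ∀ᶠ i in F, ‖E i‖ ≤ C) {S : Set H} (hS : Dense S)
    (h : ∀ x ∈ S, Tendsto (fun i => E i x) F (𝓝 (E₀ x))) (x : H) :
    Tendsto (fun i => E i x) F (𝓝 (E₀ x)) := by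
  rw [Metric.tendsto_nhds]
  intro ε hε
  obtain ⟨D, hD, hCD, hED⟩ : ∃ D : ℝ, 0 < D ∧ C ≤ D ∧ ‖E₀‖ ≤ D :=
    ⟨max 1 (max C ‖E₀‖), by positivity, by simp, by simp⟩
  obtain ⟨y, hy, hxy⟩ := Metric.dense_iff.1 hS x (ε / (3 * D)) (by positivity)
  rw [Metric.mem_ball, dist_eq_norm] at hy
  filter_upwards [hC, Metric.tendsto_nhds.1 (h y hxy) (ε / 3) (by positivity)] with i hi1 hi2
  rw [dist_eq_norm] at hi2 ⊢
  have h1 : E i x - E₀ x = -E i (y - x) + (E i y - E₀ y) + E₀ (y - x) := by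
    simp only [map_sub]; abel
  have h3 : D * (ε / (3 * D)) = ε / 3 := by field_simp
  have h2 : ‖E i (y - x)‖ ≤ ε / 3 :=
    ((E i).le_opNorm _).trans (h3 ▸ mul_le_mul (hi1.trans hCD) hy.le (norm_nonneg _) hD.le)
  have h4 : ‖E₀ (y - x)‖ ≤ ε / 3 :=
    (E₀.le_opNorm _).trans (h3 ▸ mul_le_mul hED hy.le (norm_nonneg _) hD.le)
  rw [h1]
  calc _ ≤ ‖-E i (y - x)‖ + ‖E i y - E₀ y‖ + ‖E₀ (y - x)‖ := norm_add₃_le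
    _ < _ := by rw [norm_neg]; linarith

lemma neg_graph_iff {B : H →ₗ.[ℂ] H} (u v : H) : (u, v) ∈ (-B).graph ↔ (u, -v) ∈ B.graph := by
  rw [LinearPMap.neg_graph]
  constructor
  · rintro ⟨⟨a, b⟩, h, he⟩
    simp only [LinearMap.prodMap_apply, LinearMap.id_apply, LinearMap.neg_apply,
      Prod.mk.injEq] at he
    rw [← he.1, ← he.2, neg_neg]; exact h
  · intro h
    exact ⟨_, h, by simp⟩

/-- The heat semigroup of a nonnegative self-adjoint operator `B`, with its smoothing property and
the exponential formula. -/
theorem exists_heatSemigroup {B : H →ₗ.[ℂ] H} (hB : IsSelfAdjoint B)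
    (hsym : ∀ p ∈ B.graph, ∀ q ∈ B.graph, ⟪p.2, q.1⟫ = ⟪p.1, q.2⟫)
    (hpos : ∀ p ∈ B.graph, 0 ≤ (⟪p.1, p.2⟫).re) {l : ℝ} (hl : 0 < l)
    (hsurj : ∀ f, ∃ p ∈ B.graph, l • p.1 + p.2 = f) :
    ∃ T : ℝ → H →L[ℂ] H, IsSemigroupGeneratedBy (-B) T ∧
      (∀ t u v, ⟪T t u, v⟫ = ⟪u, T t v⟫) ∧ (∀ t u, ‖T t u‖ ≤ ‖u‖) ∧
      (∀ t, ∀ p ∈ B.graph, (T t p.1, T t p.2) ∈ B.graph) ∧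
      (∀ t, 0 < t → ∃ D : H →L[ℂ] H, ∀ u, (T t u, D u) ∈ B.graph) ∧
      ∃ J : ℝ → H →L[ℂ] H, (∀ s, 0 < s → ∀ f, (J s f, s⁻¹ • (f - J s f)) ∈ B.graph) ∧
        ∀ t, 0 < t → ∀ u, Tendsto (fun n : ℕ => (J (t / n) ^ n) u) atTop (𝓝 (T t u)) := by
  obtain ⟨R, hRsa, hspec, hgr, hRp⟩ := exists_resolvent hsym hpos hl hsurj
  have hRsym : ∀ f g, ⟪R f, g⟫ = ⟪f, R g⟫ :=
    ContinuousLinearMap.isSelfAdjoint_iff_isSymmetric.1 hRsa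
  have hdense : Dense (Set.range R) := by
    refine hB.dense_domain.mono fun u hu => ?_
    exact ⟨_, hRp _ (B.mem_graph ⟨u, hu⟩)⟩
  have hid : cfc (fun r : ℝ => r) R = R := cfc_id' ℝ R
  have hcont : ∀ t, ContinuousOn (heatSymbol l t) (spectrum ℝ R) := fun t =>
    (continuous_heatSymbol l t).continuousOn
  have cid : ContinuousOn (fun r : ℝ => r) (spectrum ℝ R) := continuousOn_id
  have csid : ∀ t, ContinuousOn (fun r => heatSymbol l t r * r) (spectrum ℝ R) := fun t =>
    (hcont t).mul continuousOn_id
  -- The symbol degenerates at `t = 0`, where division by `t l = 0` makes it vanish; hence the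
  -- separate value `1` for `t ≤ 0`.
  let T : ℝ → H →L[ℂ] H := fun t => if 0 < t then cfc (heatSymbol l t) R else 1
  have hT : ∀ {t}, 0 < t → T t = cfc (heatSymbol l t) R := fun ht => if_pos ht
  have hT' : ∀ {t}, ¬ 0 < t → T t = 1 := fun ht => if_neg ht
  have hTsym : ∀ t u v, ⟪T t u, v⟫ = ⟪u, T t v⟫ := by
    intro t
    have : IsSelfAdjoint (T t) := by
      by_cases ht : 0 < t
      · rw [hT ht]; exact cfc_predicate _ _
      · rw [hT' ht]; exact IsSelfAdjoint.one _
    exact ContinuousLinearMap.isSelfAdjoint_iff_isSymmetric.1 this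
  have hTn : ∀ t u, ‖T t u‖ ≤ ‖u‖ := by
    intro t u
    by_cases ht : 0 < t
    · rw [hT ht]
      have h1 : ‖cfc (heatSymbol l t) R‖ ≤ 1 := norm_cfc_le zero_le_one fun r hr => by
        rw [Real.norm_of_nonneg (heatSymbol_nonneg _ _ _)]
        exact heatSymbol_le_one hl ht (hspec r hr)
      simpa using ContinuousLinearMap.le_of_opNorm_le _ h1 u
    · simp [hT' ht]
  have hTadd : ∀ s t : ℝ, 0 ≤ s → 0 ≤ t → T (s + t) = (T s).comp (T t) := by
    intro s t hs ht
    rcases hs.eq_or_lt with rfl | hs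
    · rw [hT' (lt_irrefl 0), zero_add]; rfl
    rcases ht.eq_or_lt with rfl | ht
    · rw [hT' (lt_irrefl 0), add_zero]; rfl
    rw [hT hs, hT ht, hT (add_pos hs ht)]
    rw [← ContinuousLinearMap.mul_def, ← cfc_mul _ _ _ (hcont s) (hcont t)]
    exact cfc_congr fun r hr => heatSymbol_mul hl hs ht (hspec r hr).1
  have hTR : ∀ t, Commute (T t) R := by
    intro t
    by_cases ht : 0 < t
    · rw [hT ht]; nth_rewrite 2 [← hid]; exact cfc_commute_cfc _ _ _
    · rw [hT' ht]; exact Commute.one_left _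
  have hTR' : ∀ t u, T t (R u) = R (T t u) := fun t u => congrArg (fun E : H →L[ℂ] H => E u) (hTR t)
  have hTgr : ∀ t, ∀ p ∈ B.graph, (T t p.1, T t p.2) ∈ B.graph := by
    intro t p hp
    have h1 := hgr (T t (p.1 + l⁻¹ • p.2))
    have h2 : p.2 = l • ((p.1 + l⁻¹ • p.2) - p.1) := by
      rw [add_sub_cancel_left, smul_smul, mul_inv_cancel₀ hl.ne', one_smul]
    have h3 : ∀ v, T t (l • v) = l • T t v := fun v => by
      rw [← Complex.coe_smul, map_smul, Complex.coe_smul]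
    rw [← hTR', hRp p hp, ← map_sub, ← h3, ← h2] at h1
    exact h1
  -- strong derivative at zero
  have hderiv : ∀ {h : ℝ}, 0 < h → ∀ x,
      ‖T h (R x) - R x‖ ≤ h * l * ‖x‖ := by
    intro h hh x
    have h1 : T h * R - R = cfc (fun r => r * (heatSymbol l h r - 1)) R := by
      have : (fun r => r * (heatSymbol l h r - 1)) = fun r => heatSymbol l h r * r - r := by
        ext r; ring
      rw [this, cfc_sub _ _ _ (csid h) cid, cfc_mul _ _ _ (hcont h) cid, hid, hT hh]
    have h2 : ‖T h * R - R‖ ≤ h * l := by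
      rw [h1]
      refine norm_cfc_le (by positivity) fun r hr => ?_
      refine (heatSymbol_sub_one_le hl hh (hspec r hr)).trans ?_
      have := (hspec r hr).1
      gcongr; nlinarith
    exact ContinuousLinearMap.le_of_opNorm_le _ h2 x
  -- The difference quotients composed with `R` have norm at most `l`, so convergence is needed only
  -- on the range of `R`, where `heatSymbol_expansion` gives the rate `h l²`.
  have hgen : ∀ x, Tendsto (fun h : ℝ => h⁻¹ • (T h (R x) - R x)) (𝓝[>] 0) (𝓝 (-(l • (x - R x)))) := by
    let E : ℝ → H →L[ℂ] H := fun h => ((h⁻¹ : ℝ) : ℂ) • (T h * R - R)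
    let E₀ : H →L[ℂ] H := -((l : ℂ) • (1 - R))
    have hE : ∀ h x, E h x = h⁻¹ • (T h (R x) - R x) := fun h x => by
      simp only [E, Complex.coe_smul]; rfl
    have hE₀ : ∀ x, E₀ x = -(l • (x - R x)) := fun x => by
      simp only [E₀, Complex.coe_smul]; rfl
    have key := tendsto_apply_of_dense (F := 𝓝[>] (0 : ℝ)) (E := E) (E₀ := E₀) (C := l) ?_ hdense ?_
    · intro x
      simpa only [hE, hE₀] using key x
    · filter_upwards [self_mem_nhdsWithin] with h hh
      rw [Set.mem_Ioi] at hh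
      refine ContinuousLinearMap.opNorm_le_bound _ hl.le fun x => ?_
      rw [hE, norm_smul, norm_inv, Real.norm_of_nonneg hh.le, inv_mul_le_iff₀ hh, ← mul_assoc]
      exact hderiv hh x
    · rintro _ ⟨x, rfl⟩
      rw [tendsto_iff_norm_sub_tendsto_zero]
      have h0 : Tendsto (fun h : ℝ => h * l ^ 2 * ‖x‖) (𝓝[>] 0) (𝓝 0) := by
        have : Tendsto (fun h : ℝ => h * l ^ 2 * ‖x‖) (𝓝 0) (𝓝 (0 * l ^ 2 * ‖x‖)) :=
          Continuous.tendsto (by fun_prop) 0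
        simp only [zero_mul] at this
        exact this.mono_left nhdsWithin_le_nhds
      refine squeeze_zero' (Eventually.of_forall fun _ => norm_nonneg _) ?_ h0
      filter_upwards [self_mem_nhdsWithin] with h hh
      rw [Set.mem_Ioi] at hh
      have h1 : (E h - E₀) * R =
          cfc (fun r => r * (h⁻¹ * (r * (heatSymbol l h r - 1)) + l * (1 - r))) R := by
        have : (fun r => r * (h⁻¹ * (r * (heatSymbol l h r - 1)) + l * (1 - r))) =
            fun r => (h⁻¹ * (heatSymbol l h r * r - r) + l * (1 - r)) * r := by ext r; ring
        have c1 : ContinuousOn (fun r : ℝ => heatSymbol l h r * r - r) (spectrum ℝ R) :=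
          (csid h).sub cid
        have c2 : ContinuousOn (fun r : ℝ => h⁻¹ * (heatSymbol l h r * r - r)) (spectrum ℝ R) :=
          c1.const_mul _
        have c3 : ContinuousOn (fun r : ℝ => l * (1 - r)) (spectrum ℝ R) := by fun_prop
        have c4 : ContinuousOn (fun r : ℝ => h⁻¹ * (heatSymbol l h r * r - r) + l * (1 - r))
          (spectrum ℝ R) := c2.add c3
        rw [this, cfc_mul _ _ _ c4 cid, cfc_add _ _ _ c2 c3, cfc_const_mul _ _ _ c1,
          cfc_const_mul l (fun r => 1 - r) R (by fun_prop), cfc_sub (fun _ => 1) (fun r => r) R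
            (by fun_prop) (by fun_prop), cfc_sub _ _ _ (csid h) cid,
          cfc_mul _ _ _ (hcont h) cid, hid, cfc_const_one ℝ R, ← hT hh]
        simp only [E, E₀, Complex.coe_smul, sub_neg_eq_add]
      have h2 : ‖(E h - E₀) * R‖ ≤ h * l ^ 2 := by
        rw [h1]
        exact norm_cfc_le (by positivity) fun r hr => heatSymbol_expansion hl hh (hspec r hr)
      exact ContinuousLinearMap.le_of_opNorm_le _ h2 x
  -- strong continuity
  have hT0 : ∀ u, Tendsto (fun h => T h u) (𝓝[>] 0) (𝓝 u) := by
    have := tendsto_apply_of_dense (F := 𝓝[>] (0 : ℝ)) (E := T) (E₀ := 1) (C := 1)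
      (Eventually.of_forall fun t => ContinuousLinearMap.opNorm_le_bound _ zero_le_one fun x => by
        simpa using hTn t x) hdense ?_
    · exact this
    · rintro _ ⟨x, rfl⟩
      rw [tendsto_iff_norm_sub_tendsto_zero]
      have h0 : Tendsto (fun h : ℝ => h * l * ‖x‖) (𝓝[>] 0) (𝓝 0) := by
        have : Tendsto (fun h : ℝ => h * l * ‖x‖) (𝓝 0) (𝓝 (0 * l * ‖x‖)) :=
          Continuous.tendsto (by fun_prop) 0
        simp only [zero_mul] at this
        exact this.mono_left nhdsWithin_le_nhds
      refine squeeze_zero' (Eventually.of_forall fun _ => norm_nonneg _) ?_ h0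
      filter_upwards [self_mem_nhdsWithin] with h hh
      exact hderiv hh x
  have hTT : ∀ s t, 0 ≤ s → s ≤ t → ∀ u, ‖T t u - T s u‖ ≤ ‖T (t - s) u - u‖ := by
    intro s t hs hst u
    have := hTadd s (t - s) hs (sub_nonneg.2 hst)
    rw [add_sub_cancel] at this
    rw [this, ContinuousLinearMap.comp_apply, ← map_sub]
    exact hTn _ _
  have hTz : T 0 = 1 := hT' (lt_irrefl 0)
  have hTcont : ∀ u, ContinuousOn (fun t => T t u) (Set.Ici 0) := by
    intro u s hs
    have hz : ∀ ε > 0, ∃ δ > 0, ∀ h, 0 ≤ h → h < δ → ‖T h u - u‖ < ε := by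
      intro ε hε
      have := (Metric.tendsto_nhdsWithin_nhds.1 (hT0 u)) ε hε
      obtain ⟨δ, hδ, h⟩ := this
      refine ⟨δ, hδ, fun h' h0 h1 => ?_⟩
      rcases h0.eq_or_lt with rfl | h0
      · simpa [hTz] using hε
      · have := h h0 (by rwa [dist_zero_right, Real.norm_of_nonneg h0.le])
        rwa [dist_eq_norm] at this
    rw [Metric.continuousWithinAt_iff]
    intro ε hε
    obtain ⟨δ, hδ, h⟩ := hz ε hε
    refine ⟨δ, hδ, fun t ht hd => ?_⟩
    rw [Real.dist_eq] at hd
    rw [Set.mem_Ici] at hs ht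
    rw [dist_eq_norm]
    rcases le_total s t with hst | hst
    · exact (hTT s t hs hst u).trans_lt (h _ (sub_nonneg.2 hst) (by rwa [abs_of_nonneg (sub_nonneg.2 hst)] at hd))
    · rw [norm_sub_rev]
      exact (hTT t s ht hst u).trans_lt (h _ (sub_nonneg.2 hst)
        (by rwa [abs_sub_comm, abs_of_nonneg (sub_nonneg.2 hst)] at hd))
  have hgenp : ∀ p ∈ B.graph,
      Tendsto (fun h : ℝ => h⁻¹ • (T h p.1 - p.1)) (𝓝[>] 0) (𝓝 (-p.2)) := by
    intro p hp
    have := hgen (p.1 + l⁻¹ • p.2)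
    rwa [hRp p hp, add_sub_cancel_left, smul_smul, mul_inv_cancel₀ hl.ne', one_smul] at this
  -- The bounded operator `R⁻¹ e^{-tP}`.
  let M : ℝ → H →L[ℂ] H := fun t => cfc (fun r => r⁻¹ * heatSymbol l t r) R
  have hRM : ∀ t, 0 < t → T t = R * M t := by
    intro t ht
    simp only [M]
    nth_rewrite 1 [← hid]
    rw [← cfc_mul _ _ _ cid (continuous_heatSymbol_inv l t).continuousOn, hT ht]
    refine cfc_congr fun r hr => ?_
    rcases (hspec r hr).1.eq_or_lt with rfl | h
    · simp [heatSymbol_zero]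
    · field_simp
  -- With `p = l (1 - r)/r` one has `r m_s(r) = (1 + s p)⁻¹`, while `m_s` stays finite at `r = 0`.
  -- So `J s = R m_s(R)` is the resolvent `(1 + sP)⁻¹` and visibly maps into the domain.
  let m : ℝ → ℝ → ℝ := fun s r => (r + s * l * (1 - r))⁻¹
  have hmpos : ∀ s, 0 < s → ∀ r ∈ spectrum ℝ R, 0 < r + s * l * (1 - r) := by
    intro s hs r hr
    obtain ⟨h1, h2⟩ := hspec r hr
    rcases h1.eq_or_lt with rfl | h
    · simp; positivity
    · have := sub_nonneg.2 h2; positivity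
  have hmc : ∀ s, 0 < s → ContinuousOn (m s) (spectrum ℝ R) := fun s hs =>
    ContinuousOn.inv₀ (by fun_prop) fun r hr => (hmpos s hs r hr).ne'
  let J : ℝ → H →L[ℂ] H := fun s => R * cfc (m s) R
  have hJ : ∀ s, 0 < s → J s = cfc (fun r => r * m s r) R := fun s hs => by
    rw [cfc_mul _ _ _ cid (hmc s hs), hid]
  have hjc : ∀ s, 0 < s → ContinuousOn (fun r => r * m s r) (spectrum ℝ R) := fun s hs =>
    cid.mul (hmc s hs)
  refine ⟨T, ⟨hTz, hTadd, hTcont, ?_⟩, hTsym, hTn, hTgr, ?_, J, ?_, ?_⟩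
  · intro u v
    rw [neg_graph_iff]
    constructor
    · intro h
      simpa using hgenp _ h
    · intro h
      -- Differentiating `⟪T h p, u⟫ = ⟪p, T h u⟫` at `h = 0` shows that `(u, -v)` is in the graph
      -- of the adjoint of `B`, which is `B`. Hence the generator is not larger than `-B`.
      rw [← LinearPMap.isSelfAdjoint_def.1 hB, mem_graph_adjoint_iff hB.dense_domain]
      intro p hp
      have h1 : Tendsto (fun h : ℝ => ⟪-(h⁻¹ • (T h p.1 - p.1)), u⟫) (𝓝[>] 0) (𝓝 ⟪p.2, u⟫) := by
        have := ((hgenp p hp).neg).inner (tendsto_const_nhds (x := u)) (𝕜 := ℂ)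
        simpa only [neg_neg] using this
      have h2 : Tendsto (fun h : ℝ => ⟪p.1, -(h⁻¹ • (T h u - u))⟫) (𝓝[>] 0) (𝓝 ⟪p.1, -v⟫) :=
        (tendsto_const_nhds (x := p.1)).inner h.neg
      refine tendsto_nhds_unique h1 (h2.congr fun h => ?_)
      simp only [inner_neg_left, inner_neg_right, inner_smul_left_eq_smul,
        inner_smul_right_eq_smul, inner_sub_left, inner_sub_right, hTsym]
  · intro t ht
    -- Since `T t = R M t` and `B R f = l (f - R f)`, this is `B T t`.
    refine ⟨(l : ℂ) • (M t - T t), fun u => ?_⟩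
    have := hgr (M t u)
    have h2 : R (M t u) = T t u := by rw [hRM t ht]; rfl
    rw [h2] at this
    simpa using this
  · intro s hs f
    have := hgr (cfc (m s) R f)
    have h2 : R (cfc (m s) R f) = J s f := rfl
    have h3 : (1 : H →L[ℂ] H) - J s = ((s * l : ℝ) : ℂ) • (cfc (m s) R - J s) := by
      rw [hJ s hs, Complex.coe_smul, ← cfc_sub _ _ _ (hmc s hs) (hjc s hs),
        ← cfc_const_mul (s * l) (fun r => m s r - r * m s r) R ((hmc s hs).sub (hjc s hs)),
        ← cfc_const_one ℝ R, ← cfc_sub _ _ _ (by fun_prop) (hjc s hs)]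
      refine cfc_congr fun r hr => ?_
      have := (hmpos s hs r hr).ne'
      simp only [m]
      field_simp
      ring
    have h4 : f - J s f = (s * l) • (cfc (m s) R f - J s f) := by
      have := congrArg (fun E : H →L[ℂ] H => E f) h3
      rw [Complex.coe_smul] at this
      exact this
    rw [h2] at this
    rw [h4, smul_smul, ← mul_assoc, inv_mul_cancel₀ hs.ne', one_mul]
    exact this
  · intro t ht u
    rw [tendsto_iff_norm_sub_tendsto_zero]
    have h0 : Tendsto (fun n : ℕ => 9 / (n : ℝ) * ‖u‖) atTop (𝓝 0) := by
      simpa using (tendsto_const_div_atTop_nhds_zero_nat (9 : ℝ)).mul_const ‖u‖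
    refine squeeze_zero' (Eventually.of_forall fun _ => norm_nonneg _) ?_ h0
    filter_upwards [eventually_ge_atTop 2] with n hn
    have hn0 : (0 : ℝ) < n := by positivity
    have hs : 0 < t / n := by positivity
    have hjp : ContinuousOn (fun r => (r * m (t / n) r) ^ n) (spectrum ℝ R) := (hjc _ hs).pow n
    have h1 : J (t / n) ^ n - T t =
        cfc (fun r => (r * m (t / n) r) ^ n - heatSymbol l t r) R := by
      rw [cfc_sub _ _ _ hjp (hcont t), cfc_pow _ _ _ (hjc _ hs), ← hJ _ hs, hT ht]
    have h2 : ‖J (t / n) ^ n - T t‖ ≤ 9 / n := by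
      rw [h1]
      refine norm_cfc_le (by positivity) fun r hr => ?_
      rcases (hspec r hr).1.eq_or_lt with rfl | h
      · have : n ≠ 0 := by omega
        simp [heatSymbol_zero, this]; positivity
      · have h5 := sub_nonneg.2 (hspec r hr).2
        rw [heatSymbol_of_pos hl ht h, Real.norm_eq_abs]
        convert abs_inv_one_add_pow_sub_exp_le (x := t * (l * (1 - r) / r)) (by positivity) hn
          using 4
        have := (hmpos _ hs r hr).ne'
        simp only [m]
        field_simp
    exact ContinuousLinearMap.le_of_opNorm_le _ h2 u

end Abstract

end HeatKernel

/-! ### Uniform bounds for the coefficients -/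

namespace HeatKernel

lemma dotProduct_self_nonneg {ι : Type*} [Fintype ι] (v : ι → ℝ) : 0 ≤ v ⬝ᵥ v :=
  Finset.sum_nonneg fun i _ => mul_self_nonneg (v i)

/-- Spectral theory is not needed. The lower bound on the inverse form follows by expanding the form
of `M` at `v - C N v`; the upper bound follows from the lower bound on `M` at `N v` and from the
square of `v - C⁻¹ N v`. -/
lemma mul_self_le_of_matrix_form {ι : Type*} [Fintype ι] [DecidableEq ι] {M N : Matrix ι ι ℝ}
    (hs : M.IsSymm) (hMN : M * N = 1) {C : ℝ} (hC : 0 < C)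
    (hl : ∀ ξ : ι → ℝ, C⁻¹ * (ξ ⬝ᵥ ξ) ≤ ξ ⬝ᵥ M.mulVec ξ)
    (hu : ∀ ξ : ι → ℝ, ξ ⬝ᵥ M.mulVec ξ ≤ C * (ξ ⬝ᵥ ξ)) (v : ι → ℝ) :
    C⁻¹ * (v ⬝ᵥ v) ≤ v ⬝ᵥ N.mulVec v ∧ v ⬝ᵥ N.mulVec v ≤ C * (v ⬝ᵥ v) := by
  set ξ := N.mulVec v with hξ
  have hv : M.mulVec ξ = v := by rw [hξ, Matrix.mulVec_mulVec, hMN, Matrix.one_mulVec]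
  have h1 := hl ξ
  have h2 := hl (v - C • ξ)
  have h3 := hu v
  rw [hv] at h1
  have h4 : ξ ⬝ᵥ M.mulVec v = v ⬝ᵥ v := by
    rw [Matrix.dotProduct_mulVec, ← Matrix.mulVec_transpose, hs.eq, hv]
  have h5 : (v - C • ξ) ⬝ᵥ M.mulVec (v - C • ξ) =
      v ⬝ᵥ M.mulVec v - 2 * C * (v ⬝ᵥ v) + C ^ 2 * (v ⬝ᵥ ξ) := by
    simp only [Matrix.mulVec_sub, Matrix.mulVec_smul, hv, sub_dotProduct, dotProduct_sub,
      smul_dotProduct, dotProduct_smul, h4, smul_eq_mul, dotProduct_comm ξ v]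
    ring
  have h6 : 0 ≤ (v - C • ξ) ⬝ᵥ (v - C • ξ) := dotProduct_self_nonneg _
  have h7 : 0 ≤ (v - C⁻¹ • ξ) ⬝ᵥ (v - C⁻¹ • ξ) := dotProduct_self_nonneg _
  have h8 : (v - C⁻¹ • ξ) ⬝ᵥ (v - C⁻¹ • ξ) = v ⬝ᵥ v - 2 * C⁻¹ * (v ⬝ᵥ ξ) + C⁻¹ ^ 2 * (ξ ⬝ᵥ ξ) := by
    simp only [sub_dotProduct, dotProduct_sub, smul_dotProduct, dotProduct_smul, smul_eq_mul,
      dotProduct_comm ξ v]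
    ring
  have hCi : 0 < C⁻¹ := inv_pos.2 hC
  have hCC : C * C⁻¹ = 1 := mul_inv_cancel₀ hC.ne'
  rw [dotProduct_comm ξ v] at h1
  constructor
  · have h9 : 0 ≤ v ⬝ᵥ M.mulVec v - 2 * C * (v ⬝ᵥ v) + C ^ 2 * (v ⬝ᵥ ξ) := by
      rw [← h5]; exact (by positivity : (0:ℝ) ≤ C⁻¹ * _).trans h2
    have h10 : C * (v ⬝ᵥ v) ≤ C ^ 2 * (v ⬝ᵥ ξ) := by linarith
    rw [inv_mul_le_iff₀ hC]
    nlinarith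
  · have h9 : 0 ≤ v ⬝ᵥ v - C⁻¹ * (v ⬝ᵥ ξ) := by
      have : C⁻¹ ^ 2 * (ξ ⬝ᵥ ξ) ≤ C⁻¹ * (v ⬝ᵥ ξ) := by
        rw [pow_two, mul_assoc]; gcongr
      linarith
    have : v ⬝ᵥ ξ = C * (C⁻¹ * (v ⬝ᵥ ξ)) := by rw [← mul_assoc, hCC, one_mul]
    rw [this]; gcongr; linarith

/-- Polarisation: the form is nonnegative at `e_i ± e_j` and at most `C` at `e_i` and `e_j`. -/
lemma abs_entry_le_of_matrix_form {ι : Type*} [Fintype ι] [DecidableEq ι] {M : Matrix ι ι ℝ}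
    (hs : M.IsSymm) {C : ℝ} (hl : ∀ ξ : ι → ℝ, 0 ≤ ξ ⬝ᵥ M.mulVec ξ)
    (hu : ∀ ξ : ι → ℝ, ξ ⬝ᵥ M.mulVec ξ ≤ C * (ξ ⬝ᵥ ξ)) (i j : ι) : |M i j| ≤ C := by
  have hii : ∀ i j : ι, Pi.single i (1 : ℝ) ⬝ᵥ M.mulVec (Pi.single j 1) = M i j := by
    intro i j; simp
  have h0 := hl (Pi.single i 1 + Pi.single j 1)
  have h1 := hl (Pi.single i 1 - Pi.single j 1)
  have h2 := hu (Pi.single i 1)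
  have h3 := hu (Pi.single j 1)
  simp only [Matrix.mulVec_add, Matrix.mulVec_sub, sub_dotProduct, dotProduct_sub, add_dotProduct,
    dotProduct_add, hii, hs.apply i j] at h0 h1 h2 h3
  simp at h2 h3
  rw [abs_le]
  constructor <;> linarith

/-- A differentiable function that is bounded together with its derivative. -/
def BddDeriv {d : ℕ} (f : Space d → ℝ) : Prop :=
  Differentiable ℝ f ∧ ∃ C, ∀ x, |f x| ≤ C ∧ ‖fderiv ℝ f x‖ ≤ C

namespace BddDeriv
variable {d : ℕ} {f h : Space d → ℝ}

lemma const (c : ℝ) : BddDeriv (fun _ : Space d => c) :=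
  ⟨differentiable_const _, |c|, fun x => ⟨le_rfl, by simp⟩⟩

lemma add (hf : BddDeriv f) (hh : BddDeriv h) : BddDeriv (fun x => f x + h x) := by
  obtain ⟨h1, C, hC⟩ := hf
  obtain ⟨h2, D, hD⟩ := hh
  refine ⟨h1.add h2, C + D, fun x => ⟨(abs_add_le _ _).trans (add_le_add (hC x).1 (hD x).1), ?_⟩⟩
  rw [fderiv_fun_add (h1 x) (h2 x)]
  exact (norm_add_le _ _).trans (add_le_add (hC x).2 (hD x).2)

lemma mul (hf : BddDeriv f) (hh : BddDeriv h) : BddDeriv (fun x => f x * h x) := by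
  obtain ⟨h1, C, hC⟩ := hf
  obtain ⟨h2, D, hD⟩ := hh
  have hC0 : ∀ x : Space d, 0 ≤ C := fun x => (abs_nonneg _).trans (hC x).1
  refine ⟨h1.mul h2, C * D + C * D, fun x => ⟨?_, ?_⟩⟩
  · have hD0 : 0 ≤ D := (abs_nonneg _).trans (hD x).1
    rw [abs_mul]
    have := mul_le_mul (hC x).1 (hD x).1 (abs_nonneg _) (hC0 x)
    nlinarith [mul_nonneg (hC0 x) hD0]
  · rw [fderiv_fun_mul (h1 x) (h2 x)]
    refine (norm_add_le _ _).trans (add_le_add ?_ ?_)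
    · rw [norm_smul]; exact mul_le_mul (hC x).1 (hD x).2 (norm_nonneg _) (hC0 x)
    · rw [norm_smul, mul_comm]
      exact mul_le_mul (hC x).2 (hD x).1 (norm_nonneg _) (hC0 x)

lemma prod {ι : Type*} (s : Finset ι) {F : ι → Space d → ℝ} (hF : ∀ i, BddDeriv (F i)) :
    BddDeriv (fun x => ∏ i ∈ s, F i x) := by
  classical
  induction s using Finset.induction_on with
  | empty => simpa using const 1
  | insert a s ha ih => simpa only [Finset.prod_insert ha] using (hF a).mul ih

lemma sum {ι : Type*} (s : Finset ι) {F : ι → Space d → ℝ} (hF : ∀ i, BddDeriv (F i)) :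
    BddDeriv (fun x => ∑ i ∈ s, F i x) := by
  classical
  induction s using Finset.induction_on with
  | empty => simpa using const 0
  | insert a s ha ih => simpa only [Finset.sum_insert ha] using (hF a).add ih

lemma det {M : Space d → Matrix (Fin d) (Fin d) ℝ} (h : ∀ j k, BddDeriv (fun x => M x j k)) :
    BddDeriv (fun x => (M x).det) := by
  simp only [Matrix.det_apply']
  exact sum _ fun σ => (const _).mul (prod _ fun i => h _ _)

end BddDeriv

namespace Metric

variable {d : ℕ} (g : Metric d)

/-- The quadratic form `∑ g_{jk}(x) z_j z_k`. -/
noncomputable def quad (x z : Space d) : ℝ := ∑ j, ∑ k, g.mat x j k * z j * z k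

/-- The first order coefficients `∑_j |g|⁻¹ ∂_j (g^{jk} |g|)` of the Laplace-Beltrami operator. -/
noncomputable def drift (k : Fin d) (x : Space d) : ℝ :=
  ∑ j, (g.density x)⁻¹ * partialDeriv j (fun y => g.inv j k y * g.density y) x

/-- Uniform bounds for the coefficients of the Laplace-Beltrami operator. -/
structure Bounds (C : ℝ) : Prop where
  one_le : 1 ≤ C
  inv_form : ∀ (x : Space d) (v : Fin d → ℝ), 0 ≤ ∑ j, ∑ k, g.inv j k x * v j * v k
  inv_form_lower : ∀ (x : Space d) (v : Fin d → ℝ),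
    ∑ j, v j ^ 2 ≤ C * ∑ j, ∑ k, g.inv j k x * v j * v k
  inv_form_upper : ∀ (x : Space d) (v : Fin d → ℝ),
    ∑ j, ∑ k, g.inv j k x * v j * v k ≤ C * ∑ j, v j ^ 2
  quad_lower : ∀ x z, C⁻¹ * ‖z‖ ^ 2 ≤ g.quad x z
  quad_upper : ∀ x z, g.quad x z ≤ C * ‖z‖ ^ 2
  mat_le : ∀ x j k, |g.mat x j k| ≤ C
  inv_le : ∀ j k x, |g.inv j k x| ≤ C
  inv_lipschitz : ∀ j k x y, |g.inv j k x - g.inv j k y| ≤ C * ‖x - y‖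
  density_lower : ∀ x, C⁻¹ ≤ g.density x
  density_upper : ∀ x, g.density x ≤ C
  drift_le : ∀ k x, |g.drift k x| ≤ C

variable {g}

lemma mat_symm (x : Space d) (j k : Fin d) : g.mat x j k = g.mat x k j := by
  have := (g.posDef x).isHermitian.apply k j
  simpa using this

lemma mat_isSymm (x : Space d) : (g.mat x).IsSymm := by
  ext j k; exact mat_symm x k j

lemma inv_isSymm (x : Space d) : ((g.mat x)⁻¹).IsSymm := by
  rw [Matrix.IsSymm, Matrix.transpose_nonsing_inv, (mat_isSymm x).eq]

lemma inv_symm (j k : Fin d) (x : Space d) : g.inv j k x = g.inv k j x :=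
  (inv_isSymm x).apply k j

lemma isUnit_det (x : Space d) : IsUnit (g.mat x).det := (g.posDef x).det_pos.ne'.isUnit

lemma sum_inv_mul_mat (x : Space d) (j l : Fin d) :
    ∑ k, g.inv j k x * g.mat x k l = (1 : Matrix (Fin d) (Fin d) ℝ) j l := by
  rw [← Matrix.nonsing_inv_mul _ (isUnit_det x)]; rfl

lemma form_eq (M : Matrix (Fin d) (Fin d) ℝ) (v : Fin d → ℝ) :
    ∑ j, ∑ k, M j k * v j * v k = v ⬝ᵥ M.mulVec v := by
  simp only [dotProduct, Matrix.mulVec, Finset.mul_sum]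
  exact Finset.sum_congr rfl fun j _ => Finset.sum_congr rfl fun k _ => by ring

lemma norm_sq_eq_dotProduct (z : Space d) : ‖z‖ ^ 2 = (z : Fin d → ℝ) ⬝ᵥ z := by
  rw [EuclideanSpace.norm_sq_eq]
  simp [dotProduct, pow_two]

/-- Ellipticity controls the zeroth order quantities. Of the long-range condition only the first
derivatives are used, and only their boundedness, as the weight is at most `1`. -/
theorem exists_bounds (hell : g.IsElliptic) (hlong : g.IsLongRange) : ∃ C, g.Bounds C := by
  obtain ⟨C₀, hC₀, hell⟩ := hell
  have hl : ∀ x (ξ : Fin d → ℝ), C₀⁻¹ * (ξ ⬝ᵥ ξ) ≤ ξ ⬝ᵥ (g.mat x)⁻¹.mulVec ξ := fun x ξ => by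
    have := (hell x (WithLp.toLp 2 ξ)).1
    rw [norm_sq_eq_dotProduct] at this
    rw [← form_eq]; exact this
  have hu : ∀ x (ξ : Fin d → ℝ), ξ ⬝ᵥ (g.mat x)⁻¹.mulVec ξ ≤ C₀ * (ξ ⬝ᵥ ξ) := fun x ξ => by
    have := (hell x (WithLp.toLp 2 ξ)).2
    rw [norm_sq_eq_dotProduct] at this
    rw [← form_eq]; exact this
  have hl0 : ∀ x (ξ : Fin d → ℝ), 0 ≤ ξ ⬝ᵥ (g.mat x)⁻¹.mulVec ξ := fun x ξ =>
    le_trans (by have := dotProduct_self_nonneg ξ; positivity) (hl x ξ)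
  have hq := fun x => mul_self_le_of_matrix_form (inv_isSymm (g := g) x)
    (Matrix.nonsing_inv_mul _ (isUnit_det x)) hC₀ (hl x) (hu x)
  have hinv : ∀ j k x, |g.inv j k x| ≤ C₀ := fun j k x =>
    abs_entry_le_of_matrix_form (inv_isSymm x) (hl0 x) (hu x) j k
  have hmat : ∀ x j k, |g.mat x j k| ≤ C₀ := fun x j k =>
    abs_entry_le_of_matrix_form (mat_isSymm x) (fun v =>
      le_trans (by have := dotProduct_self_nonneg v; positivity) (hq x v).1)
      (fun v => (hq x v).2) j k
  -- determinants
  obtain ⟨D, hD1, hDi, hDm⟩ : ∃ D : ℝ, 0 < D ∧ (∀ x, |((g.mat x)⁻¹).det| ≤ D) ∧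
      ∀ x, |(g.mat x).det| ≤ D := by
    refine ⟨(Fintype.card (Fin d)).factorial • C₀ ^ Fintype.card (Fin d), by positivity, ?_, ?_⟩
    · exact fun x => Matrix.det_le (abv := IsAbsoluteValue.toAbsoluteValue (abs : ℝ → ℝ))
        (fun j k => hinv j k x)
    · exact fun x => Matrix.det_le (abv := IsAbsoluteValue.toAbsoluteValue (abs : ℝ → ℝ))
        (fun j k => hmat x j k)
  have hdet : ∀ x, (g.mat x).det * ((g.mat x)⁻¹).det = 1 := fun x => by
    rw [← Matrix.det_mul, Matrix.mul_nonsing_inv _ (isUnit_det x), Matrix.det_one]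
  have hdpos : ∀ x, 0 < (g.mat x).det := fun x => (g.posDef x).det_pos
  have hdipos : ∀ x, 0 < ((g.mat x)⁻¹).det := fun x => by
    have := hdet x; have h2 := hdpos x
    by_contra h; push Not at h; nlinarith
  have hρ2 : ∀ x, g.density x ^ 2 = (g.mat x).det := fun x => Real.sq_sqrt (hdpos x).le
  -- derivatives
  obtain ⟨ρ, hρ, hlong⟩ := hlong
  obtain ⟨C₁, hC₁, h1⟩ := hlong 1
  have hdiff : ∀ j k, Differentiable ℝ (g.inv j k) := fun j k =>
    (g.contDiff_inv j k).differentiable (by simp)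
  have hfd : ∀ j k x, ‖fderiv ℝ (g.inv j k) x‖ ≤ C₁ := by
    intro j k x
    have h2 := h1 j k x
    rw [norm_iteratedFDeriv_one, fderiv_sub_const] at h2
    refine h2.trans ?_
    have : Real.sqrt (1 + ‖x‖ ^ 2) ^ (-ρ - ((1 : ℕ) : ℝ)) ≤ 1 :=
      Real.rpow_le_one_of_one_le_of_nonpos (Real.one_le_sqrt.2 (by nlinarith [sq_nonneg ‖x‖]))
        (by simp; linarith)
    nlinarith
  have hbd : ∀ j k, BddDeriv (g.inv j k) := fun j k =>
    ⟨hdiff j k, max C₀ C₁, fun x => ⟨(hinv j k x).trans (le_max_left _ _),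
      (hfd j k x).trans (le_max_right _ _)⟩⟩
  have hbdet : BddDeriv (fun x => ((g.mat x)⁻¹).det) := BddDeriv.det hbd
  obtain ⟨hm1, E, hE⟩ := hbdet
  have hE0 : 0 ≤ E := (norm_nonneg _).trans (hE 0).2
  have hρd : Differentiable ℝ g.density := g.contDiff_density.differentiable (by simp)
  -- The logarithmic derivative of the density is read off by differentiating `ρ² det g⁻¹ = 1`,
  -- which gives `ρ⁻¹ dρ = -½ det g · d(det g⁻¹)`. The derivatives of `g_{jk}` never appear, only
  -- those of `g^{jk}`.
  have hlog : ∀ x, ‖(g.density x)⁻¹ • fderiv ℝ g.density x‖ ≤ D * E := by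
    intro x
    have e1 : (fun y => g.density y * g.density y * ((g.mat y)⁻¹).det) = fun _ => 1 := by
      ext y; rw [← pow_two, hρ2, hdet]
    have e2 := congrArg (fun F => fderiv ℝ F x) e1
    simp only [fderiv_fun_const, Pi.zero_apply] at e2
    have e0 : DifferentiableAt ℝ (fun y => g.density y * g.density y) x := (hρd x).mul (hρd x)
    rw [fderiv_fun_mul e0 (hm1 x), fderiv_fun_mul (hρd x) (hρd x)] at e2
    have hp := g.density_pos x
    have e3 : (g.density x)⁻¹ • fderiv ℝ g.density x =
        (-(2⁻¹ * (g.mat x).det)) • fderiv ℝ (fun y => ((g.mat y)⁻¹).det) x := by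
      ext v
      have e4 := congrArg (fun L : Space d →L[ℝ] ℝ => L v) e2
      simp only [add_apply, smul_apply, smul_eq_mul, zero_apply] at e4 ⊢
      have e5 := hdet x
      have e6 := hρ2 x
      rw [inv_mul_eq_iff_eq_mul₀ hp.ne']
      have e7 : g.density x * ((g.mat x)⁻¹).det ≠ 0 := (mul_pos hp (hdipos x)).ne'
      apply mul_left_cancel₀ e7
      rw [← e6] at e5 ⊢
      linear_combination (1/2) * e4 + (g.density x) ^ 2 * (1/2) * (fderiv ℝ (fun y => ((g.mat y)⁻¹).det) x) v * e5
    rw [e3, norm_smul, norm_neg, norm_mul]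
    have e8 := hDm x
    have : ‖(2⁻¹ : ℝ)‖ * ‖(g.mat x).det‖ ≤ D := by
      rw [Real.norm_eq_abs (g.mat x).det]
      norm_num
      nlinarith [abs_nonneg (g.mat x).det]
    exact mul_le_mul this (hE x).2 (norm_nonneg _) hD1.le
  have hdrift : ∀ k x, |g.drift k x| ≤ d * (C₁ + C₀ * (D * E)) := by
    intro k x
    have hp := g.density_pos x
    have : ∀ j : Fin d, |(g.density x)⁻¹ * partialDeriv j (fun y => g.inv j k y * g.density y) x|
        ≤ C₁ + C₀ * (D * E) := by
      intro j
      have hs : ‖(EuclideanSpace.single j (1 : ℝ) : Space d)‖ = 1 := by simp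
      have e1 : (g.density x)⁻¹ * partialDeriv j (fun y => g.inv j k y * g.density y) x =
          fderiv ℝ (g.inv j k) x (EuclideanSpace.single j 1) + g.inv j k x *
            ((g.density x)⁻¹ • fderiv ℝ g.density x) (EuclideanSpace.single j 1) := by
        simp only [partialDeriv]
        rw [fderiv_fun_mul (hdiff j k x) (hρd x)]
        simp only [add_apply, smul_apply, smul_eq_mul]
        field_simp
        ring
      rw [e1]
      refine (abs_add_le _ _).trans (add_le_add ?_ ?_)
      · rw [← Real.norm_eq_abs]
        refine (ContinuousLinearMap.le_opNorm _ _).trans ?_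
        rw [hs, mul_one]; exact hfd j k x
      · rw [abs_mul]
        refine mul_le_mul (hinv j k x) ?_ (abs_nonneg _) hC₀.le
        rw [← Real.norm_eq_abs]
        refine (ContinuousLinearMap.le_opNorm _ _).trans ?_
        rw [hs, mul_one]; exact hlog x
    refine (Finset.abs_sum_le_sum_abs _ _).trans ((Finset.sum_le_sum fun j _ => this j).trans ?_)
    simp [mul_add]
  set F := d * (C₁ + C₀ * (D * E)) with hF
  have hDs : ∀ x, (1 + D)⁻¹ ≤ g.density x ∧ g.density x ≤ 1 + D := by
    intro x
    have hp := g.density_pos x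
    have h3 := hDm x
    have h4 := hDi x
    rw [abs_of_pos (hdpos x)] at h3
    rw [abs_of_pos (hdipos x)] at h4
    have h5 := hdet x
    have h6 := hρ2 x
    have h7 : 1 ≤ g.density x ^ 2 * D := by
      rw [h6]; nlinarith [hdpos x]
    constructor
    · rw [inv_le_iff_one_le_mul₀ (by positivity)]
      by_contra h
      push Not at h
      have : g.density x * D < 1 := by nlinarith
      have : g.density x < 1 := by nlinarith
      nlinarith
    · nlinarith
  refine ⟨1 + C₀ + C₁ + (1 + D) + F, ?_⟩
  have hF0 : 0 ≤ F := by positivity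
  have hle : C₀ ≤ 1 + C₀ + C₁ + (1 + D) + F := by linarith
  have hle1 : C₁ ≤ 1 + C₀ + C₁ + (1 + D) + F := by linarith
  have hleD : 1 + D ≤ 1 + C₀ + C₁ + (1 + D) + F := by linarith
  have hleF : F ≤ 1 + C₀ + C₁ + (1 + D) + F := by linarith
  have hsq : ∀ v : Fin d → ℝ, ∑ j, v j ^ 2 = v ⬝ᵥ v := fun v => by simp [dotProduct, pow_two]
  constructor
  · linarith
  · intro x v
    have := hl0 x v
    rwa [← form_eq] at this
  · intro x v
    have h2 := hl0 x v
    have h3 := hl x v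
    rw [inv_mul_le_iff₀ hC₀] at h3
    rw [hsq]
    refine h3.trans ?_
    rw [← form_eq] at h2 ⊢
    exact mul_le_mul_of_nonneg_right hle h2
  · intro x v
    have h2 := hu x v
    rw [← form_eq, ← hsq] at h2
    exact h2.trans (mul_le_mul_of_nonneg_right hle (by positivity))
  · intro x z
    have h2 := (hq x z).1
    rw [← form_eq, ← norm_sq_eq_dotProduct] at h2
    exact le_trans (by gcongr) h2
  · intro x z
    have h2 := (hq x z).2
    rw [← form_eq, ← norm_sq_eq_dotProduct] at h2
    exact h2.trans (by gcongr)
  · exact fun x j k => (hmat x j k).trans hle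
  · exact fun j k x => (hinv j k x).trans hle
  · intro j k x y
    have := Convex.norm_image_sub_le_of_norm_fderiv_le (f := g.inv j k) (s := Set.univ)
      (fun z _ => hdiff j k z) (fun z _ => hfd j k z) convex_univ (Set.mem_univ y) (Set.mem_univ x)
    exact this.trans (by gcongr)
  · exact fun x => le_trans (inv_anti₀ (by positivity) hleD) (hDs x).1
  · exact fun x => (hDs x).2.trans hleD
  · exact fun k x => (hdrift k x).trans hleF

end Metric
end HeatKernel

/-! ### Green's formula, symmetry and positivity -/

namespace HeatKernel

local notation "⟪" x ", " y "⟫" => inner ℂ x y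

open ComplexConjugate

lemma partialDeriv_conj {d : ℕ} (j : Fin d) {φ : Space d → ℂ} {x : Space d}
    (h : DifferentiableAt ℝ φ x) :
    partialDeriv j (fun y => conj (φ y)) x = conj (partialDeriv j φ x) := by
  have := (Complex.conjCLE.toContinuousLinearMap.hasFDerivAt (x := φ x)).comp x h.hasFDerivAt
  simp only [partialDeriv]
  have e : fderiv ℝ (fun y => conj (φ y)) x = _ := this.fderiv
  rw [e]; rfl

lemma partialDeriv_ofReal_mul {d : ℕ} (j : Fin d) {η : Space d → ℝ} {φ : Space d → ℂ} {x : Space d}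
    (hη : DifferentiableAt ℝ η x) (h : DifferentiableAt ℝ φ x) :
    partialDeriv j (fun y => (η y : ℂ) * φ y) x =
      ((partialDeriv j η x : ℝ) : ℂ) * φ x + η x * partialDeriv j φ x := by
  have e : (fun y => (η y : ℂ) * φ y) = fun y => η y • φ y := by ext y; simp
  rw [e]
  simp only [partialDeriv]
  rw [fderiv_fun_smul hη h]
  simp
  ring

namespace Metric

variable {d : ℕ} {g : Metric d}

lemma integral_vol {E : Type*} [NormedAddCommGroup E] [NormedSpace ℝ E] (f : Space d → E) :
    ∫ x, f x ∂g.vol = ∫ x, g.density x • f x := by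
  rw [vol, integral_withDensity_eq_integral_toReal_smul
    g.contDiff_density.continuous.measurable.ennreal_ofReal (by simp)]
  simp only [ENNReal.toReal_ofReal (g.density_pos _).le]

lemma hasCompactSupport_partialDeriv {φ : Space d → ℂ} (h : HasCompactSupport φ) (k : Fin d) :
    HasCompactSupport (partialDeriv k φ) := h.fderiv_apply ℝ _

/-- Green's formula. -/
lemma integral_minusLaplace_mul {φ : Space d → ℂ} (hφ : φ ∈ testFunctions d) {ψ : Space d → ℂ}
    (hψ : ContDiff ℝ 1 ψ) :
    ∫ x, -g.laplaceBeltrami φ x * ψ x ∂g.vol =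
      ∫ x, ∑ j, ∑ k, (g.inv j k x : ℂ) * partialDeriv k φ x * partialDeriv j ψ x ∂g.vol := by
  rw [integral_vol, integral_vol]
  let F : Fin d → Fin d → Space d → ℂ := fun j k y => (g.inv j k y * g.density y) • partialDeriv k φ y
  have hF : ∀ j k, ContDiff ℝ ∞ (F j k) := fun j k => g.contDiff_flux j k hφ.1
  have hFc : ∀ j k, HasCompactSupport (F j k) := fun j k =>
    (hasCompactSupport_partialDeriv hφ.2 k).smul_left (f := fun y => g.inv j k y * g.density y)
  have hFd : ∀ j k, Continuous (partialDeriv j (F j k)) := fun j k =>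
    (contDiff_partialDeriv j (hF j k)).continuous
  have hψd : ∀ j, Continuous (partialDeriv j ψ) := fun j =>
    (hψ.continuous_fderiv one_ne_zero).clm_apply continuous_const
  have i1 : ∀ j k, Integrable (fun x => partialDeriv j (F j k) x * ψ x) := fun j k =>
    ((hFd j k).mul hψ.continuous).integrable_of_hasCompactSupport
      (hasCompactSupport_partialDeriv (hFc j k) j).mul_right
  have i1n : ∀ j k, Integrable (fun x => -(partialDeriv j (F j k) x * ψ x)) := fun j k => (i1 j k).neg
  have i2 : ∀ j k, Integrable (fun x => F j k x * partialDeriv j ψ x) := fun j k =>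
    ((hF j k).continuous.mul (hψd j)).integrable_of_hasCompactSupport (hFc j k).mul_right
  have i3 : ∀ j k, Integrable (fun x => F j k x * ψ x) := fun j k =>
    ((hF j k).continuous.mul hψ.continuous).integrable_of_hasCompactSupport (hFc j k).mul_right
  have h1 : ∀ j k, ∫ x, F j k x * partialDeriv j ψ x = -∫ x, partialDeriv j (F j k) x * ψ x :=
    fun j k => integral_mul_fderiv_eq_neg_fderiv_mul_of_integrable (i1 j k) (i2 j k) (i3 j k)
      (fun x _ => (hF j k).differentiable (by simp) x) (fun x _ => hψ.differentiable (by simp) x)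
  have e1 : ∀ x, g.density x • (-g.laplaceBeltrami φ x * ψ x) =
      ∑ j, ∑ k, -(partialDeriv j (F j k) x * ψ x) := by
    intro x
    have hp := (g.density_pos x).ne'
    simp only [laplaceBeltrami, Complex.real_smul, neg_mul, mul_neg, Finset.sum_neg_distrib,
      Finset.mul_sum, Finset.sum_mul]
    congr 1
    refine Finset.sum_congr rfl fun j _ => Finset.sum_congr rfl fun k _ => ?_
    have : (g.density x : ℂ) ≠ 0 := by exact_mod_cast hp
    rw [← mul_assoc, ← mul_assoc, Complex.ofReal_inv, mul_inv_cancel₀ this, one_mul]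
    simp only [F, Complex.real_smul]
  have e2 : ∀ x, g.density x • (∑ j, ∑ k, (g.inv j k x : ℂ) * partialDeriv k φ x *
      partialDeriv j ψ x) = ∑ j, ∑ k, F j k x * partialDeriv j ψ x := by
    intro x
    simp only [F, Finset.smul_sum, Complex.real_smul]
    refine Finset.sum_congr rfl fun j _ => Finset.sum_congr rfl fun k _ => ?_
    push_cast; ring
  simp only [e1, e2]
  rw [integral_finsetSum _ fun j _ => integrable_finsetSum _ fun k _ => i1n j k,
    integral_finsetSum _ fun j _ => integrable_finsetSum _ fun k _ => i2 j k]
  refine Finset.sum_congr rfl fun j _ => ?_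
  rw [integral_finsetSum _ fun k _ => i1n j k, integral_finsetSum _ fun k _ => i2 j k]
  refine Finset.sum_congr rfl fun k _ => ?_
  rw [integral_neg, h1]

/-- The inner product of covectors. -/
noncomputable def form (g : Metric d) (x : Space d) (a b : Fin d → ℝ) : ℝ :=
  ∑ j, ∑ k, g.inv j k x * a j * b k

lemma form_comm (x : Space d) (a b : Fin d → ℝ) : g.form x a b = g.form x b a := by
  simp only [form]
  rw [Finset.sum_comm]
  refine Finset.sum_congr rfl fun j _ => Finset.sum_congr rfl fun k _ => ?_
  rw [inv_symm]; ring

lemma form_add_left (x : Space d) (a b c : Fin d → ℝ) :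
    g.form x (a + b) c = g.form x a c + g.form x b c := by
  simp only [form, ← Finset.sum_add_distrib, Pi.add_apply]
  refine Finset.sum_congr rfl fun j _ => Finset.sum_congr rfl fun k _ => by ring

lemma form_smul_left (x : Space d) (s : ℝ) (a c : Fin d → ℝ) :
    g.form x (s • a) c = s * g.form x a c := by
  simp only [form, Finset.mul_sum, Pi.smul_apply, smul_eq_mul]
  refine Finset.sum_congr rfl fun j _ => Finset.sum_congr rfl fun k _ => by ring

lemma form_add_right (x : Space d) (a b c : Fin d → ℝ) :
    g.form x a (b + c) = g.form x a b + g.form x a c := by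
  rw [form_comm, form_add_left, form_comm x b, form_comm x c]

lemma form_smul_right (x : Space d) (s : ℝ) (a c : Fin d → ℝ) :
    g.form x a (s • c) = s * g.form x a c := by
  rw [form_comm, form_smul_left, form_comm]

/-- Real part of the gradient. -/
noncomputable def gradRe (φ : Space d → ℂ) (x : Space d) : Fin d → ℝ := fun k => (partialDeriv k φ x).re

/-- Imaginary part of the gradient. -/
noncomputable def gradIm (φ : Space d → ℂ) (x : Space d) : Fin d → ℝ := fun k => (partialDeriv k φ x).im

/-- `|∇φ|²`. -/
noncomputable def energyDensity (g : Metric d) (φ : Space d → ℂ) (x : Space d) : ℝ :=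
  g.form x (gradRe φ x) (gradRe φ x) + g.form x (gradIm φ x) (gradIm φ x)

/-- Half of the gradient of `|φ|²`. -/
noncomputable def gradSq (φ : Space d → ℂ) (x : Space d) : Fin d → ℝ :=
  (φ x).re • gradRe φ x + (φ x).im • gradIm φ x

lemma integrable_of_partialDeriv_mul {φ : Space d → ℂ} (hφ : φ ∈ testFunctions d)
    {ψ : Fin d → Space d → ℂ} (hψ : ∀ j, Continuous (ψ j)) :
    Integrable (fun x => ∑ j, ∑ k, (g.inv j k x : ℂ) * partialDeriv k φ x * ψ j x) g.vol := by
  refine integrable_finsetSum _ fun j _ => integrable_finsetSum _ fun k _ => ?_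
  refine Continuous.integrable_of_hasCompactSupport ?_ ?_
  · exact ((Complex.continuous_ofReal.comp (g.contDiff_inv j k).continuous).mul
      (contDiff_partialDeriv k hφ.1).continuous).mul (hψ j)
  · exact (HasCompactSupport.mul_left (hasCompactSupport_partialDeriv hφ.2 k)).mul_right

/-- Since `Re (conj φ ∂_k φ)` is half of `∂_k |φ|²`, the gradient of the weight is paired only with
`gradSq`. Both the exponential weight and the regularised phase are instances of this identity. -/
lemma re_green_integrand {φ : Space d → ℂ} (hφ : φ ∈ testFunctions d) {η : Space d → ℝ}
    (hη : ContDiff ℝ 1 η) (x : Space d) :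
    (∑ j, ∑ k, (g.inv j k x : ℂ) * partialDeriv k φ x *
      partialDeriv j (fun x => conj ((η x : ℂ) * φ x)) x).re =
      η x * g.energyDensity φ x + g.form x (gradSq φ x) (fun j => partialDeriv j η x) := by
  have hφ1 : ContDiff ℝ 1 φ := hφ.1.of_le (by simp)
  have hd1 : DifferentiableAt ℝ η x := hη.differentiable (by simp) x
  have hd2 : DifferentiableAt ℝ φ x := hφ1.differentiable (by simp) x
  have hd3 : DifferentiableAt ℝ (fun y => (η y : ℂ) * φ y) x :=
    ((Complex.ofRealCLM.contDiff.comp hη).mul hφ1).differentiable (by simp) x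
  simp only [partialDeriv_conj _ hd3, partialDeriv_ofReal_mul _ hd1 hd2, energyDensity]
  rw [form_comm x (gradSq φ x)]
  simp only [form, gradSq, gradRe, gradIm, Finset.mul_sum, ← Finset.sum_add_distrib, Complex.re_sum]
  refine Finset.sum_congr rfl fun j _ => Finset.sum_congr rfl fun k _ => ?_
  simp [gradRe, gradIm]
  ring

lemma integrable_green {φ : Space d → ℂ} (hφ : φ ∈ testFunctions d) {ψ : Space d → ℂ}
    (hψ : ContDiff ℝ 1 ψ) :
    Integrable (fun x => ∑ j, ∑ k, (g.inv j k x : ℂ) * partialDeriv k φ x * partialDeriv j ψ x)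
      g.vol :=
  integrable_of_partialDeriv_mul hφ fun _ =>
    (hψ.continuous_fderiv one_ne_zero).clm_apply continuous_const

lemma contDiff_conj_mul {φ : Space d → ℂ} (hφ : φ ∈ testFunctions d) {η : Space d → ℝ}
    (hη : ContDiff ℝ 1 η) : ContDiff ℝ 1 (fun x => conj ((η x : ℂ) * φ x)) :=
  Complex.conjCLE.contDiff.comp
    ((Complex.ofRealCLM.contDiff.comp hη).mul (hφ.1.of_le (by simp)))

lemma integrable_green_re {φ : Space d → ℂ} (hφ : φ ∈ testFunctions d) {η : Space d → ℝ}
    (hη : ContDiff ℝ 1 η) :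
    Integrable (fun x => η x * g.energyDensity φ x +
      g.form x (gradSq φ x) (fun j => partialDeriv j η x)) g.vol := by
  have := (integrable_green (g := g) hφ (contDiff_conj_mul hφ hη)).re
  simpa only [RCLike.re_to_complex, re_green_integrand hφ hη] using this

lemma integrable_energyDensity {φ : Space d → ℂ} (hφ : φ ∈ testFunctions d) :
    Integrable (g.energyDensity φ) g.vol := by
  have := integrable_green_re (g := g) hφ (η := fun _ => 1) contDiff_const
  simpa [partialDeriv, form] using this

lemma re_integral_minusLaplace {φ : Space d → ℂ} (hφ : φ ∈ testFunctions d) {η : Space d → ℝ}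
    (hη : ContDiff ℝ 1 η) :
    (∫ x, -g.laplaceBeltrami φ x * conj ((η x : ℂ) * φ x) ∂g.vol).re =
      ∫ x, (η x * g.energyDensity φ x +
        g.form x (gradSq φ x) (fun j => partialDeriv j η x)) ∂g.vol := by
  have hψ := contDiff_conj_mul hφ hη
  rw [integral_minusLaplace_mul hφ hψ]
  have := integral_re (integrable_green (g := g) hφ hψ)
  simp only [RCLike.re_to_complex, re_green_integrand hφ hη] at this
  exact this.symm

/-- The gradient of `|φ|²` is bounded by `2 |φ| |∇φ|`. -/
lemma form_gradSq_le (C : ℝ) (h : g.Bounds C) (φ : Space d → ℂ) (x : Space d) :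
    g.form x (gradSq φ x) (gradSq φ x) ≤ Complex.normSq (φ x) * g.energyDensity φ x := by
  -- The vectors `Re φ ∇Re φ + Im φ ∇Im φ` and `Re φ ∇Im φ - Im φ ∇Re φ` have squares that add up to
  -- `|φ|² |∇φ|²`; the second square is discarded.
  have h0 := h.inv_form x ((φ x).re • gradIm φ x + (-(φ x).im) • gradRe φ x)
  change 0 ≤ g.form x _ _ at h0
  simp only [gradSq, energyDensity, form_add_left, form_add_right, form_smul_left, form_smul_right,
    form_comm x (gradIm φ x) (gradRe φ x), Complex.normSq_apply] at h0 ⊢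
  linarith

lemma energyDensity_nonneg {C : ℝ} (h : g.Bounds C) (φ : Space d → ℂ) (x : Space d) :
    0 ≤ g.energyDensity φ x := add_nonneg (h.inv_form x _) (h.inv_form x _)

lemma mem_minusLaplace_graph {p : g.L2 × g.L2} :
    p ∈ g.minusLaplace.graph ↔ ∃ φ : testFunctions d,
      p = (g.testToL2 φ, g.testToL2 (g.minusLaplaceTest φ)) := by
  rw [LinearPMap.mem_graph_iff]
  have key : ∀ φ : testFunctions d,
      g.minusLaplace ⟨g.testToL2 φ, LinearMap.mem_range_self _ φ⟩ =
        g.testToL2 (g.minusLaplaceTest φ) := fun φ =>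
    congrArg (fun ψ => g.testToL2 (g.minusLaplaceTest ψ))
      ((LinearEquiv.ofInjective g.testToL2 g.testToL2_injective).symm_apply_apply φ)
  constructor
  · rintro ⟨⟨_, φ, rfl⟩, h1, h2⟩
    exact ⟨φ, Prod.ext h1.symm (h2.symm.trans (key φ))⟩
  · rintro ⟨φ, rfl⟩
    exact ⟨⟨_, φ, rfl⟩, rfl, key φ⟩

lemma testToL2_ae (φ : testFunctions d) : g.testToL2 φ =ᵐ[g.vol] (φ : Space d → ℂ) :=
  MemLp.coeFn_toLp (g.memLp_test φ)

lemma inner_minusLaplaceTest (φ : testFunctions d) {V : g.L2} {v : Space d → ℂ}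
    (hV : V =ᵐ[g.vol] v) :
    ⟪V, g.testToL2 (g.minusLaplaceTest φ)⟫ =
      ∫ x, -g.laplaceBeltrami φ x * conj (v x) ∂g.vol := by
  rw [L2.inner_def]
  refine integral_congr_ae ?_
  filter_upwards [hV, testToL2_ae (g.minusLaplaceTest φ)] with x h1 h2
  rw [h1, h2, RCLike.inner_apply]
  rfl

lemma minusLaplace_symmetric : g.minusLaplace.IsFormalAdjoint g.minusLaplace := by
  have key : ∀ φ ψ : testFunctions d, ⟪g.testToL2 φ, g.testToL2 (g.minusLaplaceTest ψ)⟫ =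
      ∫ x, ∑ j, ∑ k, (g.inv j k x : ℂ) * partialDeriv k (ψ : Space d → ℂ) x *
        conj (partialDeriv j (φ : Space d → ℂ) x) ∂g.vol := by
    intro φ ψ
    have hc : ContDiff ℝ 1 (fun x => conj ((φ : Space d → ℂ) x)) :=
      Complex.conjCLE.contDiff.comp (φ.2.1.of_le (by simp))
    rw [inner_minusLaplaceTest ψ (testToL2_ae φ), integral_minusLaplace_mul ψ.2 hc]
    refine integral_congr_ae (Eventually.of_forall fun x => ?_)
    simp only [partialDeriv_conj _ (φ.2.1.differentiable (by simp) x)]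
  intro x y
  obtain ⟨φ, hφ⟩ := mem_minusLaplace_graph.1 (g.minusLaplace.mem_graph x)
  obtain ⟨ψ, hψ⟩ := mem_minusLaplace_graph.1 (g.minusLaplace.mem_graph y)
  rw [Prod.ext_iff] at hφ hψ
  simp only at hφ hψ
  rw [hφ.1, hφ.2, hψ.1, hψ.2, key, ← inner_conj_symm, key, ← integral_conj]
  refine integral_congr_ae (Eventually.of_forall fun x => ?_)
  simp only [map_sum, map_mul, Complex.conj_conj, Complex.conj_ofReal]
  rw [Finset.sum_comm]
  refine Finset.sum_congr rfl fun j _ => Finset.sum_congr rfl fun k _ => ?_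
  rw [inv_symm]; ring

/-- Real test functions, as complex valued functions. -/
def ofRealTest {f : Space d → ℝ} (h1 : ContDiff ℝ ∞ f) (h2 : HasCompactSupport f) : testFunctions d :=
  ⟨fun x => (f x : ℂ), Complex.ofRealCLM.contDiff.comp h1,
    h2.comp_left (g := fun r : ℝ => (r : ℂ)) Complex.ofReal_zero⟩

lemma dense_minusLaplace_domain : Dense (g.minusLaplace.domain : Set g.L2) := by
  rw [Submodule.dense_iff_topologicalClosure_eq_top, Submodule.topologicalClosure_eq_top_iff,
    Submodule.eq_bot_iff]
  intro u hu
  have hloc : LocallyIntegrable (fun x => u x) g.vol :=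
    (Lp.memLp u).locallyIntegrable (by norm_num)
  have h0 := ae_eq_zero_of_integral_contDiff_smul_eq_zero hloc fun f h1 h2 => by
    have h3 := (Submodule.mem_orthogonal _ u).1 hu (g.testToL2 (ofRealTest h1 h2)) ⟨_, rfl⟩
    rw [L2.inner_def] at h3
    rw [← h3]
    refine integral_congr_ae ?_
    filter_upwards [testToL2_ae (g := g) (ofRealTest h1 h2)] with x hx
    rw [hx, RCLike.inner_apply]
    simp [ofRealTest, mul_comm]
  exact (Lp.eq_zero_iff_ae_eq_zero).2 h0

lemma isClosable_minusLaplace : g.minusLaplace.IsClosable :=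
  isClosable_of_symmetric dense_minusLaplace_domain minusLaplace_symmetric

/-- A closed relation that holds for test functions holds for the graph of `P`. -/
lemma P_graph_induction {S : Set (g.L2 × g.L2)} (hS : IsClosed S)
    (h : ∀ φ : testFunctions d, (g.testToL2 φ, g.testToL2 (g.minusLaplaceTest φ)) ∈ S) :
    ∀ p ∈ g.P.graph, p ∈ S :=
  closure_graph_induction isClosable_minusLaplace hS fun p hp => by
    obtain ⟨φ, rfl⟩ := mem_minusLaplace_graph.1 hp
    exact h φ

lemma P_symmetric : ∀ p ∈ g.P.graph, ∀ q ∈ g.P.graph, ⟪p.2, q.1⟫ = ⟪p.1, q.2⟫ :=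
  closure_graph_symmetric dense_minusLaplace_domain minusLaplace_symmetric

lemma re_inner_minusLaplaceTest (φ : testFunctions d) {V : g.L2} {η : Space d → ℝ}
    (hη : ContDiff ℝ 1 η) (hV : V =ᵐ[g.vol] fun x => (η x : ℂ) * (φ : Space d → ℂ) x) :
    (⟪V, g.testToL2 (g.minusLaplaceTest φ)⟫).re =
      ∫ x, (η x * g.energyDensity φ x +
        g.form x (gradSq φ x) (fun j => partialDeriv j η x)) ∂g.vol := by
  rw [inner_minusLaplaceTest φ hV, re_integral_minusLaplace φ.2 hη]

lemma re_inner_test_energy (φ : testFunctions d) :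
    (⟪g.testToL2 φ, g.testToL2 (g.minusLaplaceTest φ)⟫).re = ∫ x, g.energyDensity φ x ∂g.vol := by
  rw [re_inner_minusLaplaceTest φ (η := fun _ => 1) contDiff_const
    ((testToL2_ae φ).trans (by simp))]
  refine integral_congr_ae (Eventually.of_forall fun x => ?_)
  simp [partialDeriv, form]

lemma P_nonneg {C : ℝ} (hg : g.Bounds C) : ∀ p ∈ g.P.graph, 0 ≤ (⟪p.1, p.2⟫).re :=
  P_graph_induction (S := {p | 0 ≤ (⟪p.1, p.2⟫).re})
    (isClosed_le continuous_const (Complex.continuous_re.comp (by fun_prop))) fun φ => by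
    simp only [Set.mem_ofPred_eq, re_inner_test_energy]
    exact integral_nonneg fun x => energyDensity_nonneg hg _ x

end Metric
end HeatKernel

/-! ### The weighted energy inequality and accretivity in `L¹` -/

namespace HeatKernel

local notation "⟪" x ", " y "⟫" => inner ℂ x y

open ComplexConjugate

/-- A regularised phase `z / √(ε + |z|²)`. -/
noncomputable def regPhase (ε : ℝ) (z : ℂ) : ℂ := ((Real.sqrt (ε + ‖z‖ ^ 2))⁻¹ : ℝ) * z

lemma abs_sqrt_sub_sqrt_le {ε : ℝ} (hε : 0 < ε) (s t : ℝ) :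
    |Real.sqrt (ε + s ^ 2) - Real.sqrt (ε + t ^ 2)| ≤ |s - t| := by
  set a := Real.sqrt (ε + s ^ 2)
  set b := Real.sqrt (ε + t ^ 2)
  have ha : a ^ 2 = ε + s ^ 2 := Real.sq_sqrt (by positivity)
  have hb : b ^ 2 = ε + t ^ 2 := Real.sq_sqrt (by positivity)
  have ha0 : 0 ≤ a := Real.sqrt_nonneg _
  have hb0 : 0 ≤ b := Real.sqrt_nonneg _
  refine sq_le_sq.1 ?_
  have h1 : ε + s * t ≤ a * b := by
    refine le_of_sq_le_sq ?_ (by positivity)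
    rw [mul_pow, ha, hb]
    nlinarith [sq_nonneg (s - t)]
  nlinarith

/-- For fixed `ε` the phase acts continuously on `L²`, which allows inequalities for test functions
to pass to the closure. The constant blows up as `ε → 0`, so that limit must be taken last. -/
lemma lipschitz_regPhase {ε : ℝ} (hε : 0 < ε) :
    LipschitzWith (2 * (Real.sqrt ε)⁻¹).toNNReal (regPhase ε) := by
  refine LipschitzWith.of_dist_le_mul fun z w => ?_
  rw [dist_eq_norm, dist_eq_norm, Real.coe_toNNReal _ (by positivity)]
  set a := Real.sqrt (ε + ‖z‖ ^ 2) with ha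
  set b := Real.sqrt (ε + ‖w‖ ^ 2) with hb
  have hsε : 0 < Real.sqrt ε := Real.sqrt_pos.2 hε
  have ha0 : Real.sqrt ε ≤ a := Real.sqrt_le_sqrt (by nlinarith [sq_nonneg ‖z‖])
  have hb0 : Real.sqrt ε ≤ b := Real.sqrt_le_sqrt (by nlinarith [sq_nonneg ‖w‖])
  have hwb : ‖w‖ ≤ b := Real.le_sqrt_of_sq_le (by linarith)
  have hap : 0 < a := hsε.trans_le ha0
  have hbp : 0 < b := hsε.trans_le hb0
  have hab : |b - a| ≤ ‖z - w‖ := by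
    refine (abs_sqrt_sub_sqrt_le hε _ _).trans ?_
    rw [norm_sub_rev]; exact abs_norm_sub_norm_le _ _
  have e : regPhase ε z - regPhase ε w =
      ((a⁻¹ : ℝ) : ℂ) * (z - w) + (((b - a) * (a⁻¹ * b⁻¹) : ℝ) : ℂ) * w := by
    simp only [regPhase, ← ha, ← hb]
    have : (b - a) * (a⁻¹ * b⁻¹) = a⁻¹ - b⁻¹ := by field_simp
    rw [this]; push_cast; ring
  rw [e]
  refine (norm_add_le _ _).trans ?_
  rw [norm_mul, norm_mul, Complex.norm_real, Complex.norm_real, Real.norm_eq_abs, Real.norm_eq_abs,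
    abs_mul, abs_of_pos (by positivity : 0 < a⁻¹), abs_of_pos (by positivity : 0 < a⁻¹ * b⁻¹)]
  have h1 : a⁻¹ ≤ (Real.sqrt ε)⁻¹ := inv_anti₀ hsε ha0
  have h2 : |b - a| * (a⁻¹ * b⁻¹) * ‖w‖ ≤ ‖z - w‖ * a⁻¹ := by
    calc |b - a| * (a⁻¹ * b⁻¹) * ‖w‖ ≤ ‖z - w‖ * (a⁻¹ * b⁻¹) * b := by gcongr
      _ = _ := by field_simp
  have h3 : a⁻¹ * ‖z - w‖ ≤ (Real.sqrt ε)⁻¹ * ‖z - w‖ := by gcongr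
  linarith

lemma regPhase_zero (ε : ℝ) : regPhase ε 0 = 0 := by simp [regPhase]

lemma partialDeriv_normSq {d : ℕ} (j : Fin d) {φ : Space d → ℂ} {x : Space d}
    (h : DifferentiableAt ℝ φ x) :
    HasFDerivAt (fun y => ‖φ y‖ ^ 2) (2 • (innerSL ℝ (φ x)).comp (fderiv ℝ φ x)) x ∧
    partialDeriv j (fun y => ‖φ y‖ ^ 2) x = 2 * Metric.gradSq φ x j := by
  have h1 := h.hasFDerivAt.norm_sq
  refine ⟨h1, ?_⟩
  simp only [partialDeriv]
  rw [h1.fderiv]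
  simp [Metric.gradSq, Metric.gradRe, Metric.gradIm, partialDeriv, Complex.inner]
  ring

namespace Metric

variable {d : ℕ} {g : Metric d}

lemma memLp_bounded_mul {m : Space d → ℝ} (hm : Measurable m) {C : ℝ} (hC : ∀ x, |m x| ≤ C)
    (u : g.L2) : MemLp (fun x => (m x : ℂ) * u x) 2 g.vol :=
  (Lp.memLp u).of_le_mul (c := C)
    ((Complex.measurable_ofReal.comp hm).aestronglyMeasurable.mul (Lp.aestronglyMeasurable u))
    (Eventually.of_forall fun x => by
      rw [norm_mul, Complex.norm_real]
      exact mul_le_mul_of_nonneg_right (hC x) (norm_nonneg _))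

/-- Multiplication by a bounded measurable function. -/
noncomputable def mulL (g : Metric d) {m : Space d → ℝ} (hm : Measurable m) {C : ℝ}
    (hC : ∀ x, |m x| ≤ C) : g.L2 →L[ℂ] g.L2 :=
  LinearMap.mkContinuous
    { toFun := fun u => (memLp_bounded_mul hm hC u).toLp
      map_add' := fun u v => by
        rw [← MemLp.toLp_add]
        refine MemLp.toLp_congr _ _ ?_
        filter_upwards [Lp.coeFn_add u v] with x hx
        change (m x : ℂ) * (u + v : g.L2) x = m x * u x + m x * v x
        rw [hx, Pi.add_apply, mul_add]
      map_smul' := fun c u => by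
        rw [RingHom.id_apply, ← MemLp.toLp_const_smul]
        refine MemLp.toLp_congr _ _ ?_
        filter_upwards [Lp.coeFn_smul c u] with x hx
        change (m x : ℂ) * (c • u : g.L2) x = c * (m x * u x)
        rw [hx, Pi.smul_apply, smul_eq_mul]; ring } C fun u => by
    refine Lp.norm_le_mul_norm_of_ae_le_mul ?_
    filter_upwards [MemLp.coeFn_toLp (memLp_bounded_mul hm hC u)] with x hx
    change ‖(memLp_bounded_mul hm hC u).toLp _ x‖ ≤ _
    rw [hx, norm_mul, Complex.norm_real]
    exact mul_le_mul_of_nonneg_right (hC x) (norm_nonneg _)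

lemma mulL_ae {m : Space d → ℝ} (hm : Measurable m) {C : ℝ} (hC : ∀ x, |m x| ≤ C) (u : g.L2) :
    g.mulL hm hC u =ᵐ[g.vol] fun x => (m x : ℂ) * u x :=
  MemLp.coeFn_toLp (memLp_bounded_mul hm hC u)

lemma norm_sq_eq_integral (u : g.L2) : ‖u‖ ^ 2 = ∫ x, ‖u x‖ ^ 2 ∂g.vol := by
  have h := inner_self_eq_norm_sq_to_K (𝕜 := ℂ) u
  rw [L2.inner_def] at h
  have h2 : ∀ x, ⟪u x, u x⟫ = ((‖u x‖ ^ 2 : ℝ) : ℂ) := fun x => by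
    rw [inner_self_eq_norm_sq_to_K]; norm_cast
  simp only [h2] at h
  rw [integral_complex_ofReal] at h
  have h3 : ((∫ x, ‖u x‖ ^ 2 ∂g.vol : ℝ) : ℂ) = ((‖u‖ ^ 2 : ℝ) : ℂ) := by
    rw [h]; norm_cast
  exact_mod_cast h3.symm

/-- Davies' weighted energy inequality. -/
lemma weighted_energy {C : ℝ} (hg : g.Bounds C) {ψ : Space d → ℝ} (hψ : ContDiff ℝ 1 ψ)
    (hm : Measurable fun x => Real.exp (ψ x)) {B : ℝ} (hB : ∀ x, |Real.exp (ψ x)| ≤ B)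
    {κ : ℝ} (hκ : ∀ x, g.form x (fun j => partialDeriv j ψ x) (fun j => partialDeriv j ψ x) ≤ κ) :
    ∀ p ∈ g.P.graph, -(κ * ‖g.mulL hm hB p.1‖ ^ 2) ≤
      (⟪g.mulL hm hB (g.mulL hm hB p.1), p.2⟫).re := by
  refine P_graph_induction (S := {p | -(κ * ‖g.mulL hm hB p.1‖ ^ 2) ≤
      (⟪g.mulL hm hB (g.mulL hm hB p.1), p.2⟫).re}) (isClosed_le (by fun_prop)
      (Complex.continuous_re.comp (by fun_prop))) fun φ => ?_
  simp only [Set.mem_ofPred_eq]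
  have hη : ContDiff ℝ 1 (fun x => Real.exp (ψ x) * Real.exp (ψ x)) := hψ.exp.mul hψ.exp
  have hu := testToL2_ae (g := g) φ
  have h1 := mulL_ae (g := g) hm hB (g.testToL2 φ)
  have h2 := mulL_ae (g := g) hm hB (g.mulL hm hB (g.testToL2 φ))
  rw [re_inner_minusLaplaceTest φ hη (by
    filter_upwards [hu, h1, h2] with x e0 e1 e2
    rw [e2, e1, e0]; push_cast; ring)]
  have h3 : ‖g.mulL hm hB (g.testToL2 φ)‖ ^ 2 =
      ∫ x, Real.exp (ψ x) * Real.exp (ψ x) * ‖(φ : Space d → ℂ) x‖ ^ 2 ∂g.vol := by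
    rw [norm_sq_eq_integral]
    refine integral_congr_ae ?_
    filter_upwards [hu, h1] with x e0 e1
    rw [e1, e0, norm_mul, Complex.norm_real, Real.norm_of_nonneg (Real.exp_pos _).le]
    ring
  have hi : Integrable (fun x => Real.exp (ψ x) * Real.exp (ψ x) * ‖(φ : Space d → ℂ) x‖ ^ 2) g.vol := by
    refine Continuous.integrable_of_hasCompactSupport ?_ ?_
    · exact hη.continuous.mul (φ.2.1.continuous.norm.pow 2)
    · refine HasCompactSupport.mul_left ?_
      exact φ.2.2.comp_left (g := fun z : ℂ => ‖z‖ ^ 2) (by simp)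
  rw [h3, ← integral_const_mul, ← integral_neg]
  refine integral_mono (hi.const_mul κ).neg (integrable_green_re φ.2 hη) fun x => ?_
  have hd : DifferentiableAt ℝ ψ x := hψ.differentiable (by simp) x
  have e : (fun j => partialDeriv j (fun y => Real.exp (ψ y) * Real.exp (ψ y)) x) =
      (2 * (Real.exp (ψ x) * Real.exp (ψ x))) • fun j => partialDeriv j ψ x := by
    ext j
    simp only [partialDeriv]
    rw [fderiv_fun_mul hd.exp hd.exp, fderiv_exp hd]
    simp; ring
  simp only [e, form_smul_right]
  set r := fun j => partialDeriv j ψ x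
  set p := gradRe (φ : Space d → ℂ) x with hp
  set q := gradIm (φ : Space d → ℂ) x with hq
  set z := (φ : Space d → ℂ) x with hz
  -- Completing the square: the nonnegativity of `|∇Re φ + Re φ ∇ψ|² + |∇Im φ + Im φ ∇ψ|²` absorbs
  -- the cross term at the price of `|φ|² |∇ψ|² ≤ κ |φ|²`.
  have h5 := hg.inv_form x (p + z.re • r)
  have h6 := hg.inv_form x (q + z.im • r)
  change 0 ≤ g.form x _ _ at h5 h6
  have h7 : ‖z‖ ^ 2 = z.re * z.re + z.im * z.im := by
    rw [← Complex.normSq_eq_norm_sq, Complex.normSq_apply]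
  simp only [energyDensity, gradSq, ← hp, ← hq, ← hz, form_add_left, form_add_right,
    form_smul_left, form_smul_right, form_comm x r p, form_comm x r q] at h5 h6 ⊢
  have h8 := mul_le_mul_of_nonneg_left (hκ x)
    (mul_nonneg (mul_self_nonneg (Real.exp (ψ x))) (sq_nonneg ‖z‖))
  have h9 := mul_nonneg (mul_self_nonneg (Real.exp (ψ x))) (add_nonneg h5 h6)
  change Real.exp (ψ x) * Real.exp (ψ x) * ‖z‖ ^ 2 * g.form x r r ≤ _ at h8
  rw [h7] at h8 ⊢
  nlinarith

/-- The accretivity of `P` with respect to the regularised phase, which gives the contractivity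
in `L¹`. -/
lemma re_inner_regPhase_nonneg {C : ℝ} (hg : g.Bounds C) {ε : ℝ} (hε : 0 < ε) :
    ∀ p ∈ g.P.graph, 0 ≤ (⟪(lipschitz_regPhase hε).compLp (regPhase_zero ε) p.1, p.2⟫).re := by
  have hc := (lipschitz_regPhase hε).continuous_compLp (regPhase_zero ε) (p := 2) (μ := g.vol)
  refine P_graph_induction (S := {p | 0 ≤
    (⟪(lipschitz_regPhase hε).compLp (regPhase_zero ε) p.1, p.2⟫).re})
    (isClosed_le continuous_const (Complex.continuous_re.comp
      ((hc.comp continuous_fst).inner continuous_snd))) fun φ => ?_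
  simp only [Set.mem_ofPred_eq]
  have hN : ContDiff ℝ 1 (fun x => ε + ‖(φ : Space d → ℂ) x‖ ^ 2) :=
    contDiff_const.add ((φ.2.1.of_le (by simp)).norm_sq ℝ)
  have hN0 : ∀ x, 0 < ε + ‖(φ : Space d → ℂ) x‖ ^ 2 := fun x => by positivity
  have hη : ContDiff ℝ 1 (fun x => (Real.sqrt (ε + ‖(φ : Space d → ℂ) x‖ ^ 2))⁻¹) :=
    (hN.sqrt fun x => (hN0 x).ne').inv fun x => (Real.sqrt_pos.2 (hN0 x)).ne'
  rw [re_inner_minusLaplaceTest φ hη (by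
    filter_upwards [testToL2_ae (g := g) φ,
      (lipschitz_regPhase hε).coeFn_compLp (regPhase_zero ε) (g.testToL2 φ)] with x e0 e1
    rw [e1, Function.comp_apply, e0]; rfl)]
  refine integral_nonneg fun x => ?_
  have hd : DifferentiableAt ℝ (φ : Space d → ℂ) x := φ.2.1.differentiable (by simp) x
  set S := Real.sqrt (ε + ‖(φ : Space d → ℂ) x‖ ^ 2) with hS
  have hS0 : 0 < S := Real.sqrt_pos.2 (hN0 x)
  have hS2 : S ^ 2 = ε + ‖(φ : Space d → ℂ) x‖ ^ 2 := Real.sq_sqrt (hN0 x).le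
  have e : (fun j => partialDeriv j (fun x => (Real.sqrt (ε + ‖(φ : Space d → ℂ) x‖ ^ 2))⁻¹) x) =
      (-(S⁻¹ ^ 3)) • gradSq (φ : Space d → ℂ) x := by
    ext j
    have h1 := (partialDeriv_normSq j hd).1.const_add ε
    have h2 := (h1.sqrt (hN0 x).ne')
    have h3 := (hasDerivAt_inv hS0.ne').comp_hasFDerivAt x h2
    have h4 := (partialDeriv_normSq j hd).2
    simp only [partialDeriv] at h4 ⊢
    rw [(partialDeriv_normSq j hd).1.fderiv] at h4
    have h5 : fderiv ℝ (fun x => (Real.sqrt (ε + ‖(φ : Space d → ℂ) x‖ ^ 2))⁻¹) x = _ := h3.fderiv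
    rw [h5]
    simp only [smul_apply, smul_eq_mul, Pi.smul_apply] at h4 ⊢
    rw [h4, ← hS]
    field_simp
  simp only [Pi.zero_apply, e, form_smul_right]
  -- The weight `S⁻¹` has gradient `-S⁻³ gradSq`, and `|gradSq|² ≤ |φ|² |∇φ|² ≤ S² |∇φ|²`, so the
  -- negative term is at most `S⁻¹ |∇φ|²`.
  have h6 := form_gradSq_le C hg (φ : Space d → ℂ) x
  have h7 := energyDensity_nonneg hg (φ : Space d → ℂ) x
  rw [Complex.normSq_eq_norm_sq] at h6
  have h8 : S⁻¹ ^ 3 * g.form x (gradSq (φ : Space d → ℂ) x) (gradSq (φ : Space d → ℂ) x) ≤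
      S⁻¹ ^ 3 * (S ^ 2 * g.energyDensity (φ : Space d → ℂ) x) := by
    gcongr
    exact h6.trans (mul_le_mul_of_nonneg_right (by linarith) h7)
  have h9 : S⁻¹ ^ 3 * (S ^ 2 * g.energyDensity (φ : Space d → ℂ) x) =
      S⁻¹ * g.energyDensity (φ : Space d → ℂ) x := by field_simp
  change 0 ≤ S⁻¹ * _ + _
  linarith

end Metric
end HeatKernel

/-! ### Gagliardo-Nirenberg and Nash inequalities -/

namespace HeatKernel

local notation "⟪" x ", " y "⟫" => inner ℂ x y

lemma norm_sq_le_sum_single {d : ℕ} {F : Type*} [NormedAddCommGroup F] [NormedSpace ℝ F]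
    (L : Space d →L[ℝ] F) : ‖L‖ ^ 2 ≤ ∑ j, ‖L (EuclideanSpace.single j 1)‖ ^ 2 := by
  set S := ∑ j, ‖L (EuclideanSpace.single j 1)‖ ^ 2 with hS
  have hS0 : 0 ≤ S := Finset.sum_nonneg fun j _ => sq_nonneg _
  have h : ‖L‖ ≤ Real.sqrt S := by
    refine L.opNorm_le_bound (Real.sqrt_nonneg _) fun v => ?_
    have hv : v = ∑ j, v j • (EuclideanSpace.single j (1 : ℝ) : Space d) := by
      ext i; simp [Finset.sum_apply, Pi.single_apply]
    have h1 : ‖L v‖ ≤ ∑ j, |v j| * ‖L (EuclideanSpace.single j 1)‖ := by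
      conv_lhs => rw [hv, map_sum]
      refine (norm_sum_le _ _).trans (Finset.sum_le_sum fun j _ => ?_)
      rw [map_smul, norm_smul, Real.norm_eq_abs]
    refine h1.trans ?_
    refine le_of_sq_le_sq ?_ (by positivity)
    refine (Finset.sum_mul_sq_le_sq_mul_sq _ _ _).trans ?_
    rw [mul_pow, Real.sq_sqrt hS0, EuclideanSpace.norm_sq_eq, mul_comm]
    simp only [sq_abs, Real.norm_eq_abs]
    exact le_rfl
  calc ‖L‖ ^ 2 ≤ Real.sqrt S ^ 2 := by gcongr
    _ = S := Real.sq_sqrt hS0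

namespace Metric

variable {d : ℕ} {g : Metric d}

lemma norm_fderiv_sq_le {C : ℝ} (hg : g.Bounds C) (φ : Space d → ℂ) (x : Space d) :
    ‖fderiv ℝ φ x‖ ^ 2 ≤ C * g.energyDensity φ x := by
  refine (norm_sq_le_sum_single _).trans ?_
  have h1 := hg.inv_form_lower x (gradRe φ x)
  have h2 := hg.inv_form_lower x (gradIm φ x)
  have h3 : ∀ j, ‖fderiv ℝ φ x (EuclideanSpace.single j 1)‖ ^ 2 =
      gradRe φ x j ^ 2 + gradIm φ x j ^ 2 := fun j => by
    rw [← Complex.normSq_eq_norm_sq, Complex.normSq_apply, gradRe, gradIm, partialDeriv]; ring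
  simp only [h3, Finset.sum_add_distrib, energyDensity, mul_add]
  exact add_le_add h1 h2

lemma vol_le {C : ℝ} (hg : g.Bounds C) : g.vol ≤ ENNReal.ofReal C • volume := by
  rw [vol, ← withDensity_const]
  exact withDensity_mono (Eventually.of_forall fun x => ENNReal.ofReal_le_ofReal (hg.density_upper x))

lemma volume_le {C : ℝ} (hg : g.Bounds C) :
    (volume : Measure (Space d)) ≤ ENNReal.ofReal C • g.vol := by
  have hC : 0 < C := by linarith [hg.one_le]
  rw [vol, ← withDensity_smul _ g.contDiff_density.continuous.measurable.ennreal_ofReal]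
  conv_lhs => rw [← withDensity_one (μ := (volume : Measure (Space d)))]
  refine withDensity_mono (Eventually.of_forall fun x => ?_)
  simp only [Pi.one_apply, Pi.smul_apply, smul_eq_mul]
  rw [← ENNReal.ofReal_mul hC.le, ← ENNReal.ofReal_one]
  refine ENNReal.ofReal_le_ofReal ?_
  have := hg.density_lower x
  rwa [inv_le_iff_one_le_mul₀ hC, mul_comm] at this

lemma vol_absolutelyContinuous : g.vol ≪ volume := withDensity_absolutelyContinuous _ _

lemma lintegral_vol_le {C : ℝ} (hg : g.Bounds C) (f : Space d → ℝ≥0∞) :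
    ∫⁻ x, f x ∂g.vol ≤ ENNReal.ofReal C * ∫⁻ x, f x := by
  refine (lintegral_mono' (vol_le hg) le_rfl).trans_eq ?_
  rw [lintegral_smul_measure, smul_eq_mul]

lemma lintegral_volume_le {C : ℝ} (hg : g.Bounds C) (f : Space d → ℝ≥0∞) :
    ∫⁻ x, f x ≤ ENNReal.ofReal C * ∫⁻ x, f x ∂g.vol := by
  refine (lintegral_mono' (volume_le hg) le_rfl).trans_eq ?_
  rw [lintegral_smul_measure, smul_eq_mul]

lemma integral_volume_le {C : ℝ} (hg : g.Bounds C) {f : Space d → ℝ} (h0 : ∀ x, 0 ≤ f x)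
    (hc : Continuous f) (hs : HasCompactSupport f) : ∫ x, f x ≤ C * ∫ x, f x ∂g.vol := by
  have hC : 0 < C := by linarith [hg.one_le]
  rw [integral_vol, ← integral_const_mul]
  refine integral_mono (hc.integrable_of_hasCompactSupport hs) ?_ fun x => ?_
  · exact Integrable.const_mul ((g.contDiff_density.continuous.smul hc).integrable_of_hasCompactSupport
      (HasCompactSupport.smul_left hs)) _
  · have := hg.density_lower x
    rw [inv_le_iff_one_le_mul₀ hC] at this
    simp only [smul_eq_mul]
    rw [← mul_assoc, mul_comm C]
    nlinarith [h0 x]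

/-- The `W^{1,1}` Sobolev inequality is applied to `|φ|²`, whose gradient is bounded by `2 |φ|
|∇φ|`; Cauchy-Schwarz then produces `‖φ‖` times the square root of the energy. Working with `|φ|²`
treats `d = 2` on the same footing as `d > 2`. -/
lemma eLpNorm_sq_test_le {C : ℝ} (hg : g.Bounds C) {p : NNReal}
    (hp : NNReal.HolderConjugate (Module.finrank ℝ (Space d)) p) :
    ∃ K : ℝ, 0 ≤ K ∧ ∀ φ : testFunctions d,
      eLpNorm (fun x => ‖(φ : Space d → ℂ) x‖ ^ 2) p volume ≤
        ENNReal.ofReal (K * (‖g.testToL2 φ‖ *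
          Real.sqrt (⟪g.testToL2 φ, g.testToL2 (g.minusLaplaceTest φ)⟫).re)) := by
  have hC : 0 < C := by linarith [hg.one_le]
  set c := eLpNormLESNormFDerivOneConst (volume : Measure (Space d)) p
  refine ⟨c * (2 * (Real.sqrt C * C)), by positivity, fun φ => ?_⟩
  set φ' : Space d → ℂ := φ.1 with hφ'
  have h1φ : ContDiff ℝ 1 φ' := φ.2.1.of_le (by simp)
  have hφc := φ.2.2
  change HasCompactSupport φ' at hφc
  have hfc : Continuous (fderiv ℝ φ') := h1φ.continuous_fderiv one_ne_zero
  have hf1 : ContDiff ℝ 1 (fun x => ‖φ' x‖ ^ 2) := h1φ.norm_sq ℝ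
  have hf2 : HasCompactSupport (fun x => ‖φ' x‖ ^ 2) := hφc.comp_left (g := fun z : ℂ => ‖z‖ ^ 2) (by simp)
  have h1 := eLpNorm_le_eLpNorm_fderiv_one (volume : Measure (Space d)) hf1 hf2 hp
  have h2 : ∀ x, ‖fderiv ℝ (fun x => ‖φ' x‖ ^ 2) x‖ ≤ 2 * (‖φ' x‖ * ‖fderiv ℝ φ' x‖) := by
    intro x
    have := ((h1φ.differentiable (by simp) x).hasFDerivAt.norm_sq)
    rw [this.fderiv]
    refine norm_nsmul_le.trans ?_
    rw [Nat.cast_ofNat]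
    refine mul_le_mul_of_nonneg_left ?_ (by norm_num)
    refine (ContinuousLinearMap.opNorm_comp_le _ _).trans ?_
    rw [innerSL_apply_norm]
  have c1 : Continuous (fun x => ‖φ' x‖) := h1φ.continuous.norm
  have c2 : Continuous (fun x => ‖fderiv ℝ φ' x‖) := hfc.norm
  have s1 : HasCompactSupport (fun x => ‖φ' x‖) := hφc.norm
  have s2 : HasCompactSupport (fun x => ‖fderiv ℝ φ' x‖) := (hφc.fderiv ℝ).norm
  have hi : Integrable (fun x => 2 * (‖φ' x‖ * ‖fderiv ℝ φ' x‖)) :=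
    ((c1.mul c2).integrable_of_hasCompactSupport s1.mul_right).const_mul 2
  have h3 : eLpNorm (fderiv ℝ (fun x => ‖φ' x‖ ^ 2)) 1 volume ≤
      ENNReal.ofReal (∫ x, 2 * (‖φ' x‖ * ‖fderiv ℝ φ' x‖)) := by
    rw [eLpNorm_one_eq_lintegral_enorm,
      ofReal_integral_eq_lintegral_ofReal hi (Eventually.of_forall fun x => by positivity)]
    refine lintegral_mono fun x => ?_
    rw [← ofReal_norm]
    exact ENNReal.ofReal_le_ofReal (h2 x)
  have hH : Real.HolderConjugate 2 2 := Real.HolderConjugate.two_two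
  have h4 := integral_mul_le_Lp_mul_Lq_of_nonneg hH (μ := (volume : Measure (Space d)))
    (Eventually.of_forall fun x => norm_nonneg (φ' x))
    (Eventually.of_forall fun x => norm_nonneg (fderiv ℝ φ' x))
    (c1.memLp_of_hasCompactSupport s1) (c2.memLp_of_hasCompactSupport s2)
  simp only [Real.rpow_two] at h4
  rw [← Real.sqrt_eq_rpow, ← Real.sqrt_eq_rpow] at h4
  have h5 : ∫ x, ‖φ' x‖ ^ 2 ≤ C * ‖g.testToL2 φ‖ ^ 2 := by
    refine (integral_volume_le hg (fun x => sq_nonneg _) hf1.continuous hf2).trans_eq ?_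
    rw [norm_sq_eq_integral]
    congr 1
    refine integral_congr_ae ?_
    filter_upwards [testToL2_ae (g := g) φ] with x hx
    rw [hx]
  have h6 : ∫ x, ‖fderiv ℝ φ' x‖ ^ 2 ≤ C * (C *
      (⟪g.testToL2 φ, g.testToL2 (g.minusLaplaceTest φ)⟫).re) := by
    have s3 : HasCompactSupport (fun x => ‖fderiv ℝ φ' x‖ ^ 2) :=
      (hφc.fderiv ℝ).comp_left (g := fun z : Space d →L[ℝ] ℂ => ‖z‖ ^ 2) (by simp)
    refine (integral_volume_le hg (fun x => sq_nonneg _) (c2.pow 2) s3).trans ?_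
    rw [re_inner_test_energy]
    refine mul_le_mul_of_nonneg_left ?_ hC.le
    rw [← integral_const_mul]
    exact integral_mono ((c2.pow 2).integrable_of_hasCompactSupport s3)
      ((integrable_energyDensity φ.2).const_mul C) fun x => norm_fderiv_sq_le hg φ' x
  refine h1.trans ((mul_le_mul_right h3 _).trans ?_)
  rw [← ENNReal.ofReal_coe_nnreal, ← ENNReal.ofReal_mul (NNReal.coe_nonneg _)]
  refine ENNReal.ofReal_le_ofReal ?_
  change (c : ℝ) * _ ≤ _
  rw [integral_const_mul, mul_assoc (c : ℝ)]
  refine mul_le_mul_of_nonneg_left ?_ c.2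
  rw [mul_assoc]
  refine mul_le_mul_of_nonneg_left (h4.trans ?_) (by norm_num)
  calc _ ≤ Real.sqrt (C * ‖g.testToL2 φ‖ ^ 2) * Real.sqrt (C * (C *
      (⟪g.testToL2 φ, g.testToL2 (g.minusLaplaceTest φ)⟫).re)) := by gcongr
    _ = _ := by
      rw [Real.sqrt_mul hC.le, Real.sqrt_sq (norm_nonneg _), ← mul_assoc C C,
        Real.sqrt_mul (mul_self_nonneg C), Real.sqrt_mul_self hC.le]
      ring

/-- The Gagliardo-Nirenberg inequality on the domain of `P`. -/
lemma eLpNorm_sq_le {C : ℝ} (hg : g.Bounds C) {p : NNReal}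
    (hp : NNReal.HolderConjugate (Module.finrank ℝ (Space d)) p) :
    ∃ K : ℝ, 0 ≤ K ∧ ∀ q ∈ g.P.graph, eLpNorm (fun x => ‖q.1 x‖ ^ 2) p volume ≤
        ENNReal.ofReal (K * (‖q.1‖ * Real.sqrt (⟪q.1, q.2⟫).re)) := by
  obtain ⟨K, hK, h⟩ := eLpNorm_sq_test_le hg hp
  refine ⟨K, hK, fun q hq => ?_⟩
  have hq' : q ∈ closure {q : g.L2 × g.L2 | ∃ φ : testFunctions d,
      q = (g.testToL2 φ, g.testToL2 (g.minusLaplaceTest φ))} := by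
    revert q
    exact P_graph_induction isClosed_closure fun φ => subset_closure ⟨φ, rfl⟩
  obtain ⟨s, hs, hsq⟩ := mem_closure_iff_seq_limit.1 hq'
  choose φ hφ using hs
  have h1 : Tendsto (fun n => (s n).1) atTop (𝓝 q.1) := (continuous_fst.tendsto q).comp hsq
  -- The right-hand side is continuous in the graph norm and the left-hand side is lower
  -- semicontinuous along an almost everywhere convergent subsequence.
  obtain ⟨ns, hns, hae⟩ := (tendstoInMeasure_of_tendsto_Lp h1).exists_seq_tendsto_ae
  have hae' : ∀ᵐ x, Tendsto (fun i => ‖(s (ns i)).1 x‖ ^ 2) atTop (𝓝 (‖q.1 x‖ ^ 2)) := by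
    filter_upwards [g.volume_absolutelyContinuous_vol.ae_le hae] with x hx
    exact hx.norm.pow 2
  have hm : ∀ u : g.L2, AEStronglyMeasurable (fun x => ‖u x‖ ^ 2) volume := fun u =>
    ((Lp.aestronglyMeasurable u).mono_ac g.volume_absolutelyContinuous_vol).norm.pow 2
  refine (Lp.eLpNorm_lim_le_liminf_eLpNorm (fun i => hm _) _ hae').trans ?_
  have hF : Continuous fun q : g.L2 × g.L2 =>
      ENNReal.ofReal (K * (‖q.1‖ * Real.sqrt (⟪q.1, q.2⟫).re)) := by
    refine ENNReal.continuous_ofReal.comp (continuous_const.mul (continuous_fst.norm.mul ?_))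
    exact Real.continuous_sqrt.comp (Complex.continuous_re.comp
      (continuous_fst.inner continuous_snd))
  have hlim := ((hF.tendsto q).comp hsq).comp hns.tendsto_atTop
  rw [← hlim.liminf_eq]
  refine liminf_le_liminf (Eventually.of_forall fun i => ?_)
  simp only [Function.comp_apply]
  rw [hφ (ns i)]
  refine (eLpNorm_congr_ae ?_).trans_le (h (φ (ns i)))
  filter_upwards [g.volume_absolutelyContinuous_vol.ae_le (testToL2_ae (g := g) (φ (ns i)))] with x hx
  rw [hx]

lemma lintegral_sq_eq (u : g.L2) : ∫⁻ x, ‖u x‖ₑ ^ 2 ∂g.vol = ENNReal.ofReal (‖u‖ ^ 2) := by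
  rw [ENNReal.ofReal_pow (norm_nonneg _), ofReal_norm, Lp.enorm_def,
    eLpNorm_eq_lintegral_rpow_enorm_toReal (by norm_num) (by norm_num)]
  simp only [ENNReal.toReal_ofNat, ENNReal.rpow_two]
  rw [← ENNReal.rpow_two, ← ENNReal.rpow_mul]
  norm_num

/-- The Nash inequality. -/
theorem nash (hd : 2 ≤ d) {C : ℝ} (hg : g.Bounds C) :
    ∃ K : ℝ, 0 < K ∧ ∀ q ∈ g.P.graph, ∀ L : ℝ, 0 ≤ L →
      ∫⁻ x, ‖q.1 x‖ₑ ∂g.vol ≤ ENNReal.ofReal L →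
      ‖q.1‖ ^ (d + 2) ≤ K * L ^ 2 * Real.sqrt (⟪q.1, q.2⟫).re ^ d := by
  have hC : 0 < C := by linarith [hg.one_le]
  have hd1 : (1 : ℝ) < d := by exact_mod_cast (by omega : 1 < d)
  let p : NNReal := NNReal.conjExponent d
  have hp : NNReal.HolderConjugate (Module.finrank ℝ (Space d)) p := by
    rw [finrank_euclideanSpace_fin]
    exact NNReal.HolderConjugate.conjExponent (by exact_mod_cast hd1)
  have hpr : (p : ℝ) * (d - 1) = d := by
    have : (p : ℝ) = d / (d - 1) := by
      simp only [p, NNReal.conjExponent]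
      rw [NNReal.coe_div, NNReal.coe_sub (by exact_mod_cast hd1.le)]
      simp
    rw [this]; field_simp [(sub_pos.2 hd1).ne']
  obtain ⟨K, hK, hgn⟩ := eLpNorm_sq_le hg hp
  -- The powers of `C` convert the `L²` and `L¹` norms between `d_g x` and `dx`; the summand `1`
  -- only makes the constant positive.
  refine ⟨(C ^ (d + 1) * C ^ 2) * (K ^ d + 1), by positivity, fun q hq L hL hqL => ?_⟩
  set u := q.1 with hu
  set E := Real.sqrt (⟪q.1, q.2⟫).re with hE
  have hE0 : 0 ≤ E := Real.sqrt_nonneg _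
  set N := eLpNorm (fun x => ‖u x‖ ^ 2) p volume with hN
  have hNle : N ≤ ENNReal.ofReal (K * (‖u‖ * E)) := hgn q hq
  have hum : AEMeasurable (fun x => ‖u x‖ₑ) volume :=
    ((Lp.aestronglyMeasurable u).mono_ac g.volume_absolutelyContinuous_vol).enorm
  have hdp : (0 : ℝ) < d + 1 := by positivity
  have hdm : (0 : ℝ) < d - 1 := by linarith
  -- Interpolation of `L²` between `L¹` and `L^{2p}`, `p = d/(d-1)`: write `|u|² = |u|^{2/(d+1)}
  -- |u|^{2d/(d+1)}` and raise the factors to the powers `(d+1)/2` and `(d+1)/(d-1)`.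
  have hHol : Real.HolderConjugate ((d + 1) / 2 : ℝ) ((d + 1) / (d - 1)) := by
    rw [Real.holderConjugate_iff]
    constructor
    · rw [lt_div_iff₀ (by norm_num)]; linarith
    · field_simp; ring
  have hY : ∫⁻ x, ‖u x‖ₑ ^ 2 ≤
      (∫⁻ x, ‖u x‖ₑ) ^ (2 / (d + 1) : ℝ) * (N ^ (p : ℝ)) ^ ((d - 1) / (d + 1) : ℝ) := by
    have h1 := ENNReal.lintegral_mul_le_Lp_mul_Lq volume hHol
      (f := fun x => ‖u x‖ₑ ^ (2 / (d + 1) : ℝ)) (g := fun x => ‖u x‖ₑ ^ (2 * d / (d + 1) : ℝ))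
      (hum.pow_const _) (hum.pow_const _)
    have e1 : ∀ x, ((fun x => ‖u x‖ₑ ^ (2 / (d + 1) : ℝ)) *
        fun x => ‖u x‖ₑ ^ (2 * d / (d + 1) : ℝ)) x = ‖u x‖ₑ ^ 2 := fun x => by
      simp only [Pi.mul_apply]
      rw [← ENNReal.rpow_add_of_nonneg _ _ (by positivity) (by positivity), ← ENNReal.rpow_two]
      congr 1; field_simp; ring
    have e2 : ∀ x, (‖u x‖ₑ ^ (2 / (d + 1) : ℝ)) ^ ((d + 1) / 2 : ℝ) = ‖u x‖ₑ := fun x => by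
      rw [← ENNReal.rpow_mul]
      have : (2 / (d + 1) : ℝ) * ((d + 1) / 2) = 1 := by field_simp
      rw [this, ENNReal.rpow_one]
    have e3 : ∀ x, (‖u x‖ₑ ^ (2 * d / (d + 1) : ℝ)) ^ ((d + 1) / (d - 1) : ℝ) =
        ‖‖u x‖ ^ 2‖ₑ ^ (p : ℝ) := fun x => by
      rw [← ENNReal.rpow_mul, enorm_pow, enorm_norm, ← ENNReal.rpow_two, ← ENNReal.rpow_mul]
      congr 1
      rw [show (p : ℝ) = d / (d - 1) by rw [eq_div_iff hdm.ne', hpr]]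
      field_simp
    simp only [e1, e2, e3] at h1
    rw [eLpNorm_nnreal_pow_eq_lintegral hp.symm.pos.ne']
    refine h1.trans (le_of_eq ?_)
    congr 2 <;> simp
  have hY2 : (∫⁻ x, ‖u x‖ₑ ^ 2) ^ (d + 1) ≤ (∫⁻ x, ‖u x‖ₑ) ^ 2 * N ^ d := by
    calc (∫⁻ x, ‖u x‖ₑ ^ 2) ^ (d + 1) ≤ ((∫⁻ x, ‖u x‖ₑ) ^ (2 / (d + 1) : ℝ) *
          (N ^ (p : ℝ)) ^ ((d - 1) / (d + 1) : ℝ)) ^ (d + 1) := by gcongr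
      _ = _ := by
        rw [mul_pow, ← ENNReal.rpow_mul, ← ENNReal.rpow_natCast, ← ENNReal.rpow_natCast,
          ← ENNReal.rpow_mul, ← ENNReal.rpow_mul, ← ENNReal.rpow_natCast, ← ENNReal.rpow_natCast]
        congr 2
        · push_cast; field_simp
        · push_cast
          rw [mul_assoc, div_mul_cancel₀ _ hdp.ne', hpr]
  have h7 : ENNReal.ofReal (‖u‖ ^ 2) ≤ ENNReal.ofReal C * ∫⁻ x, ‖u x‖ₑ ^ 2 := by
    rw [← lintegral_sq_eq]; exact lintegral_vol_le hg _
  have h8 : ∫⁻ x, ‖u x‖ₑ ≤ ENNReal.ofReal (C * L) := by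
    refine (lintegral_volume_le hg _).trans ?_
    rw [ENNReal.ofReal_mul hC.le]; gcongr
  have h9 : (‖u‖ ^ 2) ^ (d + 1) ≤ C ^ (d + 1) * ((C * L) ^ 2 * (K * (‖u‖ * E)) ^ d) := by
    rw [← ENNReal.ofReal_le_ofReal_iff (by positivity)]
    calc ENNReal.ofReal ((‖u‖ ^ 2) ^ (d + 1)) = ENNReal.ofReal (‖u‖ ^ 2) ^ (d + 1) :=
          ENNReal.ofReal_pow (by positivity) _
      _ ≤ (ENNReal.ofReal C * ∫⁻ x, ‖u x‖ₑ ^ 2) ^ (d + 1) := by gcongr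
      _ = ENNReal.ofReal C ^ (d + 1) * (∫⁻ x, ‖u x‖ₑ ^ 2) ^ (d + 1) := mul_pow _ _ _
      _ ≤ ENNReal.ofReal C ^ (d + 1) * ((∫⁻ x, ‖u x‖ₑ) ^ 2 * N ^ d) := by gcongr
      _ ≤ ENNReal.ofReal C ^ (d + 1) *
          (ENNReal.ofReal (C * L) ^ 2 * ENNReal.ofReal (K * (‖u‖ * E)) ^ d) := by gcongr
      _ = _ := by
        rw [← ENNReal.ofReal_pow hC.le, ← ENNReal.ofReal_pow (by positivity),
          ← ENNReal.ofReal_pow (by positivity), ← ENNReal.ofReal_mul (by positivity),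
          ← ENNReal.ofReal_mul (by positivity)]
  rcases (norm_nonneg u).eq_or_lt with h0 | h0
  · rw [← h0, zero_pow (by omega)]; positivity
  -- The Gagliardo-Nirenberg bound contributes a factor `‖u‖^d` on the right, which is cancelled
  -- here.
  · have h10 : ‖u‖ ^ d * ‖u‖ ^ (d + 2) ≤
        ‖u‖ ^ d * (C ^ (d + 1) * C ^ 2 * K ^ d * L ^ 2 * E ^ d) := by
      calc ‖u‖ ^ d * ‖u‖ ^ (d + 2) = (‖u‖ ^ 2) ^ (d + 1) := by ring
        _ ≤ _ := h9
        _ = _ := by rw [mul_pow, mul_pow, mul_pow]; ring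
    refine (le_of_mul_le_mul_left h10 (by positivity)).trans ?_
    have : 0 ≤ C ^ (d + 1) * C ^ 2 * (L ^ 2 * E ^ d) := by positivity
    nlinarith

end Metric
end HeatKernel

/-! ### Contractivity in `L¹` and commutation with conjugation -/

namespace HeatKernel

local notation "⟪" x ", " y "⟫" => inner ℂ x y

open ComplexConjugate

namespace Metric

variable {d : ℕ} {g : Metric d}

/-- A bound on the `L¹` norm is closed in `L²`. -/
lemma lintegral_enorm_le_of_tendsto {u : ℕ → g.L2} {v : g.L2} (h : Tendsto u atTop (𝓝 v))
    {M : ℝ≥0∞} (hM : ∀ n, ∫⁻ x, ‖u n x‖ₑ ∂g.vol ≤ M) : ∫⁻ x, ‖v x‖ₑ ∂g.vol ≤ M := by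
  obtain ⟨ns, hns, hae⟩ := (tendstoInMeasure_of_tendsto_Lp h).exists_seq_tendsto_ae
  calc ∫⁻ x, ‖v x‖ₑ ∂g.vol = ∫⁻ x, liminf (fun i => ‖u (ns i) x‖ₑ) atTop ∂g.vol := by
        refine lintegral_congr_ae ?_
        filter_upwards [hae] with x hx
        exact ((continuous_enorm.tendsto _).comp hx).liminf_eq.symm
    _ ≤ liminf (fun i => ∫⁻ x, ‖u (ns i) x‖ₑ ∂g.vol) atTop :=
        lintegral_liminf_le' fun i => (Lp.aestronglyMeasurable _).enorm
    _ ≤ M := liminf_le_of_le (by isBoundedDefault) fun b hb => by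
        obtain ⟨i, hi⟩ := hb.exists
        exact hi.trans (hM _)

lemma norm_regPhase_le {ε : ℝ} (hε : 0 < ε) (z : ℂ) : ‖regPhase ε z‖ ≤ 1 := by
  have h : 0 < ε + ‖z‖ ^ 2 := by positivity
  rw [regPhase, norm_mul, Complex.norm_real, Real.norm_of_nonneg (by positivity),
    inv_mul_le_iff₀ (Real.sqrt_pos.2 h), mul_one]
  exact Real.le_sqrt_of_sq_le (by linarith)

/-- The resolvents of `P` are contractions in `L¹`. -/
lemma lintegral_le_of_resolvent {C : ℝ} (hg : g.Bounds C) {p : g.L2 × g.L2} (hp : p ∈ g.P.graph)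
    {s : ℝ} (hs : 0 ≤ s) :
    ∫⁻ x, ‖p.1 x‖ₑ ∂g.vol ≤ ∫⁻ x, ‖(p.1 + s • p.2) x‖ₑ ∂g.vol := by
  set f := p.1 + s • p.2 with hf
  rcases eq_or_ne (∫⁻ x, ‖f x‖ₑ ∂g.vol) ∞ with h | hfin
  · rw [h]; exact le_top
  have hfi : Integrable f g.vol := ⟨Lp.aestronglyMeasurable _, lt_top_iff_ne_top.2 hfin⟩
  -- With `b` the regularised phase of `u = p.1`, this is the integrand of `⟪b, u⟫`. Accretivity
  -- gives `Re ⟪b, u⟫ ≤ Re ⟪b, f⟫`, and the latter is at most `‖f‖_1` as `|b| ≤ 1`. Since `h ε`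
  -- tends to `|u|` as `ε → 0`, Fatou's lemma concludes.
  let h : ℝ → Space d → ℝ := fun ε x => ‖p.1 x‖ ^ 2 / Real.sqrt (ε + ‖p.1 x‖ ^ 2)
  have hmeas : ∀ ε, AEStronglyMeasurable (h ε) g.vol := fun ε => by
    have h1 := (Lp.aestronglyMeasurable p.1).norm.pow 2
    exact (h1.aemeasurable.div (Real.continuous_sqrt.measurable.comp_aemeasurable
      (h1.aemeasurable.const_add ε))).aestronglyMeasurable
  have hle : ∀ ε, 0 < ε → ∫⁻ x, ‖h ε x‖ₑ ∂g.vol ≤ ∫⁻ x, ‖f x‖ₑ ∂g.vol := by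
    intro ε hε
    set b := (lipschitz_regPhase hε).compLp (regPhase_zero ε) p.1 with hb
    have hbae := (lipschitz_regPhase hε).coeFn_compLp (regPhase_zero ε) p.1
    have h0 := re_inner_regPhase_nonneg hg hε p hp
    have e1 : (⟪b, f⟫).re = (⟪b, p.1⟫).re + s * (⟪b, p.2⟫).re := by
      rw [hf, inner_add_right, inner_smul_right_eq_smul, Complex.add_re, Complex.smul_re, smul_eq_mul]
    have h2 : (⟪b, p.1⟫).re ≤ (⟪b, f⟫).re := by
      rw [e1]; linarith [mul_nonneg hs h0]
    have e2 : ∀ᵐ x ∂g.vol, ⟪b x, p.1 x⟫ = ((h ε x : ℝ) : ℂ) := by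
      filter_upwards [hbae] with x hx
      rw [hx, Function.comp_apply, RCLike.inner_apply, regPhase]
      simp only [map_mul, Complex.conj_ofReal]
      rw [mul_comm, mul_assoc, mul_comm _ (p.1 x), Complex.mul_conj, Complex.normSq_eq_norm_sq,
        ← Complex.ofReal_mul]
      congr 1
      simp only [h]; rw [div_eq_inv_mul]
    have hint : Integrable (h ε) g.vol := by
      have h3 := (L2.integrable_inner (𝕜 := ℂ) b p.1).re
      refine h3.congr ?_
      filter_upwards [e2] with x hx
      rw [hx]; simp
    have e3 : (⟪b, p.1⟫).re = ∫ x, h ε x ∂g.vol := by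
      rw [L2.inner_def, integral_congr_ae e2, integral_complex_ofReal, Complex.ofReal_re]
    have h4 : (⟪b, f⟫).re ≤ ∫ x, ‖f x‖ ∂g.vol := by
      refine (Complex.re_le_norm _).trans ?_
      rw [L2.inner_def]
      refine (norm_integral_le_integral_norm _).trans ?_
      refine integral_mono_ae (L2.integrable_inner b f).norm hfi.norm ?_
      filter_upwards [hbae] with x hx
      rw [hx]
      refine (norm_inner_le_norm _ _).trans ?_
      exact mul_le_of_le_one_left (norm_nonneg _) (norm_regPhase_le hε _)
    have h5 : ∫⁻ x, ‖h ε x‖ₑ ∂g.vol = ENNReal.ofReal (∫ x, h ε x ∂g.vol) := by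
      rw [ofReal_integral_eq_lintegral_ofReal hint (Eventually.of_forall fun x => by
        simp only [h, Pi.zero_apply]; positivity)]
      refine lintegral_congr fun x => ?_
      rw [← ofReal_norm, Real.norm_of_nonneg (by simp only [h]; positivity)]
    rw [h5, ← e3]
    refine (ENNReal.ofReal_le_ofReal (h2.trans h4)).trans_eq ?_
    rw [ofReal_integral_eq_lintegral_ofReal hfi.norm (Eventually.of_forall fun x => norm_nonneg _)]
    simp only [ofReal_norm]
  let ε : ℕ → ℝ := fun n => 1 / ((n : ℝ) + 1)
  have hε : ∀ n, 0 < ε n := fun n => by simp only [ε]; positivity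
  have hlim : ∀ x, Tendsto (fun n => h (ε n) x) atTop (𝓝 ‖p.1 x‖) := by
    intro x
    rcases eq_or_ne (p.1 x) 0 with h0 | h0
    · simp [h, h0]
    · have hε0 : Tendsto ε atTop (𝓝 0) := tendsto_one_div_add_atTop_nhds_zero_nat
      have hn : 0 < ‖p.1 x‖ := norm_pos_iff.2 h0
      have := (tendsto_const_nhds (x := ‖p.1 x‖ ^ 2)).div
        ((Real.continuous_sqrt.tendsto _).comp (hε0.add_const (‖p.1 x‖ ^ 2)))
        (by rw [zero_add, Real.sqrt_sq hn.le]; exact hn.ne')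
      have e : ‖p.1 x‖ ^ 2 / Real.sqrt (0 + ‖p.1 x‖ ^ 2) = ‖p.1 x‖ := by
        rw [zero_add, Real.sqrt_sq hn.le]; field_simp
      rw [e] at this
      exact this
  calc ∫⁻ x, ‖p.1 x‖ₑ ∂g.vol = ∫⁻ x, liminf (fun n => ‖h (ε n) x‖ₑ) atTop ∂g.vol := by
        refine lintegral_congr fun x => ?_
        have := ((continuous_enorm.tendsto _).comp (hlim x)).liminf_eq
        rw [enorm_norm] at this
        exact this.symm
    _ ≤ liminf (fun n => ∫⁻ x, ‖h (ε n) x‖ₑ ∂g.vol) atTop :=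
        lintegral_liminf_le' fun n => (hmeas _).enorm
    _ ≤ ∫⁻ x, ‖f x‖ₑ ∂g.vol := liminf_le_of_le (by isBoundedDefault) fun b hb => by
        obtain ⟨i, hi⟩ := hb.exists
        exact hi.trans (hle _ (hε i))

/-- Complex conjugation in `L²`. -/
noncomputable def conjL (g : Metric d) : g.L2 →L[ℝ] g.L2 :=
  (Complex.conjCLE : ℂ →L[ℝ] ℂ).compLpL 2 g.vol

lemma conjL_ae (u : g.L2) : g.conjL u =ᵐ[g.vol] fun x => conj (u x) :=
  ContinuousLinearMap.coeFn_compLpL _ u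

lemma conjL_testToL2 (φ : testFunctions d) : ∃ ψ : testFunctions d,
    g.conjL (g.testToL2 φ) = g.testToL2 ψ ∧
    g.conjL (g.testToL2 (g.minusLaplaceTest φ)) = g.testToL2 (g.minusLaplaceTest ψ) := by
  have hc : ∀ {f : Space d → ℂ}, ContDiff ℝ ∞ f → ContDiff ℝ ∞ fun x => conj (f x) := fun h =>
    Complex.conjCLE.contDiff.comp h
  let ψ : testFunctions d := ⟨fun x => conj ((φ : Space d → ℂ) x), hc φ.2.1,
    φ.2.2.comp_left (g := conj) (map_zero _)⟩
  have key : ∀ a b : testFunctions d, (∀ x, (b : Space d → ℂ) x = conj ((a : Space d → ℂ) x)) →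
      g.conjL (g.testToL2 a) = g.testToL2 b := fun a b h => by
    refine Lp.ext ?_
    filter_upwards [conjL_ae (g.testToL2 a), testToL2_ae (g := g) a, testToL2_ae (g := g) b]
      with x h1 h2 h3
    rw [h1, h2, h3, h]
  refine ⟨ψ, key _ _ fun x => rfl, key _ _ fun x => ?_⟩
  change -g.laplaceBeltrami ψ x = conj (-g.laplaceBeltrami φ x)
  rw [map_neg]
  congr 1
  simp only [laplaceBeltrami, map_sum, Complex.real_smul, map_mul, Complex.conj_ofReal]
  refine Finset.sum_congr rfl fun j _ => Finset.sum_congr rfl fun k _ => ?_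
  congr 1
  rw [← partialDeriv_conj j]
  · congr 1
    ext y
    simp only [map_mul, Complex.conj_ofReal]
    congr 1
    exact partialDeriv_conj k (φ.2.1.differentiable (by simp) y)
  · have := g.contDiff_flux j k φ.2.1
    simp only [Complex.real_smul] at this
    exact this.differentiable (by simp) x

/-- The coefficients of `Δ_g` are real. This is the source of the real-valuedness of the kernel. -/
lemma conjL_mem_P_graph : ∀ p ∈ g.P.graph, (g.conjL p.1, g.conjL p.2) ∈ g.P.graph := by
  have hcl : IsClosed (g.P.graph : Set (g.L2 × g.L2)) := isClosable_minusLaplace.closure_isClosed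
  refine P_graph_induction (S := {p | (g.conjL p.1, g.conjL p.2) ∈ g.P.graph}) ?_ fun φ => ?_
  · exact hcl.preimage (f := fun p : g.L2 × g.L2 => (g.conjL p.1, g.conjL p.2)) (by fun_prop)
  · obtain ⟨ψ, h1, h2⟩ := conjL_testToL2 (g := g) φ
    simp only [Set.mem_ofPred_eq]
    rw [h1, h2]
    have : (g.testToL2 ψ, g.testToL2 (g.minusLaplaceTest ψ)) ∈ g.minusLaplace.graph :=
      mem_minusLaplace_graph.2 ⟨ψ, rfl⟩
    exact LinearPMap.le_graph_of_le (LinearPMap.le_closure _) this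

end Metric

/-- The properties of the heat semigroup of `P` that are used for its kernel. -/
structure IsHeatFlow {d : ℕ} (g : Metric d) (T : ℝ → g.L2 →L[ℂ] g.L2) : Prop where
  generated : IsSemigroupGeneratedBy (-g.P) T
  symm : ∀ t u v, ⟪T t u, v⟫ = ⟪u, T t v⟫
  norm_le : ∀ t u, ‖T t u‖ ≤ ‖u‖
  smoothing : ∀ t, 0 < t → ∃ D : g.L2 →L[ℂ] g.L2, ∀ u, (T t u, D u) ∈ g.P.graph
  map_graph : ∀ t, ∀ p ∈ g.P.graph, (T t p.1, T t p.2) ∈ g.P.graph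
  lintegral_le : ∀ t, 0 < t → ∀ u, ∫⁻ x, ‖T t u x‖ₑ ∂g.vol ≤ ∫⁻ x, ‖u x‖ₑ ∂g.vol
  map_conj : ∀ t, 0 < t → ∀ u, T t (g.conjL u) = g.conjL (T t u)

namespace Metric

variable {d : ℕ} {g : Metric d}

/-- Contractivity in `L¹` and commutation with conjugation are checked on the resolvents, pass to
their powers, and then to the semigroup by Euler's formula. -/
theorem exists_heatFlow {C : ℝ} (hg : g.Bounds C) (hP : IsSelfAdjoint g.P) {l : ℝ} (hl : 0 < l)
    (hsurj : ∀ f, ∃ p ∈ g.P.graph, l • p.1 + p.2 = f) : ∃ T, IsHeatFlow g T := by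
  obtain ⟨T, h1, h2, h3, h4, h5, J, hJ, hT⟩ :=
    exists_heatSemigroup hP P_symmetric (P_nonneg hg) hl hsurj
  refine ⟨T, h1, h2, h3, h5, h4, fun t ht u => ?_, fun t ht u => ?_⟩
  -- The index is shifted by one so that every time step `t / (n + 1)` is positive.
  · refine lintegral_enorm_le_of_tendsto ((hT t ht u).comp (tendsto_add_atTop_nat 1)) fun n => ?_
    have hs : 0 < t / ((n + 1 : ℕ) : ℝ) := by positivity
    have h6 : ∀ f : g.L2, ∫⁻ x, ‖J (t / ((n + 1 : ℕ) : ℝ)) f x‖ₑ ∂g.vol ≤ ∫⁻ x, ‖f x‖ₑ ∂g.vol := by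
      intro f
      have := lintegral_le_of_resolvent hg (hJ _ hs f) hs.le
      have e : J (t / ((n + 1 : ℕ) : ℝ)) f + (t / ((n + 1 : ℕ) : ℝ)) • (t / ((n + 1 : ℕ) : ℝ))⁻¹ •
          (f - J (t / ((n + 1 : ℕ) : ℝ)) f) = f := by
        rw [smul_smul, mul_inv_cancel₀ hs.ne', one_smul, add_sub_cancel]
      exact this.trans_eq (congrArg (fun v : g.L2 => ∫⁻ x, ‖v x‖ₑ ∂g.vol) e)
    simp only [Function.comp_apply]
    have h7 : ∀ (m : ℕ) (f : g.L2), ∫⁻ x, ‖(J (t / ((n + 1 : ℕ) : ℝ)) ^ m) f x‖ₑ ∂g.vol ≤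
        ∫⁻ x, ‖f x‖ₑ ∂g.vol := by
      intro m
      induction m with
      | zero => intro f; simp
      | succ m ih => intro f; rw [pow_succ]; exact (ih _).trans (h6 f)
    exact h7 _ u
  · have hJs : ∀ s, 0 < s → ∀ f, J s (g.conjL f) = g.conjL (J s f) := by
      intro s hs f
      -- `J s (conj f)` and `conj (J s f)` solve the same resolvent equation, whose solution is
      -- unique by `mul_norm_le_of_nonneg`.
      have a := hJ s hs (g.conjL f)
      have b := conjL_mem_P_graph _ (hJ s hs f)
      have c := g.P.graph.sub_mem a b
      have hn := mul_norm_le_of_nonneg (l := s⁻¹) (P_nonneg hg _ c)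
      have e : s⁻¹ • ((J s (g.conjL f), s⁻¹ • (g.conjL f - J s (g.conjL f))) -
          (g.conjL (J s f), g.conjL (s⁻¹ • (f - J s f)))).1 + ((J s (g.conjL f), s⁻¹ • (g.conjL f - J s (g.conjL f))) -
          (g.conjL (J s f), g.conjL (s⁻¹ • (f - J s f)))).2 = (0 : g.L2) := by
        simp only [Prod.fst_sub, Prod.snd_sub, map_smul, map_sub, smul_sub]
        abel
      erw [e, norm_zero] at hn
      have h0 : ‖J s (g.conjL f) - g.conjL (J s f)‖ ≤ 0 := by
        have hsi : 0 < s⁻¹ := inv_pos.2 hs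
        by_contra h; push Not at h
        have := mul_pos hsi h
        simp only [Prod.fst_sub] at hn
        linarith
      exact sub_eq_zero.1 (norm_le_zero_iff.1 h0)
    have l1 := (hT t ht (g.conjL u)).comp (tendsto_add_atTop_nat 1)
    have l2 : Tendsto (fun n : ℕ => g.conjL ((J (t / ((n + 1 : ℕ) : ℝ)) ^ (n + 1)) u)) atTop
        (𝓝 (g.conjL (T t u))) :=
      (g.conjL.continuous.tendsto _).comp ((hT t ht u).comp (tendsto_add_atTop_nat 1))
    refine tendsto_nhds_unique l1 (l2.congr fun n => ?_)
    have hs : 0 < t / ((n + 1 : ℕ) : ℝ) := by positivity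
    have h7 : ∀ (m : ℕ) (f : g.L2), g.conjL ((J (t / ((n + 1 : ℕ) : ℝ)) ^ m) f) =
        (J (t / ((n + 1 : ℕ) : ℝ)) ^ m) (g.conjL f) := by
      intro m
      induction m with
      | zero => intro f; simp
      | succ m ih =>
        intro f
        rw [pow_succ, mul_apply_eq_comp, mul_apply_eq_comp, ih, hJs _ hs]
    exact h7 _ u

end Metric

/-! ### Nash's argument for the semigroup -/

namespace IsHeatFlow

variable {d : ℕ} {g : Metric d} {T : ℝ → g.L2 →L[ℂ] g.L2}

lemma add_apply (hT : IsHeatFlow g T) {s t : ℝ} (hs : 0 ≤ s) (ht : 0 ≤ t) (u : g.L2) :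
    T (s + t) u = T s (T t u) := by
  rw [hT.generated.map_add s t hs ht]; rfl

/-- The generator is a right limit at `0`, so the semigroup law gives right derivatives; the
comparison arguments below need no more. -/
lemma hasDerivWithinAt (hT : IsHeatFlow g T) {t : ℝ} (ht : 0 ≤ t) {u w : g.L2}
    (h : (T t u, w) ∈ g.P.graph) : HasDerivWithinAt (fun s => T s u) (-w) (Set.Ici t) t := by
  rw [← hasDerivWithinAt_Ioi_iff_Ici, hasDerivWithinAt_iff_tendsto_slope' Set.self_notMem_Ioi]
  have h1 := (hT.generated.generator (T t u) (-w)).1 ((neg_graph_iff _ _).2 (by rwa [neg_neg]))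
  have h2 : Tendsto (fun s => s - t) (𝓝[>] t) (𝓝[>] 0) := by
    refine tendsto_nhdsWithin_iff.2 ⟨?_, ?_⟩
    · have : Tendsto (fun s => s - t) (𝓝 t) (𝓝 (t - t)) := (continuous_id.sub continuous_const).tendsto t
      rw [sub_self] at this
      exact this.mono_left nhdsWithin_le_nhds
    · filter_upwards [self_mem_nhdsWithin] with s hs
      exact sub_pos.2 (Set.mem_Ioi.1 hs)
  refine (h1.comp h2).congr' ?_
  filter_upwards [self_mem_nhdsWithin] with s hs
  have hs' : t < s := hs
  simp only [Function.comp_apply, slope_def_module]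
  have h3 := hT.add_apply (sub_pos.2 hs').le ht u
  rw [sub_add_cancel] at h3
  rw [← h3]
  rfl

/-- Nash's bound for the heat semigroup from `L¹` to `L²`. -/
theorem exists_norm_le_lintegral (hd : 2 ≤ d) {C : ℝ} (hg : g.Bounds C) (hT : IsHeatFlow g T) :
    ∃ A : ℝ, 0 < A ∧ ∀ t, 0 < t → ∀ f : g.L2, ∀ L : ℝ, 0 < L →
      ∫⁻ x, ‖f x‖ₑ ∂g.vol ≤ ENNReal.ofReal L → ‖T t f‖ ≤ A * t ^ (-(d : ℝ) / 4) * L := by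
  obtain ⟨K, hK, hN⟩ := Metric.nash hd hg
  have hd0 : (0 : ℝ) < d := by exact_mod_cast (by omega : 0 < d)
  refine ⟨(2 / d) ^ (-(d : ℝ) / 4) * Real.sqrt K, by positivity, fun t ht f L hL hfL => ?_⟩
  rcases (norm_nonneg (T t f)).eq_or_lt with h0 | h0
  · rw [← h0]; positivity
  -- Nash's inequality and contractivity in `L¹` make the right derivative of `y^{-2/d}` at least `κ
  -- = (4/d) (K L²)^{-2/d}`. Integrating over `[t/2, t]`, which avoids time zero where `f` need not
  -- be in the domain, gives `y(t)^{-2/d} ≥ κ t/2`; the power `-d/4` of this is the claim.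
  set y : ℝ → ℝ := fun s => ‖T s f‖ ^ 2 with hy
  have hypos : ∀ s ∈ Set.Icc (t / 2) t, 0 < y s := fun s hs => by
    have h1 : T t f = T (t - s) (T s f) := by
      rw [← hT.add_apply (sub_nonneg.2 hs.2) (by linarith [hs.1]), sub_add_cancel]
    have h2 := hT.norm_le (t - s) (T s f)
    rw [← h1] at h2
    have : 0 < ‖T s f‖ := h0.trans_le h2
    simp only [hy]; positivity
  set κ := (4 / d) * (K * L ^ 2) ^ (-(2 / d) : ℝ) with hκ
  have hκ0 : 0 < κ := by positivity
  choose D hD using fun (s : ℝ) (hs : 0 < s) => hT.smoothing s hs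
  have hder : ∀ s, 0 < s → ∃ w, (T s f, w) ∈ g.P.graph ∧
      HasDerivWithinAt y (-(2 * (⟪T s f, w⟫).re)) (Set.Ici s) s := fun s hs => by
    refine ⟨D s hs f, hD s hs f, ?_⟩
    have h0 := hT.hasDerivWithinAt hs.le (hD s hs f)
    have h1 := Complex.reCLM.hasFDerivAt.comp_hasDerivWithinAt s (h0.inner ℂ h0)
    have e : y = fun r => (⟪T r f, T r f⟫).re := by
      ext r; rw [inner_self_eq_norm_sq_to_K]; norm_cast
    rw [e]
    refine h1.congr_deriv ?_
    simp only [Complex.reCLM_apply, inner_neg_right, inner_neg_left, Complex.add_re, Complex.neg_re]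
    rw [← inner_conj_symm (D s hs f), Complex.conj_re]
    ring
  choose! w hw hy' using hder
  have hz : ∀ x ∈ Set.Ico (t / 2) t, HasDerivWithinAt (fun s => -(y s) ^ (-(2 / d) : ℝ))
      (-(-(2 * (⟪T x f, w x⟫).re) * (-(2 / d)) * y x ^ (-(2 / d) - 1 : ℝ))) (Set.Ici x) x :=
    fun x hx => ((hy' x (by linarith [hx.1])).rpow_const
      (Or.inl (hypos x ⟨hx.1, hx.2.le⟩).ne')).neg
  have hcont : ContinuousOn (fun s => -(y s) ^ (-(2 / d) : ℝ)) (Set.Icc (t / 2) t) := by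
    refine (ContinuousOn.rpow_const ?_ fun x hx => Or.inl (hypos x hx).ne').neg
    exact (((hT.generated.continuousOn f).mono fun x hx =>
      (by linarith [hx.1] : (0 : ℝ) ≤ x)).norm).pow 2
  have key := image_le_of_deriv_right_le_deriv_boundary hcont hz
    (B := fun s => -(κ * (s - t / 2))) (B' := fun _ => -κ)
    (by simp only [sub_self, mul_zero, neg_zero]
        have := Real.rpow_pos_of_pos (hypos (t / 2) ⟨le_rfl, by linarith⟩) (-(2 / d) : ℝ)
        linarith) (by fun_prop)
    (fun x _ => by
      have := (((hasDerivAt_id x).sub_const (t / 2)).const_mul κ).neg.hasDerivWithinAt (s := Set.Ici x)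
      rw [mul_one] at this
      exact this)
    (fun x hx => by
      have hx0 : 0 < x := by linarith [hx.1]
      have hyx := hypos x ⟨hx.1, hx.2.le⟩
      set E := Real.sqrt (⟪T x f, w x⟫).re with hE
      have hE2 : E ^ 2 = (⟪T x f, w x⟫).re := Real.sq_sqrt (Metric.P_nonneg hg _ (hw x hx0))
      have h3 := hN _ (hw x hx0) L hL.le ((hT.lintegral_le x hx0 f).trans hfL)
      have hE0 : 0 ≤ E := Real.sqrt_nonneg _
      have h4 : y x ^ ((d + 2) / 2 : ℝ) ≤ K * L ^ 2 * E ^ d := by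
        refine le_trans (le_of_eq ?_) h3
        simp only [hy]
        rw [← Real.rpow_natCast, ← Real.rpow_natCast, ← Real.rpow_mul (norm_nonneg _)]
        congr 1; push_cast; ring_nf
      have h5 : y x ^ (1 + 2 / d : ℝ) ≤ (K * L ^ 2) ^ (2 / d : ℝ) * E ^ 2 := by
        have := Real.rpow_le_rpow (by positivity) h4 (by positivity : (0 : ℝ) ≤ 2 / d)
        rw [← Real.rpow_mul hyx.le, Real.mul_rpow (by positivity) (by positivity),
          ← Real.rpow_natCast E, ← Real.rpow_mul hE0] at this
        have a1 : ((d + 2) / 2 : ℝ) * (2 / d) = 1 + 2 / d := by field_simp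
        have a2 : (d : ℝ) * (2 / d) = (2 : ℕ) := by push_cast; field_simp
        rwa [a1, a2, Real.rpow_natCast] at this
      rw [← hE2, neg_le_neg_iff]
      have h6 : y x ^ (-(2 / d) - 1 : ℝ) * y x ^ (1 + 2 / d : ℝ) = 1 := by
        rw [← Real.rpow_add hyx]; ring_nf; exact Real.rpow_zero _
      have h7 : (K * L ^ 2) ^ (-(2 / d) : ℝ) * (K * L ^ 2) ^ (2 / d : ℝ) = 1 := by
        rw [← Real.rpow_add (by positivity)]; simp
      set a := y x ^ (-(2 / d) - 1 : ℝ)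
      set b := (K * L ^ 2) ^ (-(2 / d) : ℝ)
      have ha : 0 < a := Real.rpow_pos_of_pos hyx _
      have hb : 0 < b := by positivity
      have h8 : b ≤ a * E ^ 2 := by
        have := mul_le_mul_of_nonneg_left h5 (mul_nonneg ha.le hb.le)
        nlinarith
      have h9 := mul_le_mul_of_nonneg_left h8 (by positivity : (0 : ℝ) ≤ 4 / d)
      calc κ = 4 / d * b := rfl
        _ ≤ _ := h9
        _ = _ := by ring)
    (x := t) ⟨by linarith, le_rfl⟩
  have hyt := hypos t ⟨by linarith, le_rfl⟩
  have h10 : 2 / d * t * (K * L ^ 2) ^ (-(2 / d) : ℝ) ≤ y t ^ (-(2 / d) : ℝ) := by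
    have : κ * (t - t / 2) = 2 / d * t * (K * L ^ 2) ^ (-(2 / d) : ℝ) := by rw [hκ]; ring
    linarith
  have h11 := Real.rpow_le_rpow_of_nonpos (by positivity) h10 (by
    have : (0 : ℝ) < d / 4 := by positivity
    linarith : -(d : ℝ) / 4 ≤ 0)
  rw [Real.mul_rpow (by positivity) (by positivity), Real.mul_rpow (by positivity) ht.le,
    ← Real.rpow_mul hyt.le, ← Real.rpow_mul (by positivity)] at h11
  have e1 : -(2 / d) * (-(d : ℝ) / 4) = 1 / 2 := by field_simp; norm_num
  rw [e1, ← Real.sqrt_eq_rpow, ← Real.sqrt_eq_rpow, Real.sqrt_sq (norm_nonneg _),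
    Real.sqrt_mul hK.le, Real.sqrt_sq hL.le] at h11
  linarith

end IsHeatFlow
end HeatKernel

/-! ### Off-diagonal decay -/

namespace HeatKernel

local notation "⟪" x ", " y "⟫" => inner ℂ x y

open ComplexConjugate

/-- No derivative is assumed at `0`: compare with times `ε > 0` and use continuity as `ε → 0`. -/
lemma le_of_right_deriv_nonpos {f f' : ℝ → ℝ} {t : ℝ} (ht : 0 < t)
    (hc : ContinuousOn f (Set.Icc 0 t))
    (hd : ∀ x, 0 < x → x < t → HasDerivWithinAt f (f' x) (Set.Ici x) x)
    (hn : ∀ x, 0 < x → x < t → f' x ≤ 0) : f t ≤ f 0 := by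
  have h1 : ∀ ε ∈ Set.Ioo 0 t, f t ≤ f ε := by
    intro ε hε
    exact image_le_of_deriv_right_le_deriv_boundary (a := ε) (b := t) (f := f) (f' := f')
      (B := fun _ => f ε) (B' := fun _ => 0)
      (hc.mono (Set.Icc_subset_Icc_left hε.1.le)) (fun x hx => hd x (hε.1.trans_le hx.1) hx.2)
      le_rfl continuousOn_const (fun x _ => hasDerivWithinAt_const _ _ _)
      (fun x hx => hn x (hε.1.trans_le hx.1) hx.2) ⟨hε.2.le, le_rfl⟩
  have h2 : Tendsto f (𝓝[Set.Ioo 0 t] 0) (𝓝 (f 0)) :=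
    (hc 0 ⟨le_rfl, ht.le⟩).mono_left (nhdsWithin_mono _ Set.Ioo_subset_Icc_self)
  have : (𝓝[Set.Ioo 0 t] (0 : ℝ)).NeBot := by
    rw [nhdsWithin_Ioo_eq_nhdsGT ht]; infer_instance
  exact ge_of_tendsto h2 (eventually_nhdsWithin_of_forall h1)

lemma exists_abs_deriv_smoothTransition_le : ∃ c : ℝ, 0 < c ∧ ∀ x, |deriv Real.smoothTransition x| ≤ c := by
  have hc : Continuous (deriv Real.smoothTransition) :=
    (Real.smoothTransition.contDiff (n := 1)).continuous_deriv le_rfl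
  obtain ⟨c, hc1⟩ := (isCompact_Icc (a := (0 : ℝ)) (b := 1)).exists_bound_of_continuousOn hc.continuousOn
  refine ⟨|c| + 1, by positivity, fun x => ?_⟩
  by_cases hx : x ∈ Set.Icc (0 : ℝ) 1
  · exact (hc1 x hx).trans ((le_abs_self c).trans (by linarith))
  · have : deriv Real.smoothTransition x = 0 := by
      rw [Set.mem_Icc, not_and_or, not_le, not_le] at hx
      rcases hx with hx | hx
      · have : Real.smoothTransition =ᶠ[𝓝 x] fun _ => 0 := by
          filter_upwards [Iio_mem_nhds hx] with y hy
          exact Real.smoothTransition.zero_of_nonpos (le_of_lt hy)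
        rw [this.deriv_eq, deriv_const]
      · have : Real.smoothTransition =ᶠ[𝓝 x] fun _ => 1 := by
          filter_upwards [Ioi_mem_nhds hx] with y hy
          exact Real.smoothTransition.one_of_one_le (le_of_lt hy)
        rw [this.deriv_eq, deriv_const]
    rw [this, abs_zero]; positivity

namespace Metric

variable {d : ℕ} {g : Metric d}

lemma inner_mulL {m : Space d → ℝ} (hm : Measurable m) {C : ℝ} (hC : ∀ x, |m x| ≤ C) (u v : g.L2) :
    ⟪g.mulL hm hC u, v⟫ = ⟪u, g.mulL hm hC v⟫ := by
  rw [L2.inner_def, L2.inner_def]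
  refine integral_congr_ae ?_
  filter_upwards [mulL_ae hm hC u, mulL_ae hm hC v] with x h1 h2
  rw [h1, h2, RCLike.inner_apply, RCLike.inner_apply, map_mul, Complex.conj_ofReal]
  ring

/-- Multiplication by the indicator function of a set. -/
noncomputable def cut (g : Metric d) {S : Set (Space d)} (hS : MeasurableSet S) : g.L2 →L[ℂ] g.L2 :=
  g.mulL (m := S.indicator fun _ => 1) (measurable_const.indicator hS) (C := 1) fun x => by
    by_cases hx : x ∈ S <;> simp [hx]

lemma cut_ae {S : Set (Space d)} (hS : MeasurableSet S) (u : g.L2) :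
    g.cut hS u =ᵐ[g.vol] S.indicator u := by
  refine (mulL_ae _ _ u).trans (Eventually.of_forall fun x => ?_)
  by_cases hx : x ∈ S <;> simp [hx]

lemma cut_vanish {S : Set (Space d)} (hS : MeasurableSet S) (u : g.L2) :
    ∀ᵐ x ∂g.vol, x ∉ S → g.cut hS u x = 0 := by
  filter_upwards [cut_ae hS u] with x hx h
  rw [hx, Set.indicator_of_notMem h]

lemma sub_cut_vanish {S : Set (Space d)} (hS : MeasurableSet S) (u : g.L2) :
    ∀ᵐ x ∂g.vol, x ∈ S → (u - g.cut hS u) x = 0 := by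
  filter_upwards [cut_ae hS u, Lp.coeFn_sub u (g.cut hS u)] with x hx h1 h
  rw [h1, Pi.sub_apply, hx, Set.indicator_of_mem h, sub_self]

lemma inner_eq_zero_of_vanish {S : Set (Space d)} {u v : g.L2}
    (hu : ∀ᵐ x ∂g.vol, x ∈ S → u x = 0) (hv : ∀ᵐ x ∂g.vol, x ∉ S → v x = 0) : ⟪u, v⟫ = 0 := by
  rw [L2.inner_def, ← integral_zero (Space d) ℂ (μ := g.vol)]
  refine integral_congr_ae ?_
  filter_upwards [hu, hv] with x h1 h2
  by_cases hx : x ∈ S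
  · rw [h1 hx, inner_zero_left]
  · rw [h2 hx, inner_zero_right]

lemma inner_cut_self {S : Set (Space d)} (hS : MeasurableSet S) (u : g.L2) :
    ⟪g.cut hS u, u⟫ = (‖g.cut hS u‖ : ℂ) ^ 2 := by
  have h : ⟪g.cut hS u, u - g.cut hS u⟫ = 0 :=
    inner_eq_zero_of_vanish (S := Sᶜ) (cut_vanish hS u) (by simpa using sub_cut_vanish hS u)
  rw [inner_sub_right, sub_eq_zero] at h
  rw [h, inner_self_eq_norm_sq_to_K]; norm_cast

lemma norm_sub_cut_le {S : Set (Space d)} (hS : MeasurableSet S) (u : g.L2) :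
    ‖u - g.cut hS u‖ ≤ ‖u‖ := by
  refine Lp.norm_le_norm_of_ae_le ?_
  filter_upwards [cut_ae hS u, Lp.coeFn_sub u (g.cut hS u)] with x hx h
  rw [h, Pi.sub_apply, hx]
  by_cases hx : x ∈ S <;> simp [hx]

end Metric

namespace IsHeatFlow

variable {d : ℕ} {g : Metric d} {T : ℝ → g.L2 →L[ℂ] g.L2}

/-- Growth of exponentially weighted norms. -/
lemma norm_mulL_exp_le (hT : IsHeatFlow g T) {C : ℝ} (hg : g.Bounds C) {ψ : Space d → ℝ}
    (hψ : ContDiff ℝ 1 ψ) (hm : Measurable fun x => Real.exp (ψ x)) {B : ℝ}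
    (hB : ∀ x, |Real.exp (ψ x)| ≤ B) {κ : ℝ}
    (hκ : ∀ x, g.form x (fun j => partialDeriv j ψ x) (fun j => partialDeriv j ψ x) ≤ κ)
    {t : ℝ} (ht : 0 < t) (f : g.L2) :
    ‖g.mulL hm hB (T t f)‖ ≤ Real.exp (κ * t) * ‖g.mulL hm hB f‖ := by
  set M := g.mulL hm hB with hM
  set y : ℝ → ℝ := fun s => ‖M (T s f)‖ ^ 2 with hy
  choose D hD using fun (s : ℝ) (hs : 0 < s) => hT.smoothing s hs
  have hder : ∀ s, 0 < s → ∃ w, (T s f, w) ∈ g.P.graph ∧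
      HasDerivWithinAt y (-(2 * (⟪M (M (T s f)), w⟫).re)) (Set.Ici s) s := fun s hs => by
    refine ⟨D s hs f, hD s hs f, ?_⟩
    have h0 : HasDerivWithinAt (fun r => M (T r f)) (M (-(D s hs f))) (Set.Ici s) s :=
      (M.restrictScalars ℝ).hasFDerivAt.comp_hasDerivWithinAt s (hT.hasDerivWithinAt hs.le (hD s hs f))
    have h1 := Complex.reCLM.hasFDerivAt.comp_hasDerivWithinAt s (h0.inner ℂ h0)
    have e : y = fun r => (⟪M (T r f), M (T r f)⟫).re := by
      ext r; rw [inner_self_eq_norm_sq_to_K]; norm_cast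
    rw [e]
    refine h1.congr_deriv ?_
    simp only [Complex.reCLM_apply, map_neg, inner_neg_right, inner_neg_left, Complex.add_re,
      Complex.neg_re]
    rw [← inner_conj_symm (M (D s hs f)), Complex.conj_re,
      show ⟪M (M (T s f)), D s hs f⟫ = ⟪M (T s f), M (D s hs f)⟫ from Metric.inner_mulL hm hB _ _]
    ring
  choose! w hw hy' using hder
  have hcy : ContinuousOn y (Set.Icc 0 t) :=
    ((M.continuous.comp_continuousOn ((hT.generated.continuousOn f).mono fun x hx => hx.1)).norm).pow 2
  -- `weighted_energy` says that the right derivative of `y` is at most `2κ y`, so `e^{-2κs} y(s)`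
  -- does not increase.
  have key := le_of_right_deriv_nonpos (f := fun s => Real.exp (-(2 * κ) * s) * y s)
    (f' := fun s => Real.exp (-(2 * κ) * s) * (-(2 * κ)) * y s +
      Real.exp (-(2 * κ) * s) * (-(2 * (⟪M (M (T s f)), w s⟫).re))) ht
    ((Continuous.continuousOn (by fun_prop)).mul hcy)
    (fun x hx _ => by
      have h1 : HasDerivAt (fun s => Real.exp (-(2 * κ) * s))
          (Real.exp (-(2 * κ) * x) * (-(2 * κ))) x := by
        simpa using ((hasDerivAt_id x).const_mul (-(2 * κ))).exp
      exact h1.hasDerivWithinAt.mul (hy' x hx))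
    (fun x hx _ => by
      have h2 := Metric.weighted_energy hg hψ hm hB hκ _ (hw x hx)
      simp only [← hM] at h2
      have h3 : 0 < Real.exp (-(2 * κ) * x) := Real.exp_pos _
      change _ * (-(2 * κ)) * ‖M (T x f)‖ ^ 2 + _ ≤ 0
      nlinarith)
  simp only [mul_zero, Real.exp_zero, one_mul, hy, hT.generated.map_zero,
    ContinuousLinearMap.id_apply] at key
  refine le_of_sq_le_sq ?_ (by positivity)
  rw [mul_pow, ← Real.exp_nat_mul]
  have h4 := mul_le_mul_of_nonneg_left key (Real.exp_pos (2 * κ * t)).le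
  rw [← mul_assoc, ← Real.exp_add] at h4
  have e : 2 * κ * t + -(2 * κ) * t = 0 := by ring
  rw [e, Real.exp_zero, one_mul] at h4
  refine h4.trans_eq ?_
  congr 2; push_cast; ring

/-- The Davies-Gaffney estimate for half spaces. -/
theorem exists_gaffney (hT : IsHeatFlow g T) {C : ℝ} (hg : g.Bounds C) :
    ∃ κ : ℝ, 0 < κ ∧ ∀ e : Space d, ‖e‖ = 1 → ∀ r R : ℝ, r < R → ∀ t, 0 < t → ∀ f h : g.L2,
      (∀ᵐ x ∂g.vol, r < inner ℝ e x → f x = 0) → (∀ᵐ x ∂g.vol, inner ℝ e x < R → h x = 0) →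
      ‖⟪h, T t f⟫‖ ≤ Real.exp (-(R - r) ^ 2 / (κ * t)) * ‖f‖ * ‖h‖ := by
  obtain ⟨c, hc, hcd⟩ := exists_abs_deriv_smoothTransition_le
  have hC : 0 < C := by linarith [hg.one_le]
  set κ₀ := C * c ^ 2 with hκ₀
  have hκ0 : 0 < κ₀ := by positivity
  refine ⟨4 * κ₀, by positivity, fun e he r R hrR t ht f h hf hh => ?_⟩
  set w := R - r with hw
  have hw0 : 0 < w := sub_pos.2 hrR
  -- This slope minimises `α² κ₀ t - α w`; the minimum is `-w²/(4 κ₀ t)`.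
  set α := w / (2 * κ₀ * t) with hα
  have hα0 : 0 < α := by positivity
  -- A bounded weight depending only on `⟨e, x⟩`: it is `0` where `f` lives and `α w` where `h`
  -- lives. The two cases are `h1` and `h2` below.
  set ψ : Space d → ℝ := fun x => α * w * Real.smoothTransition ((inner ℝ e x - r) / w) with hψd
  have hin : ContDiff ℝ 1 fun x : Space d => (inner ℝ e x - r) / w :=
    (((innerSL ℝ e).contDiff).sub contDiff_const).div_const w
  have hψ : ContDiff ℝ 1 ψ := contDiff_const.mul (Real.smoothTransition.contDiff.comp hin)
  have hB : ∀ x, |Real.exp (ψ x)| ≤ Real.exp (α * w) := fun x => by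
    rw [abs_of_pos (Real.exp_pos _), Real.exp_le_exp]
    exact mul_le_of_le_one_right (by positivity) (Real.smoothTransition.le_one _)
  have hm : Measurable fun x => Real.exp (ψ x) := hψ.continuous.rexp.measurable
  have hpd : ∀ x j, partialDeriv j ψ x =
      α * deriv Real.smoothTransition ((inner ℝ e x - r) / w) * e j := by
    intro x j
    have h1 : HasFDerivAt (fun x : Space d => (inner ℝ e x - r) / w) (w⁻¹ • innerSL ℝ e) x := by
      have := (((innerSL ℝ e).hasFDerivAt (x := x)).sub_const r).mul_const w⁻¹
      simpa [div_eq_mul_inv] using this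
    have h2 : HasDerivAt Real.smoothTransition
        (deriv Real.smoothTransition ((inner ℝ e x - r) / w)) ((inner ℝ e x - r) / w) :=
      ((Real.smoothTransition.contDiff (n := 1)).differentiable (by simp) _).hasDerivAt
    have h3 := (h2.comp_hasFDerivAt x h1).const_mul (α * w)
    have h4 : fderiv ℝ ψ x = _ := h3.fderiv
    rw [partialDeriv, h4]
    simp only [smul_apply, smul_eq_mul, innerSL_apply_apply]
    have h5 : inner ℝ e (EuclideanSpace.single j (1 : ℝ)) = e j := by
      rw [EuclideanSpace.inner_single_right]; simp
    rw [h5]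
    field_simp
  have hκ : ∀ x, g.form x (fun j => partialDeriv j ψ x) (fun j => partialDeriv j ψ x) ≤
      α ^ 2 * κ₀ := by
    intro x
    refine (hg.inv_form_upper x _).trans ?_
    simp only [hpd, mul_pow, ← Finset.mul_sum]
    have h1 : ∑ j, e j ^ 2 = 1 := by
      have := EuclideanSpace.norm_sq_eq e
      rw [he] at this
      simpa using this.symm
    rw [h1, mul_one, hκ₀]
    have h2 := sq_le_sq' (by linarith [(abs_le.1 (hcd ((inner ℝ e x - r) / w))).1])
      (abs_le.1 (hcd ((inner ℝ e x - r) / w))).2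
    have := mul_le_mul_of_nonneg_left h2 (by positivity : 0 ≤ C * α ^ 2)
    nlinarith
  have hN := hT.norm_mulL_exp_le hg hψ hm hB hκ ht f
  have h1 : g.mulL hm hB f = f := by
    refine Lp.ext ?_
    filter_upwards [Metric.mulL_ae hm hB f, hf] with x hx hfx
    rw [hx]
    by_cases hr : r < inner ℝ e x
    · rw [hfx hr, mul_zero]
    · have : ψ x = 0 := by
        simp only [hψd]
        rw [Real.smoothTransition.zero_of_nonpos, mul_zero]
        exact div_nonpos_of_nonpos_of_nonneg (by linarith) hw0.le
      rw [this]; simp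
  have h2 : g.mulL hm hB h = ((Real.exp (α * w) : ℝ) : ℂ) • h := by
    refine Lp.ext ?_
    filter_upwards [Metric.mulL_ae hm hB h, hh, Lp.coeFn_smul ((Real.exp (α * w) : ℝ) : ℂ) h]
      with x hx hhx hs
    rw [hx, hs, Pi.smul_apply, smul_eq_mul]
    by_cases hr : inner ℝ e x < R
    · rw [hhx hr, mul_zero, mul_zero]
    · have : ψ x = α * w := by
        simp only [hψd]
        rw [Real.smoothTransition.one_of_one_le, mul_one]
        rw [le_div_iff₀ hw0]; linarith
      rw [this]
  rw [h1] at hN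
  have h3 : ((Real.exp (α * w) : ℝ) : ℂ) * ⟪h, T t f⟫ = ⟪h, g.mulL hm hB (T t f)⟫ := by
    rw [← Metric.inner_mulL, h2, inner_smul_left, Complex.conj_ofReal]
  have h4 : Real.exp (α * w) * ‖⟪h, T t f⟫‖ ≤ ‖h‖ * (Real.exp (α ^ 2 * κ₀ * t) * ‖f‖) := by
    have := congrArg norm h3
    rw [norm_mul, Complex.norm_real, Real.norm_of_nonneg (Real.exp_pos _).le] at this
    rw [this]
    exact (norm_inner_le_norm _ _).trans (by gcongr)
  have h5 : Real.exp (-w ^ 2 / (4 * κ₀ * t)) = Real.exp (α ^ 2 * κ₀ * t) / Real.exp (α * w) := by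
    rw [← Real.exp_sub]
    congr 1
    rw [hα]; field_simp; ring
  rw [h5, div_mul_eq_mul_div, div_mul_eq_mul_div, le_div_iff₀ (Real.exp_pos _)]
  linarith

/-- Gaussian decay of the heat semigroup from `L¹` to `L²`, off the diagonal. -/
theorem exists_norm_inner_le (hd : 2 ≤ d) {C : ℝ} (hg : g.Bounds C) (hT : IsHeatFlow g T) :
    ∃ A c : ℝ, 0 < A ∧ 0 < c ∧ ∀ e : Space d, ‖e‖ = 1 → ∀ r δ : ℝ, 0 < δ → ∀ t, 0 < t →
      ∀ f h : g.L2, ∀ L : ℝ, 0 < L → ∫⁻ x, ‖f x‖ₑ ∂g.vol ≤ ENNReal.ofReal L →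
      (∀ᵐ x ∂g.vol, r < inner ℝ e x → f x = 0) → (∀ᵐ x ∂g.vol, inner ℝ e x < r + δ → h x = 0) →
      ‖⟪h, T t f⟫‖ ≤ A * t ^ (-(d : ℝ) / 4) * Real.exp (-(c * (δ ^ 2 / t))) * L * ‖h‖ := by
  obtain ⟨A, hA, hAL⟩ := hT.exists_norm_le_lintegral hd hg
  obtain ⟨κ, hκ, hG⟩ := hT.exists_gaffney hg
  set b : ℝ := (2 : ℝ) ^ ((d : ℝ) / 4) with hb
  have hb0 : 0 < b := by positivity
  -- The Gaffney exponent for time `t/2` and distance `δ/4`: `(δ/4)² / (κ t/2) = c δ²/t`.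
  set c := 1 / (8 * κ) with hc
  have hc0 : 0 < c := by positivity
  -- Halving the time costs the factor `b = 2^{d/4}`, whereas the pair `(3δ/4, t/2)` has `δ²/t`
  -- multiplied by `9/8`. For `X = δ²/t ≥ X₀` the gain `e^{-cX/8}` is at most `1/(2b)`; for smaller
  -- `X` the Nash bound suffices, at the price of `e^{c X₀}` in `A'`.
  set X₀ := 8 * Real.log (2 * b) / c with hX₀
  set A' := A * Real.exp (c * X₀) + 2 * A * b with hA'
  have hA'0 : 0 < A' := by positivity
  refine ⟨A', c, hA'0, hc0, fun e he r δ hδ t ht f h L hL hfL hf hh => ?_⟩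
  -- Induction on the number of halvings of the time. The error `‖T (t/2ⁿ) f - f‖` comes from the
  -- base case, where `h` is orthogonal to `f`, and vanishes as `n → ∞`.
  have main : ∀ n : ℕ, ∀ t, 0 < t → ∀ δ, 0 < δ → ∀ h : g.L2,
      (∀ᵐ x ∂g.vol, inner ℝ e x < r + δ → h x = 0) →
      ‖⟪h, T t f⟫‖ ≤ (A' * t ^ (-(d : ℝ) / 4) * Real.exp (-(c * (δ ^ 2 / t))) * L +
        ‖T (t / 2 ^ n) f - f‖) * ‖h‖ := by
    intro n
    induction n with
    | zero =>
      intro t ht δ hδ h hh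
      have h0 : ⟪h, f⟫ = 0 := by
        refine Metric.inner_eq_zero_of_vanish (S := {x | inner ℝ e x < r + δ}) hh ?_
        filter_upwards [hf] with x hx h1
        exact hx (by simp only [not_lt] at h1; linarith)
      have h1 : ⟪h, T t f⟫ = ⟪h, T t f - f⟫ := by rw [inner_sub_right, h0, sub_zero]
      rw [h1, pow_zero, div_one]
      refine (norm_inner_le_norm _ _).trans ?_
      rw [mul_comm]
      gcongr
      exact le_add_of_nonneg_left (by positivity)
    | succ n ih =>
      intro t ht δ hδ h hh
      set X := δ ^ 2 / t with hX
      have hX0 : 0 < X := by positivity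
      rcases lt_or_ge X X₀ with hXX | hXX
      · have h1 : ‖⟪h, T t f⟫‖ ≤ ‖h‖ * (A * t ^ (-(d : ℝ) / 4) * L) :=
          (norm_inner_le_norm _ _).trans (by gcongr; exact hAL t ht f L hL hfL)
        refine h1.trans ?_
        rw [mul_comm]
        refine mul_le_mul_of_nonneg_right ?_ (norm_nonneg _)
        refine le_trans ?_ (le_add_of_nonneg_right (norm_nonneg _))
        have h2 : 1 ≤ Real.exp (c * X₀) * Real.exp (-(c * X)) := by
          rw [← Real.exp_add]
          refine Real.one_le_exp ?_
          nlinarith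
        have h3 : 0 < Real.exp (-(c * X)) := Real.exp_pos _
        have h4 : A * 1 ≤ A * (Real.exp (c * X₀) * Real.exp (-(c * X))) := by gcongr
        have h5 : 0 ≤ 2 * A * b * Real.exp (-(c * X)) := by positivity
        have h6 : A ≤ A' * Real.exp (-(c * X)) := by rw [hA']; nlinarith
        have h7 := mul_le_mul_of_nonneg_right h6
          (by positivity : 0 ≤ t ^ (-(d : ℝ) / 4) * L)
        linarith
      · have ht2 : 0 < t / 2 := by positivity
        -- Split `F = T (t/2) f` at `r + 3δ/4`. The part `F1` below is at distance `δ/4` from the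
        -- support of `h`, so Gaffney and the Nash bound apply. The part `F2` above is estimated by
        -- the induction hypothesis tested with `F2` itself, since `⟪F2, F⟫ = ‖F2‖²`.
        set S : Set (Space d) := {x | r + 3 / 4 * δ ≤ inner ℝ e x} with hS
        have hSm : MeasurableSet S := (isClosed_le continuous_const
          (by fun_prop : Continuous fun x : Space d => inner ℝ e x)).measurableSet
        set F := T (t / 2) f with hF
        set F2 := g.cut hSm F with hF2
        set F1 := F - F2 with hF1
        have e1 : T t f = T (t / 2) F1 + T (t / 2) F2 := by
          rw [← map_add, hF1, sub_add_cancel, hF, ← hT.add_apply ht2.le ht2.le, add_halves]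
        have hpow : (t / 2) ^ (-(d : ℝ) / 4) = b * t ^ (-(d : ℝ) / 4) := by
          rw [Real.div_rpow ht.le (by norm_num), hb, neg_div, Real.rpow_neg (by norm_num : (0 : ℝ) ≤ 2),
            div_inv_eq_mul, mul_comm]
        have n1 : ‖F1‖ ≤ A * (b * t ^ (-(d : ℝ) / 4)) * L := by
          rw [← hpow]
          exact (Metric.norm_sub_cut_le hSm F).trans (hAL _ ht2 f L hL hfL)
        have n2 : ‖F2‖ ≤ A' * (b * t ^ (-(d : ℝ) / 4)) * Real.exp (-(c * (9 / 8 * X))) * L +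
            ‖T (t / 2 ^ (n + 1)) f - f‖ := by
          have h1 := ih (t / 2) ht2 (3 / 4 * δ) (by positivity) F2 (by
            filter_upwards [Metric.cut_vanish hSm F] with x hx h1
            exact hx (by simp only [hS, Set.mem_ofPred_eq, not_le]; exact h1))
          rw [hpow, show (3 / 4 * δ) ^ 2 / (t / 2) = 9 / 8 * X by rw [hX]; ring,
            show t / 2 / 2 ^ n = t / 2 ^ (n + 1) by rw [pow_succ]; field_simp] at h1
          have h2 : ‖⟪F2, F⟫‖ = ‖F2‖ * ‖F2‖ := by
            rw [hF2, Metric.inner_cut_self, norm_pow, Complex.norm_real, norm_norm, sq]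
          rw [h2] at h1
          rcases (norm_nonneg F2).eq_or_lt with h0 | h0
          · rw [← h0]; positivity
          · exact le_of_mul_le_mul_right h1 h0
        have i1 : ‖⟪h, T (t / 2) F1⟫‖ ≤ Real.exp (-(c * X)) * ‖F1‖ * ‖h‖ := by
          have h1 := hG e he (r + 3 / 4 * δ) (r + δ) (by linarith) (t / 2) ht2 F1 h (by
            filter_upwards [Metric.sub_cut_vanish hSm F] with x hx h1
            exact hx (le_of_lt h1)) hh
          have e2 : -(r + δ - (r + 3 / 4 * δ)) ^ 2 / (κ * (t / 2)) = -(c * X) := by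
            rw [hc, hX]; field_simp; ring
          rwa [e2] at h1
        have i2 : ‖⟪h, T (t / 2) F2⟫‖ ≤ ‖F2‖ * ‖h‖ := by
          rw [mul_comm]
          exact (norm_inner_le_norm _ _).trans (by gcongr; exact hT.norm_le _ _)
        have hexp : b * Real.exp (-(c * (9 / 8 * X))) ≤ 1 / 2 * Real.exp (-(c * X)) := by
          have h1 : Real.exp (-(c * (9 / 8 * X))) = Real.exp (-(c * X / 8)) * Real.exp (-(c * X)) := by
            rw [← Real.exp_add]; congr 1; ring
          have h2 : Real.exp (-(c * X / 8)) ≤ (2 * b)⁻¹ := by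
            rw [← Real.exp_log (by positivity : 0 < (2 * b)⁻¹), Real.exp_le_exp, Real.log_inv,
              neg_le_neg_iff]
            rw [hX₀, div_le_iff₀ hc0] at hXX
            linarith
          rw [h1]
          calc b * (Real.exp (-(c * X / 8)) * Real.exp (-(c * X)))
              ≤ b * ((2 * b)⁻¹ * Real.exp (-(c * X))) := by gcongr
            _ = _ := by field_simp
        rw [e1, inner_add_right]
        refine (norm_add_le _ _).trans ((add_le_add i1 i2).trans ?_)
        rw [← add_mul]
        refine mul_le_mul_of_nonneg_right ?_ (norm_nonneg _)
        set E := Real.exp (-(c * X)) with hE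
        have hE0 : 0 < E := Real.exp_pos _
        set τ := t ^ (-(d : ℝ) / 4) with hτ
        have hτ0 : 0 < τ := by positivity
        have j1 : E * ‖F1‖ ≤ E * (A * (b * τ) * L) := by gcongr
        have j2 : A' * (b * τ) * Real.exp (-(c * (9 / 8 * X))) * L ≤ A' * τ * L * (1 / 2 * E) := by
          calc _ = A' * τ * L * (b * Real.exp (-(c * (9 / 8 * X)))) := by ring
            _ ≤ _ := by gcongr
        -- This makes the near part at most half of the target; the far part takes the other half
        -- and the error term.
        have j3 : 2 * A * b ≤ A' := by rw [hA']; linarith [mul_pos hA (Real.exp_pos (c * X₀))]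
        have j4 := mul_le_mul_of_nonneg_right j3 (by positivity : 0 ≤ τ * E * L)
        nlinarith
  have hlim : Tendsto (fun n : ℕ => (A' * t ^ (-(d : ℝ) / 4) * Real.exp (-(c * (δ ^ 2 / t))) * L +
      ‖T (t / 2 ^ n) f - f‖) * ‖h‖) atTop
      (𝓝 ((A' * t ^ (-(d : ℝ) / 4) * Real.exp (-(c * (δ ^ 2 / t))) * L + ‖f - f‖) * ‖h‖)) := by
    have h1 : Tendsto (fun n : ℕ => t / 2 ^ n) atTop (𝓝[Set.Ici 0] 0) := by
      refine tendsto_nhdsWithin_iff.2 ⟨?_, Eventually.of_forall fun n => ?_⟩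
      · exact tendsto_const_nhds.div_atTop (tendsto_pow_atTop_atTop_of_one_lt (by norm_num))
      · exact Set.mem_Ici.2 (by positivity)
    have h2 := (hT.generated.continuousOn f 0 Set.self_mem_Ici).tendsto.comp h1
    rw [hT.generated.map_zero] at h2
    exact ((h2.sub_const f).norm.const_add _).mul_const _
  rw [sub_self, norm_zero, add_zero] at hlim
  exact ge_of_tendsto hlim (Eventually.of_forall fun n => main n t ht δ hδ h hh)

end IsHeatFlow
end HeatKernel

/-! ### Mollification and distributional solutions -/

namespace HeatKernel

local notation "⟪" x ", " y "⟫" => inner ℂ x y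

open ComplexConjugate

lemma contDiff_partialDeriv_real {d : ℕ} (j : Fin d) {f : Space d → ℝ} (h : ContDiff ℝ ∞ f) :
    ContDiff ℝ ∞ (partialDeriv j f) :=
  (h.fderiv_right (by simp)).clm_apply contDiff_const

lemma hasCompactSupport_partialDeriv_real {d : ℕ} (j : Fin d) {f : Space d → ℝ}
    (h : HasCompactSupport f) : HasCompactSupport (partialDeriv j f) := h.fderiv_apply ℝ _

lemma partialDeriv_ofReal {d : ℕ} (j : Fin d) {f : Space d → ℝ} {x : Space d}
    (h : DifferentiableAt ℝ f x) :
    partialDeriv j (fun y => (f y : ℂ)) x = ((partialDeriv j f x : ℝ) : ℂ) := by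
  have : HasFDerivAt (fun y => (f y : ℂ)) _ x := Complex.ofRealCLM.hasFDerivAt.comp x h.hasFDerivAt
  simp only [partialDeriv]
  rw [this.fderiv]; rfl

lemma partialDeriv_sub_left {d : ℕ} {F : Type*} [NormedAddCommGroup F] [NormedSpace ℝ F] (j : Fin d)
    {f : Space d → F} (hf : Differentiable ℝ f) (x : Space d) :
    partialDeriv j (fun y => f (x - y)) = fun y => -partialDeriv j f (x - y) := by
  ext y
  have h : HasFDerivAt (fun y => f (x - y)) _ y :=
    (hf (x - y)).hasFDerivAt.comp y ((hasFDerivAt_id y).const_sub x)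
  simp only [partialDeriv]
  rw [h.fderiv]
  simp

/-- The Schur test for convolutions in `L²`. -/
lemma lintegral_sq_convolution_le {d : ℕ} {k f : Space d → ℝ≥0∞} (hk : Measurable k)
    (hf : AEMeasurable f) :
    ∫⁻ x, (∫⁻ y, k (x - y) * f y) ^ 2 ≤ (∫⁻ z, k z) ^ 2 * ∫⁻ y, f y ^ 2 := by
  obtain ⟨f', hf', hff⟩ := hf
  have e0 : ∀ x, ∫⁻ y, k (x - y) * f y = ∫⁻ y, k (x - y) * f' y := fun x =>
    lintegral_congr_ae (by filter_upwards [hff] with y hy; rw [hy])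
  have e1 : ∫⁻ y, f y ^ 2 = ∫⁻ y, f' y ^ 2 :=
    lintegral_congr_ae (by filter_upwards [hff] with y hy; rw [hy])
  simp only [e0, e1]
  have hkx : ∀ x : Space d, Measurable fun y => k (x - y) := fun x => hk.comp (measurable_const.sub measurable_id)
  have hsum : ∀ x : Space d, ∫⁻ y, k (x - y) = ∫⁻ z, k z := fun x => lintegral_sub_left_eq_self k x
  have hp : ∀ x : Space d, (∫⁻ y, k (x - y) * f' y) ^ 2 ≤ (∫⁻ z, k z) * ∫⁻ y, k (x - y) * f' y ^ 2 := by
    intro x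
    have h1 := ENNReal.lintegral_mul_le_Lp_mul_Lq volume Real.HolderConjugate.two_two
      (f := fun y => k (x - y) ^ (1 / 2 : ℝ)) (g := fun y => k (x - y) ^ (1 / 2 : ℝ) * f' y)
      ((hkx x).pow_const _).aemeasurable (((hkx x).pow_const _).mul hf').aemeasurable
    have e2 : ∀ a : ℝ≥0∞, (a ^ (1 / 2 : ℝ)) ^ (2 : ℝ) = a := fun a => by
      rw [← ENNReal.rpow_mul]; norm_num
    have e3 : ∀ y, ((fun y => k (x - y) ^ (1 / 2 : ℝ)) * fun y => k (x - y) ^ (1 / 2 : ℝ) * f' y) y =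
        k (x - y) * f' y := fun y => by
      simp only [Pi.mul_apply]
      rw [← mul_assoc, ← ENNReal.rpow_add_of_nonneg _ _ (by norm_num) (by norm_num)]
      norm_num
    have e4 : ∀ a b : ℝ≥0∞, (a ^ (1 / 2 : ℝ) * b) ^ (2 : ℝ) = a * b ^ 2 := fun a b => by
      rw [ENNReal.mul_rpow_of_nonneg _ _ (by norm_num), e2, ENNReal.rpow_two]
    simp only [e2, e3, e4, hsum] at h1
    calc (∫⁻ y, k (x - y) * f' y) ^ 2 ≤ _ := pow_le_pow_left' h1 2
      _ = _ := by
        rw [mul_pow, ← ENNReal.rpow_two, ← ENNReal.rpow_two, e2, e2]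
  calc ∫⁻ x, (∫⁻ y, k (x - y) * f' y) ^ 2 ≤ ∫⁻ x, (∫⁻ z, k z) * ∫⁻ y, k (x - y) * f' y ^ 2 :=
        lintegral_mono hp
    _ = (∫⁻ z, k z) * ∫⁻ y, ∫⁻ x, k (x - y) * f' y ^ 2 := by
        have hm : Measurable fun p : Space d × Space d => k (p.1 - p.2) * f' p.2 ^ 2 :=
          (hk.comp (measurable_fst.sub measurable_snd)).mul ((hf'.comp measurable_snd).pow_const 2)
        rw [lintegral_const_mul _ hm.lintegral_prod_right',
          lintegral_lintegral_swap hm.aemeasurable]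
    _ = _ := by
        have : ∀ y, ∫⁻ x, k (x - y) * f' y ^ 2 = (∫⁻ z, k z) * f' y ^ 2 := fun y => by
          rw [lintegral_mul_const _ (show Measurable fun x => k (x - y) from hk.comp (measurable_id.sub measurable_const)),
            lintegral_sub_right_eq_self k y]
        simp only [this]
        rw [lintegral_const_mul _ (hf'.pow_const 2), sq, mul_assoc]

/-- The convolution of a real kernel with a complex function. -/
noncomputable def moll {d : ℕ} (k : Space d → ℝ) (f : Space d → ℂ) : Space d → ℂ :=
  convolution f k (ContinuousLinearMap.lsmul ℝ ℝ).flip volume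

section moll

variable {d : ℕ} {k : Space d → ℝ} {f : Space d → ℂ}

lemma moll_apply (k : Space d → ℝ) (f : Space d → ℂ) (x : Space d) :
    moll k f x = ∫ y, (k (x - y) : ℂ) * f y := by
  simp only [moll, convolution_def, ContinuousLinearMap.flip_apply, ContinuousLinearMap.lsmul_apply,
    Complex.real_smul]

lemma integrable_moll (hf : LocallyIntegrable f) (hk : Continuous k) (hs : HasCompactSupport k)
    (x : Space d) : Integrable fun y => (k (x - y) : ℂ) * f y := by
  have := hs.convolutionExists_right (ContinuousLinearMap.lsmul ℝ ℝ).flip hf hk x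
  simpa [ConvolutionExistsAt, Complex.real_smul] using this

lemma contDiff_moll (hf : LocallyIntegrable f) (hk : ContDiff ℝ ∞ k) (hs : HasCompactSupport k) :
    ContDiff ℝ 1 (moll k f) :=
  hs.contDiff_convolution_right (n := 1) _ hf (hk.of_le (by simp))

lemma partialDeriv_moll (hf : LocallyIntegrable f) (hk : ContDiff ℝ ∞ k) (hs : HasCompactSupport k)
    (j : Fin d) : partialDeriv j (moll k f) = moll (partialDeriv j k) f := by
  ext x
  have h1 : ContDiff ℝ 1 k := hk.of_le (by simp)
  rw [partialDeriv, moll, (hs.hasFDerivAt_convolution_right _ hf h1 x).fderiv,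
    convolution_precompR_apply _ hf (hs.fderiv ℝ) (h1.continuous_fderiv one_ne_zero)]
  rfl

lemma enorm_moll_le (x : Space d) : ‖moll k f x‖ₑ ≤ ∫⁻ y, ‖k (x - y)‖ₑ * ‖f y‖ₑ := by
  rw [moll_apply]
  refine (enorm_integral_le_lintegral_enorm _).trans_eq (lintegral_congr fun y => ?_)
  rw [enorm_mul]
  congr 1
  rw [← ofReal_norm, ← ofReal_norm, Complex.norm_real]

lemma memLp_moll (hf : MemLp f 2 volume) (hk : ContDiff ℝ ∞ k) (hs : HasCompactSupport k) :
    MemLp (moll k f) 2 volume := by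
  refine ⟨(contDiff_moll (hf.locallyIntegrable (by norm_num)) hk hs).continuous.aestronglyMeasurable, ?_⟩
  have h1 : ∫⁻ z, ‖k z‖ₑ < ⊤ := (hk.continuous.integrable_of_hasCompactSupport hs).2
  have h2 : ∫⁻ y, ‖f y‖ₑ ^ 2 < ⊤ := by
    have := lintegral_rpow_enorm_lt_top_of_eLpNorm_lt_top (by norm_num) (by norm_num) hf.2
    simpa using this
  rw [eLpNorm_lt_top_iff_lintegral_rpow_enorm_lt_top (by norm_num) (by norm_num)]
  simp only [ENNReal.toReal_ofNat, ENNReal.rpow_two]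
  calc ∫⁻ x, ‖moll k f x‖ₑ ^ 2 ≤ ∫⁻ x, (∫⁻ y, ‖k (x - y)‖ₑ * ‖f y‖ₑ) ^ 2 :=
        lintegral_mono fun x => pow_le_pow_left' (enorm_moll_le x) 2
    _ ≤ _ := lintegral_sq_convolution_le hk.continuous.measurable.enorm hf.1.enorm
    _ < ⊤ := ENNReal.mul_lt_top (ENNReal.pow_lt_top h1) h2

end moll

namespace Metric

variable {d : ℕ} {g : Metric d}

/-- The Laplace-Beltrami operator on real functions, in non-divergence form. -/
noncomputable def laplace (g : Metric d) (f : Space d → ℝ) (x : Space d) : ℝ :=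
  ∑ k, (∑ j, g.inv j k x * partialDeriv j (partialDeriv k f) x + g.drift k x * partialDeriv k f x)

lemma laplaceBeltrami_ofReal {f : Space d → ℝ} (hf : ContDiff ℝ ∞ f) (x : Space d) :
    g.laplaceBeltrami (fun y => (f y : ℂ)) x = ((g.laplace f x : ℝ) : ℂ) := by
  have h1 : ∀ k, partialDeriv k (fun y => (f y : ℂ)) = fun y => ((partialDeriv k f y : ℝ) : ℂ) :=
    fun k => funext fun y => partialDeriv_ofReal k (hf.differentiable (by simp) y)
  have hA : ∀ j k, Differentiable ℝ fun y => g.inv j k y * g.density y := fun j k =>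
    ((g.contDiff_inv j k).mul g.contDiff_density).differentiable (by simp)
  have hD : ∀ k, Differentiable ℝ (partialDeriv k f) := fun k =>
    (contDiff_partialDeriv_real k hf).differentiable (by simp)
  have h2 : ∀ j k, partialDeriv j (fun y => (g.inv j k y * g.density y) •
      partialDeriv k (fun y => (f y : ℂ)) y) x =
      ((partialDeriv j (fun y => g.inv j k y * g.density y * partialDeriv k f y) x : ℝ) : ℂ) := by
    intro j k
    rw [← partialDeriv_ofReal j (f := fun y => g.inv j k y * g.density y * partialDeriv k f y)
      (((hA j k).mul (hD k)) x), h1]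
    congr 1
    ext y
    simp
  have h3 : ∀ j k, partialDeriv j (fun y => g.inv j k y * g.density y * partialDeriv k f y) x =
      g.inv j k x * g.density x * partialDeriv j (partialDeriv k f) x +
        partialDeriv j (fun y => g.inv j k y * g.density y) x * partialDeriv k f x := by
    intro j k
    have h4 := fderiv_fun_mul (hA j k x) (hD k x)
    rw [partialDeriv, h4]
    simp only [partialDeriv]
    simp only [add_apply, smul_apply, smul_eq_mul]
    ring
  simp only [laplaceBeltrami, h2, h3, laplace, drift]
  have hp := (g.density_pos x).ne'
  rw [Finset.sum_comm]
  push_cast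
  refine Finset.sum_congr rfl fun k _ => ?_
  rw [Finset.sum_mul, ← Finset.sum_add_distrib]
  refine Finset.sum_congr rfl fun j _ => ?_
  have hp' : (g.density x : ℂ) ≠ 0 := by exact_mod_cast hp
  rw [Complex.real_smul]
  push_cast
  field_simp

/-- An element of `L²(ℝ^d, d_g x)`, as a density with respect to Lebesgue measure. -/
noncomputable def dens (u : g.L2) (x : Space d) : ℂ := (g.density x : ℂ) * u x

lemma memLp_volume {C : ℝ} (hg : g.Bounds C) (u : g.L2) : MemLp u 2 volume :=
  (Lp.memLp u).of_measure_le_smul ENNReal.ofReal_ne_top (volume_le hg)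

lemma memLp_dens {C : ℝ} (hg : g.Bounds C) (u : g.L2) : MemLp (dens u) 2 volume := by
  refine (memLp_volume hg u).of_le_mul (c := C) ?_ (Eventually.of_forall fun x => ?_)
  · exact (Complex.measurable_ofReal.comp
      g.contDiff_density.continuous.measurable).aestronglyMeasurable.mul (memLp_volume hg u).1
  · rw [dens, norm_mul, Complex.norm_real, Real.norm_of_nonneg (g.density_pos x).le]
    exact mul_le_mul_of_nonneg_right (hg.density_upper x) (norm_nonneg _)

/-- `-Δ_g u = w` in the sense of distributions. -/
def WeakEq (u w : g.L2) : Prop :=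
  ∀ φ : testFunctions d, ⟪g.testToL2 (g.minusLaplaceTest φ), u⟫ = ⟪g.testToL2 φ, w⟫

lemma weakEq_of_mem_graph {p : g.L2 × g.L2} (hp : p ∈ g.P.graph) : WeakEq p.1 p.2 := fun φ =>
  P_symmetric _ (LinearPMap.le_graph_of_le (LinearPMap.le_closure _)
    (mem_minusLaplace_graph.2 ⟨φ, rfl⟩)) _ hp

/-- In terms of Lebesgue measure, `W = ρ u` solves `∑ ∂_j ∂_k (g^{jk} W) - ∑ ∂_k (b_k W) = -ρ w` in
the sense of distributions, where `b` is the drift. All derivatives fall on the test function, so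
mollification applies directly. -/
lemma WeakEq.integral_laplace {u w : g.L2} (h : WeakEq u w) {f : Space d → ℝ} (hf : ContDiff ℝ ∞ f)
    (hs : HasCompactSupport f) :
    ∫ x, ((g.laplace f x : ℝ) : ℂ) * dens u x = -∫ x, (f x : ℂ) * dens w x := by
  have h1 := h (ofRealTest hf hs)
  rw [L2.inner_def, L2.inner_def] at h1
  have e1 : ∫ x, ⟪g.testToL2 (g.minusLaplaceTest (ofRealTest hf hs)) x, u x⟫ ∂g.vol =
      ∫ x, -((g.laplace f x : ℝ) : ℂ) * u x ∂g.vol := by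
    refine integral_congr_ae ?_
    filter_upwards [testToL2_ae (g := g) (g.minusLaplaceTest (ofRealTest hf hs))] with x hx
    rw [hx, RCLike.inner_apply]
    change u x * conj (-g.laplaceBeltrami (fun y => (f y : ℂ)) x) = _
    rw [laplaceBeltrami_ofReal hf, map_neg, Complex.conj_ofReal]; ring
  have e2 : ∫ x, ⟪g.testToL2 (ofRealTest hf hs) x, w x⟫ ∂g.vol = ∫ x, (f x : ℂ) * w x ∂g.vol := by
    refine integral_congr_ae ?_
    filter_upwards [testToL2_ae (g := g) (ofRealTest hf hs)] with x hx
    rw [hx, RCLike.inner_apply]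
    change w x * conj (f x : ℂ) = _
    rw [Complex.conj_ofReal]; ring
  rw [e1, e2, integral_vol, integral_vol] at h1
  have e3 : ∀ x, g.density x • (-((g.laplace f x : ℝ) : ℂ) * u x) =
      -(((g.laplace f x : ℝ) : ℂ) * dens u x) := fun x => by
    rw [Complex.real_smul, dens]; ring
  have e4 : ∀ x, g.density x • ((f x : ℂ) * w x) = (f x : ℂ) * dens w x := fun x => by
    rw [Complex.real_smul, dens]; ring
  simp only [e3, e4] at h1
  rw [integral_neg] at h1
  rw [← h1, neg_neg]

end Metric
end HeatKernel

/-! ### Lebesgue points and Friedrichs' commutator estimate -/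

namespace HeatKernel

local notation "⟪" x ", " y "⟫" => inner ℂ x y

open ComplexConjugate

/-- Convergence of integral kernels at Lebesgue points. -/
lemma ae_tendsto_integral_kernel {d : ℕ} {f : Space d → ℂ} (hf : LocallyIntegrable f) {κ : ℝ}
    (hκ : 0 < κ) : ∀ᵐ x, ∀ (k : ℝ → Space d → ℝ) (B c : ℝ), (∀ r, 0 < r → Continuous (k r)) →
      (∀ r, 0 < r → ∀ y, |k r y| ≤ B * (r ^ d)⁻¹) → (∀ r, 0 < r → ∀ y, κ * r < dist y x → k r y = 0) →
      (∀ r, 0 < r → ∫ y, k r y = c) →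
      Tendsto (fun r => ∫ y, (k r y : ℂ) * f y) (𝓝[>] 0) (𝓝 (c * f x)) := by
  -- The exceptional set depends only on `f` and `κ`, so the kernels may depend on the point `x`;
  -- the bumps adapted to the metric at `x` need this.
  filter_upwards [IsUnifLocDoublingMeasure.ae_tendsto_average_norm_sub volume hf 1] with x hx
  intro k B c hkc hkB hk0 hkc1
  have h1 : Tendsto (fun r : ℝ => κ * r) (𝓝[>] 0) (𝓝[>] 0) := by
    refine tendsto_nhdsWithin_iff.2 ⟨?_, ?_⟩
    · have : Tendsto (fun r : ℝ => κ * r) (𝓝 0) (𝓝 (κ * 0)) := (continuous_const_mul κ).tendsto 0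
      rw [mul_zero] at this
      exact this.mono_left nhdsWithin_le_nhds
    · filter_upwards [self_mem_nhdsWithin] with r hr
      exact mul_pos hκ (Set.mem_Ioi.1 hr)
  have h2 := hx (fun _ => x) (fun r : ℝ => κ * r) h1 (by
    filter_upwards [self_mem_nhdsWithin] with r hr
    have : 0 < r := hr
    rw [Metric.mem_closedBall, dist_self]; positivity)
  set V := (volume (Metric.ball (0 : Space d) 1)).toReal with hV
  have h3 := h2.const_mul (B * (κ ^ d * V))
  rw [mul_zero] at h3
  rw [tendsto_iff_norm_sub_tendsto_zero]
  refine squeeze_zero' (Eventually.of_forall fun r => norm_nonneg _) ?_ h3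
  filter_upwards [self_mem_nhdsWithin] with r hr
  have hr : 0 < r := hr
  set S := Metric.closedBall x (κ * r) with hS
  have hsupp : Function.support (k r) ⊆ S := fun y hy => by
    by_contra h
    rw [hS, Metric.mem_closedBall, not_le] at h
    exact hy (hk0 r hr y h)
  have hcs : HasCompactSupport (k r) :=
    HasCompactSupport.of_support_subset_isCompact (isCompact_closedBall _ _) hsupp
  have hki : Integrable (k r) := (hkc r hr).integrable_of_hasCompactSupport hcs
  have hfS : IntegrableOn f S := hf.integrableOn_isCompact (isCompact_closedBall _ _)
  have hkf : Integrable fun y => (k r y : ℂ) * f y := by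
    have h4 : IntegrableOn (fun y => (k r y : ℂ) * f y) S := by
      refine Integrable.bdd_mul (c := B * (r ^ d)⁻¹) hfS
        (Complex.continuous_ofReal.comp (hkc r hr)).aestronglyMeasurable
        (Eventually.of_forall fun y => ?_)
      rw [Complex.norm_real]; exact hkB r hr y
    refine (integrableOn_iff_integrable_of_support_subset ?_).1 h4
    intro y hy
    refine hsupp ?_
    rw [Function.mem_support] at hy ⊢
    intro h; rw [h] at hy; simp at hy
  have e1 : (∫ y, (k r y : ℂ) * f y) - c * f x = ∫ y in S, (k r y : ℂ) * (f y - f x) := by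
    rw [setIntegral_eq_integral_of_forall_compl_eq_zero (fun y hy => by
      rw [hk0 r hr y (by rw [hS, Metric.mem_closedBall, not_le] at hy; exact hy)]; simp)]
    simp only [mul_sub]
    have hki2 : Integrable fun y => (k r y : ℂ) * f x := hki.ofReal.mul_const _
    rw [integral_sub hkf hki2, integral_mul_const, integral_complex_ofReal, hkc1 r hr]
  rw [e1]
  have hSv : volume.real S = κ ^ d * r ^ d * V := by
    rw [Measure.real, hS, Measure.addHaar_closedBall _ _ (by positivity), finrank_euclideanSpace_fin,
      ENNReal.toReal_mul, ENNReal.toReal_ofReal (by positivity), mul_pow]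
  have hcon : IntegrableOn (fun _ : Space d => f x) S :=
    integrableOn_const (measure_closedBall_lt_top.ne)
  calc ‖∫ y in S, (k r y : ℂ) * (f y - f x)‖ ≤ ∫ y in S, B * (r ^ d)⁻¹ * ‖f y - f x‖ := by
        refine norm_integral_le_of_norm_le ((hfS.sub hcon).norm.const_mul _)
          (Eventually.of_forall fun y => ?_)
        rw [norm_mul, Complex.norm_real]
        exact mul_le_mul_of_nonneg_right (hkB r hr y) (norm_nonneg _)
    _ = B * (κ ^ d * V) * ⨍ y in S, ‖f y - f x‖ := by
        rw [integral_const_mul, setAverage_eq, smul_eq_mul, hSv]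
        have hVp : 0 < V := ENNReal.toReal_pos (Metric.measure_ball_pos _ _ one_pos).ne'
          measure_ball_lt_top.ne
        field_simp

/-- The dilation of a function that preserves the integral. -/
noncomputable def dilate {d : ℕ} (ε : ℝ) (f : Space d → ℝ) (z : Space d) : ℝ :=
  (ε ^ d)⁻¹ * f (ε⁻¹ • z)

lemma integral_dilate {d : ℕ} {ε : ℝ} (hε : 0 < ε) (f : Space d → ℝ) :
    ∫ z, dilate ε f z = ∫ z, f z := by
  simp only [dilate]
  rw [integral_const_mul, Measure.integral_comp_inv_smul, finrank_euclideanSpace_fin,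
    abs_of_pos (by positivity), smul_eq_mul, inv_mul_cancel_left₀ (by positivity)]

lemma contDiff_dilate {d : ℕ} (ε : ℝ) {f : Space d → ℝ} (hf : ContDiff ℝ ∞ f) :
    ContDiff ℝ ∞ (dilate ε f) := contDiff_const.mul (hf.comp (contDiff_const_smul ε⁻¹))

lemma hasCompactSupport_dilate {d : ℕ} {ε : ℝ} (hε : 0 < ε) {f : Space d → ℝ}
    (hf : HasCompactSupport f) : HasCompactSupport (dilate ε f) :=
  (hf.comp_smul (inv_ne_zero hε.ne')).mul_left

lemma partialDeriv_dilate {d : ℕ} (j : Fin d) (ε : ℝ) {f : Space d → ℝ} (hf : Differentiable ℝ f)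
    (z : Space d) : partialDeriv j (dilate ε f) z = ε⁻¹ * dilate ε (partialDeriv j f) z := by
  have h : HasFDerivAt (dilate ε f) _ z :=
    ((hf (ε⁻¹ • z)).hasFDerivAt.comp z ((hasFDerivAt_id z).const_smul ε⁻¹)).const_mul ((ε ^ d)⁻¹)
  simp only [dilate, partialDeriv]
  change fderiv ℝ (dilate ε f) z _ = _
  rw [h.fderiv]
  simp
  ring

lemma integral_norm_sq_eq {d : ℕ} {f : Space d → ℂ} (hf : MemLp f 2 volume) :
    ENNReal.ofReal (∫ x, ‖f x‖ ^ 2) = ∫⁻ x, ‖f x‖ₑ ^ 2 := by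
  have hi : Integrable fun x => ‖f x‖ ^ 2 := by simpa using hf.integrable_norm_pow (by norm_num)
  rw [ofReal_integral_eq_lintegral_ofReal hi (Eventually.of_forall fun x => by positivity)]
  refine lintegral_congr fun x => ?_
  rw [ENNReal.ofReal_pow (norm_nonneg _), ofReal_norm]

lemma memLp_bdd_mul {d : ℕ} {m : Space d → ℝ} (hm : Continuous m) {C : ℝ} (hC : ∀ x, |m x| ≤ C)
    {f : Space d → ℂ} (hf : MemLp f 2 volume) : MemLp (fun x => (m x : ℂ) * f x) 2 volume :=
  hf.of_le_mul (c := C) ((Complex.continuous_ofReal.comp hm).aestronglyMeasurable.mul hf.1)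
    (Eventually.of_forall fun x => by
      rw [norm_mul, Complex.norm_real]
      exact mul_le_mul_of_nonneg_right (hC x) (norm_nonneg _))

lemma integrable_mul_conj {d : ℕ} {f h : Space d → ℂ} (hf : MemLp f 2 volume)
    (hh : MemLp h 2 volume) : Integrable fun x => f x * conj (h x) :=
  MemLp.integrable_mul hf (hh.star)

/-- Square integrability of the functions and of their derivatives replaces compact support. -/
lemma integral_partialDeriv_mul_conj {d : ℕ} (j : Fin d) {f h : Space d → ℂ} (hf : ContDiff ℝ 1 f)
    (hh : ContDiff ℝ 1 h) (h1 : MemLp f 2 volume) (h2 : MemLp h 2 volume)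
    (h3 : MemLp (partialDeriv j f) 2 volume) (h4 : MemLp (partialDeriv j h) 2 volume) :
    ∫ x, partialDeriv j f x * conj (h x) = -∫ x, f x * conj (partialDeriv j h x) := by
  have hc : ContDiff ℝ 1 fun x => conj (h x) := Complex.conjCLE.contDiff.comp hh
  have e : ∀ x, fderiv ℝ (fun x => conj (h x)) x (EuclideanSpace.single j 1) =
      conj (partialDeriv j h x) := fun x =>
    partialDeriv_conj j (hh.differentiable (by simp) x)
  have := integral_mul_fderiv_eq_neg_fderiv_mul_of_integrable (μ := (volume : Measure (Space d)))
    (f := f) (g := fun x => conj (h x)) (v := EuclideanSpace.single j (1 : ℝ))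
    (integrable_mul_conj h3 h2) (by simp only [e]; exact integrable_mul_conj h1 h4)
    (integrable_mul_conj h1 h2) (fun x _ => hf.differentiable (by simp) x)
    (fun x _ => hc.differentiable (by simp) x)
  simp only [e] at this
  rw [this, neg_neg]; rfl

namespace Metric

variable {d : ℕ} {g : Metric d}

lemma continuous_drift (k : Fin d) : Continuous (g.drift k) := by
  refine continuous_finsetSum _ fun j _ => ?_
  refine (g.contDiff_density.continuous.inv₀ fun x => (g.density_pos x).ne').mul ?_
  exact (contDiff_partialDeriv_real j ((g.contDiff_inv j k).mul g.contDiff_density)).continuous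

/-- The energy estimate for a mollified solution of `-Δ_g u = -l u`. -/
lemma integral_moll_le {C : ℝ} (hg : g.Bounds C) {l : ℝ} {u : g.L2} (hu : WeakEq u (-(l • u)))
    {η : Space d → ℝ} (hη : ContDiff ℝ ∞ η) (hs : HasCompactSupport η) {I : ℝ}
    (hI : ∫ z, C * (∑ k, ‖z‖ * |partialDeriv k η z| + |η z|) ≤ I) :
    l * ∫ x, ‖moll η (dens u) x‖ ^ 2 ≤ C / 4 * (d * (I ^ 2 * ∫ x, ‖dens u x‖ ^ 2)) := by
  have hC : 0 < C := by linarith [hg.one_le]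
  set W := dens u with hWd
  have hW : MemLp W 2 volume := memLp_dens hg u
  have hηk : ∀ k, ContDiff ℝ ∞ (partialDeriv k η) := fun k => contDiff_partialDeriv_real k hη
  have hsk : ∀ k, HasCompactSupport (partialDeriv k η) := fun k =>
    hasCompactSupport_partialDeriv_real k hs
  have hηjk : ∀ j k, ContDiff ℝ ∞ (partialDeriv j (partialDeriv k η)) := fun j k =>
    contDiff_partialDeriv_real j (hηk k)
  have hsjk : ∀ j k, HasCompactSupport (partialDeriv j (partialDeriv k η)) := fun j k =>
    hasCompactSupport_partialDeriv_real j (hsk k)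
  set Wi : Fin d → Fin d → Space d → ℂ := fun j k y => (g.inv j k y : ℂ) * W y with hWi
  set Wd : Fin d → Space d → ℂ := fun k y => (g.drift k y : ℂ) * W y with hWdr
  have mWi : ∀ j k, MemLp (Wi j k) 2 volume := fun j k =>
    memLp_bdd_mul (g.contDiff_inv j k).continuous (hg.inv_le j k) hW
  have mWd : ∀ k, MemLp (Wd k) 2 volume := fun k =>
    memLp_bdd_mul (continuous_drift k) (hg.drift_le k) hW
  have hl : ∀ {f : Space d → ℂ}, MemLp f 2 volume → LocallyIntegrable f := fun hf =>
    hf.locallyIntegrable (by norm_num)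
  set v := moll η W with hv
  have hvk : ∀ k, partialDeriv k v = moll (partialDeriv k η) W := fun k =>
    partialDeriv_moll (hl hW) hη hs k
  have mv : MemLp v 2 volume := memLp_moll hW hη hs
  have mvk : ∀ k, MemLp (partialDeriv k v) 2 volume := fun k => by
    rw [hvk]; exact memLp_moll hW (hηk k) (hsk k)
  have cv : ContDiff ℝ 1 v := contDiff_moll (hl hW) hη hs
  -- The weak equation tested with `y ↦ η (x - y)`: the mollified equation in double divergence
  -- form.
  have heq : ∀ x, (l : ℂ) * v x = ∑ k, (∑ j, moll (partialDeriv j (partialDeriv k η)) (Wi j k) x -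
      moll (partialDeriv k η) (Wd k) x) := by
    intro x
    have hφ : ContDiff ℝ ∞ fun y => η (x - y) := hη.comp (contDiff_const.sub contDiff_id)
    have hφs : HasCompactSupport fun y => η (x - y) :=
      hs.comp_homeomorph (Homeomorph.subLeft x)
    have h1 := hu.integral_laplace hφ hφs
    have e1 : ∫ y, (η (x - y) : ℂ) * dens (-(l • u)) y = -(l * v x) := by
      rw [hv, moll_apply, ← integral_const_mul, ← integral_neg]
      refine integral_congr_ae ?_
      filter_upwards [g.volume_absolutelyContinuous_vol.ae_le (Lp.coeFn_neg (l • u)),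
        g.volume_absolutelyContinuous_vol.ae_le (Lp.coeFn_smul l u)] with y a1 a2
      simp only [dens, hWd]
      rw [a1, Pi.neg_apply, a2, Pi.smul_apply, Complex.real_smul]
      ring
    rw [e1, neg_neg] at h1
    rw [← h1]
    have e2 : ∀ y, ((g.laplace (fun y => η (x - y)) y : ℝ) : ℂ) * W y =
        ∑ k, (∑ j, ((partialDeriv j (partialDeriv k η) (x - y) : ℝ) : ℂ) * Wi j k y -
          ((partialDeriv k η (x - y) : ℝ) : ℂ) * Wd k y) := by
      intro y
      have a1 : ∀ k, partialDeriv k (fun y => η (x - y)) = fun y => -partialDeriv k η (x - y) :=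
        fun k => partialDeriv_sub_left k (hη.differentiable (by simp)) x
      have a2 : ∀ j k, partialDeriv j (fun y => -partialDeriv k η (x - y)) =
          fun y => partialDeriv j (partialDeriv k η) (x - y) := fun j k => by
        have := partialDeriv_sub_left j (f := fun z => -partialDeriv k η z)
          ((hηk k).neg.differentiable (by simp)) x
        rw [this]
        ext y
        simp only [partialDeriv]
        rw [fderiv_fun_neg, neg_apply, neg_neg]
        rfl
      simp only [laplace, a1, a2, hWi, hWdr]
      push_cast
      rw [Finset.sum_mul]
      refine Finset.sum_congr rfl fun k _ => ?_
      rw [add_mul, Finset.sum_mul]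
      refine (congrArg₂ (· + ·) (Finset.sum_congr rfl fun j _ => ?_) ?_).trans (sub_eq_add_neg _ _).symm
      · ring
      · ring
    simp only [← hWd, e2]
    have i1 : ∀ j k, Integrable fun y => ((partialDeriv j (partialDeriv k η) (x - y) : ℝ) : ℂ) * Wi j k y :=
      fun j k => integrable_moll (hl (mWi j k)) (hηjk j k).continuous (hsjk j k) x
    have i2 : ∀ k, Integrable fun y => ((partialDeriv k η (x - y) : ℝ) : ℂ) * Wd k y :=
      fun k => integrable_moll (hl (mWd k)) (hηk k).continuous (hsk k) x
    have i12 : ∀ k, Integrable fun y =>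
        ∑ j, ((partialDeriv j (partialDeriv k η) (x - y) : ℝ) : ℂ) * Wi j k y -
          ((partialDeriv k η (x - y) : ℝ) : ℂ) * Wd k y :=
      fun k => (integrable_finsetSum _ fun j _ => i1 j k).sub (i2 k)
    rw [integral_finsetSum _ fun k _ => i12 k]
    refine (Finset.sum_congr rfl fun k _ => ?_).symm
    rw [integral_sub (integrable_finsetSum _ fun j _ => i1 j k) (i2 k),
      integral_finsetSum _ fun j _ => i1 j k, moll_apply]
    simp only [moll_apply]
  -- The flux, with `l v = ∑ ∂_j H_j`.
  set H : Fin d → Space d → ℂ := fun j x =>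
    ∑ k, moll (partialDeriv k η) (Wi j k) x - moll η (Wd j) x with hH
  have mF : ∀ j k, MemLp (moll (partialDeriv k η) (Wi j k)) 2 volume := fun j k =>
    memLp_moll (mWi j k) (hηk k) (hsk k)
  have mG : ∀ k, MemLp (moll η (Wd k)) 2 volume := fun k => memLp_moll (mWd k) hη hs
  have mFj : ∀ j k, MemLp (moll (partialDeriv j (partialDeriv k η)) (Wi j k)) 2 volume := fun j k =>
    memLp_moll (mWi j k) (hηjk j k) (hsjk j k)
  have mGk : ∀ k, MemLp (moll (partialDeriv k η) (Wd k)) 2 volume := fun k =>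
    memLp_moll (mWd k) (hηk k) (hsk k)
  have mH : ∀ j, MemLp (H j) 2 volume := fun j =>
    (memLp_finsetSum _ fun k _ => mF j k).sub (mG j)
  have henergy : (l : ℂ) * ∫ x, v x * conj (v x) = -∫ x, ∑ j, H j x * conj (partialDeriv j v x) := by
    have e1 : ∀ x, (l : ℂ) * (v x * conj (v x)) =
        ∑ k, (∑ j, moll (partialDeriv j (partialDeriv k η)) (Wi j k) x * conj (v x) -
          moll (partialDeriv k η) (Wd k) x * conj (v x)) := fun x => by
      rw [← mul_assoc, heq, Finset.sum_mul]
      refine Finset.sum_congr rfl fun k _ => ?_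
      rw [sub_mul, Finset.sum_mul]
    have i1 : ∀ j k, Integrable fun x =>
        moll (partialDeriv j (partialDeriv k η)) (Wi j k) x * conj (v x) :=
      fun j k => integrable_mul_conj (mFj j k) mv
    have i2 : ∀ k, Integrable fun x => moll (partialDeriv k η) (Wd k) x * conj (v x) :=
      fun k => integrable_mul_conj (mGk k) mv
    have i3 : ∀ j k, Integrable fun x => moll (partialDeriv k η) (Wi j k) x * conj (partialDeriv j v x) :=
      fun j k => integrable_mul_conj (mF j k) (mvk j)
    have i4 : ∀ k, Integrable fun x => moll η (Wd k) x * conj (partialDeriv k v x) :=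
      fun k => integrable_mul_conj (mG k) (mvk k)
    rw [← integral_const_mul]
    simp only [e1, hH, sub_mul, Finset.sum_mul]
    have i12 : ∀ k, Integrable fun x =>
        ∑ j, moll (partialDeriv j (partialDeriv k η)) (Wi j k) x * conj (v x) -
          moll (partialDeriv k η) (Wd k) x * conj (v x) :=
      fun k => (integrable_finsetSum _ fun j _ => i1 j k).sub (i2 k)
    have i34 : ∀ j, Integrable fun x =>
        ∑ k, moll (partialDeriv k η) (Wi j k) x * conj (partialDeriv j v x) -
          moll η (Wd j) x * conj (partialDeriv j v x) :=
      fun j => (integrable_finsetSum _ fun k _ => i3 j k).sub (i4 j)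
    rw [integral_finsetSum _ fun k _ => i12 k, integral_finsetSum _ fun j _ => i34 j]
    have p1 : ∀ j k, ∫ x, moll (partialDeriv j (partialDeriv k η)) (Wi j k) x * conj (v x) =
        -∫ x, moll (partialDeriv k η) (Wi j k) x * conj (partialDeriv j v x) := fun j k => by
      have e := partialDeriv_moll (hl (mWi j k)) (hηk k) (hsk k) j
      rw [← e]
      exact integral_partialDeriv_mul_conj j (contDiff_moll (hl (mWi j k)) (hηk k) (hsk k)) cv
        (mF j k) mv (by rw [e]; exact mFj j k) (mvk j)
    have p2 : ∀ k, ∫ x, moll (partialDeriv k η) (Wd k) x * conj (v x) =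
        -∫ x, moll η (Wd k) x * conj (partialDeriv k v x) := fun k => by
      have e := partialDeriv_moll (hl (mWd k)) hη hs k
      rw [← e]
      exact integral_partialDeriv_mul_conj k (contDiff_moll (hl (mWd k)) hη hs) cv
        (mG k) mv (by rw [e]; exact mGk k) (mvk k)
    have q1 : ∀ k, ∫ x, (∑ j, moll (partialDeriv j (partialDeriv k η)) (Wi j k) x * conj (v x) -
          moll (partialDeriv k η) (Wd k) x * conj (v x)) =
        ∑ j, -(∫ x, moll (partialDeriv k η) (Wi j k) x * conj (partialDeriv j v x)) -
          -(∫ x, moll η (Wd k) x * conj (partialDeriv k v x)) := fun k => by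
      rw [integral_sub (integrable_finsetSum _ fun j _ => i1 j k) (i2 k),
        integral_finsetSum _ fun j _ => i1 j k, p2]
      simp only [p1]
    have q2 : ∀ j, ∫ x, (∑ k, moll (partialDeriv k η) (Wi j k) x * conj (partialDeriv j v x) -
          moll η (Wd j) x * conj (partialDeriv j v x)) =
        ∑ k, (∫ x, moll (partialDeriv k η) (Wi j k) x * conj (partialDeriv j v x)) -
          ∫ x, moll η (Wd j) x * conj (partialDeriv j v x) := fun j => by
      rw [integral_sub (integrable_finsetSum _ fun k _ => i3 j k) (i4 j),
        integral_finsetSum _ fun k _ => i3 j k]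
    simp only [q1, q2, Finset.sum_sub_distrib]
    rw [Finset.sum_comm]
    simp only [Finset.sum_neg_distrib]
    ring
  -- The commutator of mollification with the coefficients: what is left of the flux after the
  -- elliptic part `∑ g^{jk} ∂_k v` is removed.
  set Q : Fin d → Space d → ℂ := fun j x => H j x - ∑ k, (g.inv j k x : ℂ) * partialDeriv k v x with hQ
  have mQ : ∀ j, MemLp (Q j) 2 volume := fun j =>
    (mH j).sub (memLp_finsetSum _ fun k _ =>
      memLp_bdd_mul (g.contDiff_inv j k).continuous (hg.inv_le j k) (mvk k))
  have iQ : ∀ j, Integrable fun x => ‖Q j x‖ ^ 2 := fun j => by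
    simpa using (mQ j).integrable_norm_pow (by norm_num)
  -- Young's inequality `|Q_j| |∂_j v| ≤ (C/4) |Q_j|² + C⁻¹ |∂_j v|²`; the last terms sum to at most
  -- the energy density by ellipticity, and the energy density has the good sign.
  have hpt : ∀ x, (-∑ j, H j x * conj (partialDeriv j v x)).re ≤ C / 4 * ∑ j, ‖Q j x‖ ^ 2 := by
    intro x
    have e1 : ∑ j, H j x * conj (partialDeriv j v x) = ∑ j, Q j x * conj (partialDeriv j v x) +
        ∑ j, ∑ k, (g.inv j k x : ℂ) * partialDeriv k v x * conj (partialDeriv j v x) := by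
      rw [← Finset.sum_add_distrib]
      refine Finset.sum_congr rfl fun j _ => ?_
      rw [← Finset.sum_mul, ← add_mul, hQ]
      simp only [sub_add_cancel]
    have e2 : (∑ j, ∑ k, (g.inv j k x : ℂ) * partialDeriv k v x * conj (partialDeriv j v x)).re =
        g.energyDensity v x := by
      simp only [energyDensity, form, gradRe, gradIm, ← Finset.sum_add_distrib, Complex.re_sum]
      refine Finset.sum_congr rfl fun j _ => Finset.sum_congr rfl fun k _ => ?_
      simp
      ring
    have e3 : ∑ j, ‖partialDeriv j v x‖ ^ 2 ≤ C * g.energyDensity v x := by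
      have h1 := hg.inv_form_lower x (gradRe v x)
      have h2 := hg.inv_form_lower x (gradIm v x)
      have h3 : ∀ j, ‖partialDeriv j v x‖ ^ 2 = gradRe v x j ^ 2 + gradIm v x j ^ 2 := fun j => by
        rw [← Complex.normSq_eq_norm_sq, Complex.normSq_apply, gradRe, gradIm]; ring
      simp only [h3, Finset.sum_add_distrib, energyDensity, mul_add]
      exact add_le_add h1 h2
    rw [e1, Complex.neg_re, Complex.add_re, e2]
    have e4 : -(∑ j, Q j x * conj (partialDeriv j v x)).re ≤
        ∑ j, (C / 4 * ‖Q j x‖ ^ 2 + C⁻¹ * ‖partialDeriv j v x‖ ^ 2) := by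
      refine (neg_le_abs _).trans ((Complex.abs_re_le_norm _).trans ((norm_sum_le _ _).trans ?_))
      refine Finset.sum_le_sum fun j _ => ?_
      rw [norm_mul, RCLike.norm_conj]
      have := sq_nonneg (C / 2 * ‖Q j x‖ - ‖partialDeriv j v x‖)
      have h5 : C / 4 * ‖Q j x‖ ^ 2 + C⁻¹ * ‖partialDeriv j v x‖ ^ 2 -
          ‖Q j x‖ * ‖partialDeriv j v x‖ = C⁻¹ * (C / 2 * ‖Q j x‖ - ‖partialDeriv j v x‖) ^ 2 := by
        field_simp; ring
      have h6 : 0 ≤ C⁻¹ * (C / 2 * ‖Q j x‖ - ‖partialDeriv j v x‖) ^ 2 := by positivity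
      linarith
    rw [Finset.sum_add_distrib, ← Finset.mul_sum, ← Finset.mul_sum] at e4
    have e5 : C⁻¹ * ∑ j, ‖partialDeriv j v x‖ ^ 2 ≤ g.energyDensity v x := by
      rw [inv_mul_le_iff₀ hC]; exact e3
    linarith
  have hmain : l * ∫ x, ‖v x‖ ^ 2 ≤ C / 4 * ∑ j, ∫ x, ‖Q j x‖ ^ 2 := by
    have e1 : ∫ x, v x * conj (v x) = ((∫ x, ‖v x‖ ^ 2 : ℝ) : ℂ) := by
      rw [← integral_complex_ofReal]
      refine integral_congr_ae (Eventually.of_forall fun x => ?_)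
      simp only [Complex.mul_conj, Complex.normSq_eq_norm_sq]
    have i1 : Integrable fun x => ∑ j, H j x * conj (partialDeriv j v x) :=
      integrable_finsetSum _ fun j _ => integrable_mul_conj (mH j) (mvk j)
    rw [e1, ← Complex.ofReal_mul, ← integral_neg] at henergy
    have e2 := congrArg Complex.re henergy
    rw [Complex.ofReal_re] at e2
    have e3 := integral_re i1.neg
    simp only [RCLike.re_to_complex, Pi.neg_apply] at e3
    rw [e2, ← e3, ← integral_finsetSum _ fun j _ => iQ j, ← integral_const_mul]
    exact integral_mono i1.neg.re ((integrable_finsetSum _ fun j _ => iQ j).const_mul _) hpt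
  have hI0 : 0 ≤ ∫ z, C * (∑ k, ‖z‖ * |partialDeriv k η z| + |η z|) :=
    integral_nonneg fun z => by positivity
  set m : Space d → ℝ := fun z => C * (∑ k, ‖z‖ * |partialDeriv k η z| + |η z|) with hm
  have hm0 : ∀ z, 0 ≤ m z := fun z => by positivity
  have cm : Continuous m := continuous_const.mul ((continuous_finsetSum _ fun k _ =>
    continuous_norm.mul (hηk k).continuous.abs).add hη.continuous.abs)
  have im : Integrable m := by
    refine Integrable.const_mul (Integrable.add (integrable_finsetSum _ fun k _ => ?_) ?_) _
    · exact (continuous_norm.mul (hηk k).continuous.abs).integrable_of_hasCompactSupport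
        ((hsk k).norm.mul_left)
    · exact hη.continuous.abs.integrable_of_hasCompactSupport hs.norm
  have hQle : ∀ j, ∫ x, ‖Q j x‖ ^ 2 ≤ I ^ 2 * ∫ x, ‖W x‖ ^ 2 := by
    intro j
    have hI' : 0 ≤ I := hI0.trans hI
    rw [← ENNReal.ofReal_le_ofReal_iff (by positivity), integral_norm_sq_eq (mQ j),
      ENNReal.ofReal_mul (by positivity), integral_norm_sq_eq hW, ENNReal.ofReal_pow hI']
    have hmI : ∫⁻ z, ENNReal.ofReal (m z) ≤ ENNReal.ofReal I := by
      rw [← ofReal_integral_eq_lintegral_ofReal im (Eventually.of_forall hm0)]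
      exact ENNReal.ofReal_le_ofReal hI
    refine le_trans ?_ ((lintegral_sq_convolution_le cm.measurable.ennreal_ofReal hW.1.enorm).trans
      (by gcongr))
    refine lintegral_mono fun x => pow_le_pow_left' ?_ 2
    have i1 : ∀ k, Integrable fun y => ((partialDeriv k η (x - y) : ℝ) : ℂ) * Wi j k y :=
      fun k => integrable_moll (hl (mWi j k)) (hηk k).continuous (hsk k) x
    have i2 : Integrable fun y => (η (x - y) : ℂ) * Wd j y :=
      integrable_moll (hl (mWd j)) hη.continuous hs x
    have i3 : ∀ k, Integrable fun y => (g.inv j k x : ℂ) * (((partialDeriv k η (x - y) : ℝ) : ℂ) * W y) :=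
      fun k => (integrable_moll (hl hW) (hηk k).continuous (hsk k) x).const_mul _
    -- In this form `∂_k η (x - y)` is multiplied by a difference of coefficients, bounded by `C |x
    -- - y|`. So `|Q_j|` is dominated by the convolution of `m` with `|W|`, and the Schur test
    -- applies.
    have e : Q j x = ∫ y, (∑ k, (((g.inv j k y - g.inv j k x) * partialDeriv k η (x - y) : ℝ) : ℂ) * W y
        - ((g.drift j y * η (x - y) : ℝ) : ℂ) * W y) := by
      have a1 : ∀ y, (∑ k, (((g.inv j k y - g.inv j k x) * partialDeriv k η (x - y) : ℝ) : ℂ) * W y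
          - ((g.drift j y * η (x - y) : ℝ) : ℂ) * W y) =
          (∑ k, ((partialDeriv k η (x - y) : ℝ) : ℂ) * Wi j k y - (η (x - y) : ℂ) * Wd j y) -
            ∑ k, (g.inv j k x : ℂ) * (((partialDeriv k η (x - y) : ℝ) : ℂ) * W y) := by
        intro y
        rw [sub_right_comm, ← Finset.sum_sub_distrib]
        simp only [hWi, hWdr]
        push_cast
        congr 1
        · exact Finset.sum_congr rfl fun k _ => by ring
        · ring
      simp only [a1]
      have i12 : Integrable fun y => ∑ k, ((partialDeriv k η (x - y) : ℝ) : ℂ) * Wi j k y -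
          (η (x - y) : ℂ) * Wd j y := (integrable_finsetSum _ fun k _ => i1 k).sub i2
      rw [integral_sub i12 (integrable_finsetSum _ fun k _ => i3 k),
        integral_sub (integrable_finsetSum _ fun k _ => i1 k) i2,
        integral_finsetSum _ fun k _ => i1 k, integral_finsetSum _ fun k _ => i3 k]
      simp only [integral_const_mul, ← moll_apply, hQ, hH, hvk]
    rw [e]
    refine (enorm_integral_le_lintegral_enorm _).trans (lintegral_mono fun y => ?_)
    rw [← Finset.sum_mul, ← sub_mul, enorm_mul]
    gcongr
    rw [← ofReal_norm]
    refine ENNReal.ofReal_le_ofReal ?_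
    refine (norm_sub_le _ _).trans ?_
    rw [hm]
    simp only [mul_add, Finset.mul_sum]
    refine add_le_add ((norm_sum_le _ _).trans (Finset.sum_le_sum fun k _ => ?_)) ?_
    · rw [Complex.norm_real, Real.norm_eq_abs, abs_mul, ← mul_assoc]
      refine mul_le_mul_of_nonneg_right ?_ (abs_nonneg _)
      rw [norm_sub_rev]; exact hg.inv_lipschitz j k y x
    · rw [Complex.norm_real, Real.norm_eq_abs, abs_mul]
      exact mul_le_mul_of_nonneg_right (hg.drift_le j y) (abs_nonneg _)
  refine hmain.trans (mul_le_mul_of_nonneg_left ?_ (by positivity))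
  refine (Finset.sum_le_sum fun j _ => hQle j).trans_eq ?_
  simp

end Metric
end HeatKernel

/-! ### Essential self-adjointness -/

namespace HeatKernel

local notation "⟪" x ", " y "⟫" => inner ℂ x y

open ComplexConjugate

namespace Metric

variable {d : ℕ} {g : Metric d}

lemma ae_tendsto_moll_dilate {η : Space d → ℝ} (hη : ContDiff ℝ ∞ η)
    (hs : Function.support η ⊆ Metric.closedBall 0 2) (h1 : ∫ z, η z = 1) {W : Space d → ℂ}
    (hW : LocallyIntegrable W) :
    ∀ᵐ x, Tendsto (fun ε => moll (dilate ε η) W x) (𝓝[>] 0) (𝓝 (W x)) := by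
  have hcs : HasCompactSupport η :=
    HasCompactSupport.of_support_subset_isCompact (isCompact_closedBall _ _) hs
  obtain ⟨B, hB⟩ := hη.continuous.bounded_above_of_compact_support hcs
  filter_upwards [ae_tendsto_integral_kernel hW (κ := 2) two_pos] with x hx
  have := hx (fun r y => dilate r η (x - y)) B 1
    (fun r _ => (contDiff_dilate r hη).continuous.comp (continuous_const.sub continuous_id))
    (fun r hr y => by
      have hrd : 0 < r ^ d := pow_pos hr d
      rw [dilate, abs_mul, abs_of_pos (by positivity), mul_comm]
      exact mul_le_mul_of_nonneg_right (hB _) (by positivity))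
    (fun r hr y hy => by
      have : η (r⁻¹ • (x - y)) = 0 := by
        by_contra h
        have h2 := hs h
        rw [mem_closedBall_zero_iff, norm_smul, norm_inv, Real.norm_of_nonneg hr.le,
          inv_mul_le_iff₀ hr, ← dist_eq_norm, dist_comm] at h2
        linarith
      rw [dilate, this, mul_zero])
    (fun r hr => by rw [integral_sub_left_eq_self (dilate r η), integral_dilate hr, h1])
  rw [Complex.ofReal_one, one_mul] at this
  simpa only [moll_apply] using this

lemma eq_zero_of_dens {C : ℝ} (hg : g.Bounds C) {u : g.L2} (h : ∫ x, ‖dens u x‖ ^ 2 ≤ 0) : u = 0 := by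
  have hi : Integrable fun x => ‖dens u x‖ ^ 2 := by
    simpa using (memLp_dens hg u).integrable_norm_pow (by norm_num)
  have h0 := (integral_eq_zero_iff_of_nonneg (fun x => by positivity) hi).1
    (le_antisymm h (integral_nonneg fun x => by positivity))
  refine (Lp.eq_zero_iff_ae_eq_zero).2 ?_
  filter_upwards [vol_absolutelyContinuous.ae_le h0] with x hx
  have h1 : ‖dens u x‖ = 0 := by simpa using hx
  rw [dens, norm_mul, Complex.norm_real, mul_eq_zero, norm_eq_zero, norm_eq_zero] at h1
  exact h1.resolve_left (g.density_pos x).ne'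

/-- The deficiency spaces of `-Δ_g` are trivial. -/
theorem exists_eq_zero_of_weakEq {C : ℝ} (hg : g.Bounds C) :
    ∃ l : ℝ, 0 < l ∧ ∀ u : g.L2, WeakEq u (-(l • u)) → u = 0 := by
  have hC : 0 < C := by linarith [hg.one_le]
  let b : ContDiffBump (0 : Space d) := ⟨1, 2, one_pos, by norm_num⟩
  set η : Space d → ℝ := b.normed volume with hηd
  have hη : ContDiff ℝ ∞ η := b.contDiff_normed
  have hs : HasCompactSupport η := b.hasCompactSupport_normed
  have hsupp : Function.support η ⊆ Metric.closedBall 0 2 := by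
    rw [hηd, b.support_normed_eq]; exact Metric.ball_subset_closedBall
  have h1 : ∫ z, η z = 1 := b.integral_normed
  set m : Space d → ℝ := fun z => C * (∑ k, ‖z‖ * |partialDeriv k η z| + |η z|) with hm
  set I := ∫ z, m z with hI
  -- Scale invariance: the factor `‖z‖` compensates the derivative of `η`, so the integrand is the
  -- dilation of `m` and its integral does not depend on `ε`.
  have hmε : ∀ ε, 0 < ε → ∫ z, C * (∑ k, ‖z‖ * |partialDeriv k (dilate ε η) z| + |dilate ε η z|) ≤ I := by
    intro ε hε
    rw [hI, ← integral_dilate hε m]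
    refine le_of_eq (integral_congr_ae (Eventually.of_forall fun z => ?_))
    have hp : 0 < (ε ^ d)⁻¹ := by positivity
    have hp' : 0 < ε⁻¹ := by positivity
    simp only [partialDeriv_dilate _ _ (hη.differentiable (by simp)), dilate, hm, abs_mul,
      abs_of_pos hp, abs_of_pos hp', norm_smul, Real.norm_of_nonneg hp'.le]
    rw [mul_left_comm, mul_add (ε ^ d)⁻¹, Finset.mul_sum]
    congr 2
    exact Finset.sum_congr rfl fun k _ => by ring
  set q := C / 4 * (d * I ^ 2) with hq
  have hq0 : 0 ≤ q := by positivity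
  -- The estimate gives `l ‖v‖² ≤ q N` at every scale; with `l = q + 1`, Fatou's lemma yields `(q +
  -- 1) N ≤ q N`.
  refine ⟨q + 1, by positivity, fun u hu => eq_zero_of_dens hg ?_⟩
  set N := ∫ x, ‖dens u x‖ ^ 2 with hN
  have hN0 : 0 ≤ N := integral_nonneg fun x => by positivity
  have hW := memLp_dens hg u
  have hlW : LocallyIntegrable (dens u) := hW.locallyIntegrable (by norm_num)
  set ε : ℕ → ℝ := fun n => 1 / ((n : ℝ) + 1) with hε
  have hε0 : ∀ n, 0 < ε n := fun n => by simp only [hε]; positivity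
  have hεt : Tendsto ε atTop (𝓝[>] 0) :=
    tendsto_nhdsWithin_iff.2 ⟨tendsto_one_div_add_atTop_nhds_zero_nat, Eventually.of_forall hε0⟩
  have hbound : ∀ n, ∫⁻ x, ‖moll (dilate (ε n) η) (dens u) x‖ₑ ^ 2 ≤ ENNReal.ofReal (q * N / (q + 1)) := by
    intro n
    have hd1 := contDiff_dilate (ε n) hη
    have hd2 := hasCompactSupport_dilate (hε0 n) hs
    rw [← integral_norm_sq_eq (memLp_moll hW hd1 hd2)]
    refine ENNReal.ofReal_le_ofReal ?_
    have := integral_moll_le hg hu hd1 hd2 (hmε _ (hε0 n))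
    rw [le_div_iff₀ (by positivity), mul_comm]
    refine this.trans_eq ?_
    rw [hq]; ring
  have hfin : ENNReal.ofReal N ≤ ENNReal.ofReal (q * N / (q + 1)) := by
    rw [hN, integral_norm_sq_eq hW]
    calc ∫⁻ x, ‖dens u x‖ₑ ^ 2 =
          ∫⁻ x, liminf (fun n => ‖moll (dilate (ε n) η) (dens u) x‖ₑ ^ 2) atTop := by
          refine lintegral_congr_ae ?_
          filter_upwards [ae_tendsto_moll_dilate hη hsupp h1 hlW] with x hx
          have h2 : Continuous fun z : ℂ => ‖z‖ₑ ^ 2 := (ENNReal.continuous_pow 2).comp continuous_enorm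
          exact (((h2.tendsto _).comp (hx.comp hεt)).liminf_eq).symm
      _ ≤ liminf (fun n => ∫⁻ x, ‖moll (dilate (ε n) η) (dens u) x‖ₑ ^ 2) atTop :=
          lintegral_liminf_le fun n => ((contDiff_moll hlW (contDiff_dilate (ε n) hη)
            (hasCompactSupport_dilate (hε0 n) hs)).continuous.measurable.enorm.pow_const 2)
      _ ≤ _ := liminf_le_of_le (by isBoundedDefault) fun b hb => by
          obtain ⟨n, hn⟩ := hb.exists
          exact hn.trans (hbound n)
  rw [ENNReal.ofReal_le_ofReal_iff (by positivity), le_div_iff₀ (by positivity)] at hfin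
  linarith

/-- A vector orthogonal to the range of `l - Δ_g` on test functions solves `Δ_g u = l u` weakly,
hence vanishes; the range of the closure is then dense and closed. -/
theorem exists_P_surjective {C : ℝ} (hg : g.Bounds C) :
    ∃ l : ℝ, 0 < l ∧ ∀ f : g.L2, ∃ p ∈ g.P.graph, l • p.1 + p.2 = f := by
  obtain ⟨l, hl, h⟩ := exists_eq_zero_of_weakEq hg
  refine ⟨l, hl, fun f => exists_closure_graph_of_dense_range isClosable_minusLaplace
    (fun p hp => ?_) hl (fun u hu => h u fun φ => ?_) f⟩
  · exact P_nonneg hg p (LinearPMap.le_graph_of_le (LinearPMap.le_closure _) hp)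
  · have h1 := hu _ (mem_minusLaplace_graph.2 ⟨φ, rfl⟩)
    rw [← Complex.coe_smul, inner_add_left, inner_smul_left, Complex.conj_ofReal] at h1
    have h2 : ⟪g.testToL2 φ, -(l • u)⟫ = -(l * ⟪g.testToL2 φ, u⟫) := by
      rw [inner_neg_right, ← inner_smul_right]
      congr 2
    rw [h2, eq_neg_iff_add_eq_zero, add_comm]
    exact h1

theorem isSelfAdjoint_P {C : ℝ} (hg : g.Bounds C) : IsSelfAdjoint g.P := by
  obtain ⟨l, _, h⟩ := exists_P_surjective hg
  exact isSelfAdjoint_of_surjective (dense_minusLaplace_domain.mono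
    (LinearPMap.le_closure g.minusLaplace).1) P_symmetric h

end Metric
end HeatKernel

/-! ### Bumps that are radial for the metric at a point -/

namespace HeatKernel

/-- A smooth decreasing function on the half line, supported in `[0,1]`. -/
noncomputable def profile (p : ℝ) : ℝ := Real.smoothTransition (1 - p)

/-- A primitive of `-profile / 2` that vanishes on `[1, ∞)`. -/
noncomputable def potential (p : ℝ) : ℝ := ∫ s in p..1, profile s / 2

lemma contDiff_profile : ContDiff ℝ ∞ profile :=
  Real.smoothTransition.contDiff.comp (contDiff_const.sub contDiff_id)

lemma profile_nonneg (p : ℝ) : 0 ≤ profile p := Real.smoothTransition.nonneg _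

lemma profile_le_one (p : ℝ) : profile p ≤ 1 := Real.smoothTransition.le_one _

lemma profile_of_one_le {p : ℝ} (h : 1 ≤ p) : profile p = 0 :=
  Real.smoothTransition.zero_of_nonpos (by linarith)

lemma profile_zero : profile 0 = 1 := Real.smoothTransition.one_of_one_le (by norm_num)

lemma hasDerivAt_profile (p : ℝ) : HasDerivAt profile (deriv profile p) p :=
  (contDiff_profile.differentiable (by simp) p).hasDerivAt

lemma exists_abs_deriv_profile_le : ∃ c : ℝ, 0 < c ∧ ∀ p, |deriv profile p| ≤ c := by
  obtain ⟨c, hc, h⟩ := exists_abs_deriv_smoothTransition_le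
  refine ⟨c, hc, fun p => ?_⟩
  have h1 : HasDerivAt Real.smoothTransition (deriv Real.smoothTransition (1 - p)) (1 - p) :=
    ((Real.smoothTransition.contDiff (n := 1)).differentiable (by simp) _).hasDerivAt
  have h2 : HasDerivAt profile _ p := h1.comp p ((hasDerivAt_id p).const_sub 1)
  rw [h2.deriv, mul_neg, mul_one, abs_neg]
  exact h _

lemma deriv_profile_of_one_lt {p : ℝ} (h : 1 < p) : deriv profile p = 0 := by
  have : profile =ᶠ[𝓝 p] fun _ => 0 := by
    filter_upwards [Ioi_mem_nhds h] with y hy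
    exact profile_of_one_le (le_of_lt hy)
  rw [this.deriv_eq, deriv_const]

lemma hasDerivAt_potential (p : ℝ) : HasDerivAt potential (-(profile p / 2)) p :=
  intervalIntegral.integral_hasDerivAt_left
    ((contDiff_profile.continuous.div_const 2).intervalIntegrable _ _)
    (contDiff_profile.continuous.div_const 2).stronglyMeasurable.stronglyMeasurableAtFilter
    (contDiff_profile.continuous.div_const 2).continuousAt

lemma contDiff_potential : ContDiff ℝ ∞ potential := by
  rw [contDiff_infty_iff_deriv]
  refine ⟨fun p => (hasDerivAt_potential p).differentiableAt, ?_⟩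
  have : deriv potential = fun p => -(profile p / 2) := funext fun p => (hasDerivAt_potential p).deriv
  rw [this]
  exact (contDiff_profile.div_const 2).neg

lemma potential_of_one_le {p : ℝ} (h : 1 ≤ p) : potential p = 0 := by
  rw [potential, intervalIntegral.integral_symm, intervalIntegral.integral_congr (g := fun _ => 0)]
  · simp
  · intro s hs
    rw [Set.uIcc_of_le h] at hs
    simp only [profile_of_one_le hs.1, zero_div]

lemma abs_potential_le {p : ℝ} (h : 0 ≤ p) : |potential p| ≤ 1 := by
  rcases le_total 1 p with h1 | h1
  · rw [potential_of_one_le h1, abs_zero]; exact zero_le_one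
  · have := intervalIntegral.norm_integral_le_of_norm_le_const (a := p) (b := 1)
      (f := fun s => profile s / 2) (C := 1) fun s _ => by
        rw [Real.norm_of_nonneg (div_nonneg (profile_nonneg s) (by norm_num))]
        linarith [profile_le_one s]
    rw [one_mul, abs_of_nonneg (by linarith : (0 : ℝ) ≤ 1 - p)] at this
    exact this.trans (by linarith)

namespace Metric

variable {d : ℕ} {g : Metric d}

/-- The vector `g(x) z`. -/
noncomputable def flat (g : Metric d) (x z : Space d) (k : Fin d) : ℝ := ∑ j, g.mat x k j * z j

lemma quad_eq (x z : Space d) : g.quad x z = ∑ k, z k * g.flat x z k := by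
  simp only [quad, flat, Finset.mul_sum]
  exact Finset.sum_congr rfl fun j _ => Finset.sum_congr rfl fun k _ => by ring

lemma quad_smul (x z : Space d) (a : ℝ) : g.quad x (a • z) = a ^ 2 * g.quad x z := by
  simp only [quad, Finset.mul_sum, PiLp.smul_apply, smul_eq_mul]
  exact Finset.sum_congr rfl fun j _ => Finset.sum_congr rfl fun k _ => by ring

lemma quad_nonneg {C : ℝ} (hg : g.Bounds C) (x z : Space d) : 0 ≤ g.quad x z :=
  le_trans (by have := hg.one_le; positivity) (hg.quad_lower x z)

lemma norm_le_of_quad_le {C : ℝ} (hg : g.Bounds C) {x z : Space d} {r : ℝ} (hr : 0 ≤ r)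
    (h : g.quad x z ≤ r ^ 2) : ‖z‖ ≤ C * r := by
  have hC := hg.one_le
  have h1 := (hg.quad_lower x z).trans h
  rw [inv_mul_le_iff₀ (by linarith)] at h1
  refine le_of_sq_le_sq ?_ (by positivity)
  rw [mul_pow]
  nlinarith [sq_nonneg r]

lemma abs_flat_le {C : ℝ} (hg : g.Bounds C) (x z : Space d) (k : Fin d) :
    |g.flat x z k| ≤ d * C * ‖z‖ := by
  refine (Finset.abs_sum_le_sum_abs _ _).trans ?_
  have : ∀ j ∈ Finset.univ, |g.mat x k j * z j| ≤ C * ‖z‖ := fun j _ => by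
    rw [abs_mul]
    exact mul_le_mul (hg.mat_le x k j) (PiLp.norm_apply_le z j) (abs_nonneg _)
      (by linarith [hg.one_le])
  refine (Finset.sum_le_sum this).trans_eq ?_
  simp [mul_assoc]

lemma hasFDerivAt_coord (j : Fin d) (z : Space d) :
    HasFDerivAt (fun z : Space d => z j) (EuclideanSpace.proj j : Space d →L[ℝ] ℝ) z :=
  (EuclideanSpace.proj j : Space d →L[ℝ] ℝ).hasFDerivAt

lemma contDiff_coord (j : Fin d) : ContDiff ℝ ∞ (fun z : Space d => z j) :=
  (EuclideanSpace.proj j : Space d →L[ℝ] ℝ).contDiff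

lemma contDiff_quad (x : Space d) : ContDiff ℝ ∞ (g.quad x) :=
  ContDiff.sum fun j _ => ContDiff.sum fun k _ =>
    (contDiff_const.mul (contDiff_coord j)).mul (contDiff_coord k)

lemma contDiff_flat (x : Space d) (k : Fin d) : ContDiff ℝ ∞ (fun z => g.flat x z k) :=
  ContDiff.sum fun j _ => contDiff_const.mul (contDiff_coord j)

lemma partialDeriv_flat (x z : Space d) (j k : Fin d) :
    partialDeriv j (fun z => g.flat x z k) z = g.mat x k j := by
  have h : HasFDerivAt (fun z => g.flat x z k)
      (∑ l, g.mat x k l • (EuclideanSpace.proj l : Space d →L[ℝ] ℝ)) z :=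
    HasFDerivAt.fun_sum fun l _ => (hasFDerivAt_coord l z).const_mul _
  rw [partialDeriv, h.fderiv]
  simp

lemma partialDeriv_quad (x z : Space d) (k : Fin d) :
    partialDeriv k (g.quad x) z = 2 * g.flat x z k := by
  have e : g.quad x = fun z => ∑ l, z l * g.flat x z l := funext fun z => quad_eq x z
  have hl : ∀ l, DifferentiableAt ℝ (fun z => g.flat x z l) z := fun l =>
    (contDiff_flat x l).differentiable (by simp) z
  have h : HasFDerivAt (fun z => ∑ l, z l * g.flat x z l) _ z :=
    HasFDerivAt.fun_sum (u := Finset.univ) fun l _ => (hasFDerivAt_coord l z).mul (hl l).hasFDerivAt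
  have h2 : ∀ l, fderiv ℝ (fun z => g.flat x z l) z (EuclideanSpace.single k 1) = g.mat x l k :=
    fun l => partialDeriv_flat x z k l
  rw [partialDeriv, e, h.fderiv]
  simp only [sum_apply, add_apply, smul_apply, smul_eq_mul, h2, Finset.sum_add_distrib]
  have h3 : ∑ l, z l * g.mat x l k = g.flat x z k :=
    Finset.sum_congr rfl fun l _ => by rw [mat_symm, mul_comm]
  rw [h3, two_mul]
  congr 1
  simp

lemma partialDeriv_comp_sub {F : Type*} [NormedAddCommGroup F] [NormedSpace ℝ F] (k : Fin d)
    {f : Space d → F} (hf : Differentiable ℝ f) (x y : Space d) :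
    partialDeriv k (fun y => f (y - x)) y = partialDeriv k f (y - x) := by
  have h : HasFDerivAt (fun y => f (y - x)) _ y :=
    (hf (y - x)).hasFDerivAt.comp y ((hasFDerivAt_id y).sub_const x)
  simp only [partialDeriv]
  rw [h.fderiv]
  simp

section radial

variable {F F1 F2 : ℝ → ℝ}

lemma partialDeriv_radial (h1 : ∀ p, HasDerivAt F (F1 p) p) (a b : ℝ) (x : Space d) (k : Fin d) :
    partialDeriv k (fun y => b * F (a * g.quad x (y - x))) =
      fun y => 2 * (a * b) * (F1 (a * g.quad x (y - x)) * g.flat x (y - x) k) := by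
  ext y
  have hq : Differentiable ℝ (g.quad x) := (contDiff_quad x).differentiable (by simp)
  have hd : DifferentiableAt ℝ (fun y => g.quad x (y - x)) y :=
    DifferentiableAt.fun_comp' y (hq (y - x)) (differentiableAt_id.sub_const x)
  have h : HasFDerivAt (fun y => b * F (a * g.quad x (y - x))) _ y :=
    ((h1 (a * g.quad x (y - x))).comp_hasFDerivAt y (hd.hasFDerivAt.const_mul a)).const_mul b
  have h2 := partialDeriv_comp_sub k hq x y
  rw [partialDeriv_quad, partialDeriv] at h2
  rw [partialDeriv, h.fderiv]
  simp only [smul_apply, smul_eq_mul, h2]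
  ring

lemma partialDeriv_partialDeriv_radial (h1 : ∀ p, HasDerivAt F (F1 p) p)
    (h2 : ∀ p, HasDerivAt F1 (F2 p) p) (a b : ℝ) (x y : Space d) (j k : Fin d) :
    partialDeriv j (partialDeriv k (fun y => b * F (a * g.quad x (y - x)))) y =
      4 * (a ^ 2 * b) * (F2 (a * g.quad x (y - x)) * (g.flat x (y - x) j * g.flat x (y - x) k)) +
        2 * (a * b) * (F1 (a * g.quad x (y - x)) * g.mat x j k) := by
  rw [partialDeriv_radial h1]
  have e1 := congrFun (partialDeriv_radial (g := g) h2 a 1 x j) y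
  simp only [one_mul] at e1
  have hq : Differentiable ℝ (fun y => g.quad x (y - x)) :=
    ((contDiff_quad x).differentiable (by simp)).comp (differentiable_id.sub_const x)
  have d1 : DifferentiableAt ℝ (fun y => F1 (a * g.quad x (y - x))) y :=
    ((h2 (a * g.quad x (y - x))).differentiableAt.comp y ((hq y).const_mul a))
  have hf : Differentiable ℝ (fun z => g.flat x z k) := (contDiff_flat x k).differentiable (by simp)
  have d2 : DifferentiableAt ℝ (fun y => g.flat x (y - x) k) y :=
    DifferentiableAt.fun_comp' (g := fun z => g.flat x z k) y (hf (y - x)) (differentiableAt_id.sub_const x)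
  have e2 := partialDeriv_comp_sub j hf x y
  rw [partialDeriv_flat] at e2
  have h : HasFDerivAt (fun y => 2 * (a * b) * (F1 (a * g.quad x (y - x)) * g.flat x (y - x) k)) _ y :=
    (d1.hasFDerivAt.mul d2.hasFDerivAt).const_mul (2 * (a * b))
  rw [partialDeriv] at e1 e2
  rw [partialDeriv, h.fderiv]
  simp only [smul_apply, add_apply, smul_eq_mul, e1, e2, mat_symm x j k]
  ring

lemma sum_inv_mul_flat (x z : Space d) :
    ∑ k, ∑ j, g.inv j k x * (g.flat x z j * g.flat x z k) = g.quad x z := by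
  have h : ∀ k, ∑ j, g.inv k j x * g.flat x z j = z k := fun k => by
    simp only [flat, Finset.mul_sum]
    rw [Finset.sum_comm]
    have : ∀ l, ∑ j, g.inv k j x * (g.mat x j l * z l) = (1 : Matrix (Fin d) (Fin d) ℝ) k l * z l :=
      fun l => by
        rw [← sum_inv_mul_mat, Finset.sum_mul]
        exact Finset.sum_congr rfl fun j _ => by ring
    simp only [this, Matrix.one_apply]
    simp
  rw [quad_eq]
  refine Finset.sum_congr rfl fun k _ => ?_
  rw [← h k, Finset.sum_mul]
  refine Finset.sum_congr rfl fun j _ => ?_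
  rw [inv_symm]; ring

lemma sum_inv_mul_mat_trace (x : Space d) : ∑ k, ∑ j, g.inv j k x * g.mat x j k = d := by
  have : ∀ k, ∑ j, g.inv j k x * g.mat x j k = 1 := fun k => by
    have := sum_inv_mul_mat (g := g) x k k
    rw [Matrix.one_apply_eq] at this
    rw [← this]
    exact Finset.sum_congr rfl fun j _ => by rw [inv_symm]
  simp [this]

/-- The Laplace-Beltrami operator on functions that are radial for the metric at `x`, up to lower
order terms. -/
lemma abs_laplace_radial_sub_le {C : ℝ} (hg : g.Bounds C) (h1 : ∀ p, HasDerivAt F (F1 p) p)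
    (h2 : ∀ p, HasDerivAt F1 (F2 p) p) {a b : ℝ} (ha : 0 ≤ a) (hb : 0 ≤ b) (x y : Space d) :
    |g.laplace (fun y => b * F (a * g.quad x (y - x))) y -
        b * (4 * a * (a * g.quad x (y - x) * F2 (a * g.quad x (y - x))) +
          2 * a * d * F1 (a * g.quad x (y - x)))| ≤
      b * (d * (d * (C * ‖y - x‖ * (4 * a ^ 2 * |F2 (a * g.quad x (y - x))| * (d * C * ‖y - x‖) ^ 2 +
        2 * a * |F1 (a * g.quad x (y - x))| * C)) +
        C * (2 * a * |F1 (a * g.quad x (y - x))| * (d * C * ‖y - x‖)))) := by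
  have hC : 0 < C := by linarith [hg.one_le]
  set z := y - x with hz
  set p := a * g.quad x z with hp
  set D : Fin d → Fin d → ℝ := fun j k => 4 * (a ^ 2 * b) * (F2 p * (g.flat x z j * g.flat x z k)) +
        2 * (a * b) * (F1 p * g.mat x j k) with hD
  -- With the coefficients frozen at `x`, the first term contracts to the quadratic form itself and
  -- the second to the trace `d`.
  have e1 : b * (4 * a * (a * g.quad x z * F2 p) + 2 * a * d * F1 p) =
      ∑ k, ∑ j, g.inv j k x * D j k := by
    have : ∀ j k, g.inv j k x * D j k = 4 * (a ^ 2 * b) * F2 p *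
        (g.inv j k x * (g.flat x z j * g.flat x z k)) +
        2 * (a * b) * F1 p * (g.inv j k x * g.mat x j k) := fun j k => by rw [hD]; ring
    simp only [this, Finset.sum_add_distrib, ← Finset.mul_sum, sum_inv_mul_flat,
      sum_inv_mul_mat_trace]
    ring
  have e2 : g.laplace (fun y => b * F (a * g.quad x (y - x))) y = ∑ k, (∑ j, g.inv j k y * D j k +
      g.drift k y * (2 * (a * b) * (F1 p * g.flat x z k))) := by
    simp only [laplace, partialDeriv_partialDeriv_radial h1 h2]
    simp only [partialDeriv_radial h1, hD, hp, hz]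
  have hDle : ∀ j k, |D j k| ≤ b * (4 * a ^ 2 * |F2 p| * (d * C * ‖z‖) ^ 2 + 2 * a * |F1 p| * C) := by
    intro j k
    refine (abs_add_le _ _).trans ?_
    rw [mul_add]
    refine add_le_add ?_ ?_
    · rw [abs_mul, abs_mul (F2 p), abs_mul (g.flat x z j), abs_of_nonneg (by positivity)]
      have := mul_le_mul (abs_flat_le hg x z j) (abs_flat_le hg x z k) (abs_nonneg _) (by positivity)
      calc 4 * (a ^ 2 * b) * (|F2 p| * (|g.flat x z j| * |g.flat x z k|))
          ≤ 4 * (a ^ 2 * b) * (|F2 p| * (d * C * ‖z‖ * (d * C * ‖z‖))) := by gcongr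
        _ = _ := by ring
    · rw [abs_mul, abs_mul (F1 p), abs_of_nonneg (by positivity)]
      calc 2 * (a * b) * (|F1 p| * |g.mat x j k|) ≤ 2 * (a * b) * (|F1 p| * C) := by
            gcongr; exact hg.mat_le x j k
        _ = _ := by ring
  rw [e1, e2, ← Finset.sum_sub_distrib]
  refine (Finset.abs_sum_le_sum_abs _ _).trans ?_
  have hk : ∀ k ∈ Finset.univ, |∑ j, g.inv j k y * D j k +
      g.drift k y * (2 * (a * b) * (F1 p * g.flat x z k)) - ∑ j, g.inv j k x * D j k| ≤
      d * (C * ‖z‖ * (b * (4 * a ^ 2 * |F2 p| * (d * C * ‖z‖) ^ 2 + 2 * a * |F1 p| * C))) +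
        C * (2 * (a * b) * (|F1 p| * (d * C * ‖z‖))) := by
    intro k _
    have : ∑ j, g.inv j k y * D j k + g.drift k y * (2 * (a * b) * (F1 p * g.flat x z k)) -
        ∑ j, g.inv j k x * D j k = ∑ j, (g.inv j k y - g.inv j k x) * D j k +
        g.drift k y * (2 * (a * b) * (F1 p * g.flat x z k)) := by
      simp only [sub_mul, Finset.sum_sub_distrib]; ring
    rw [this]
    refine (abs_add_le _ _).trans (add_le_add ?_ ?_)
    · refine (Finset.abs_sum_le_sum_abs _ _).trans ?_
      have : ∀ j ∈ Finset.univ, |(g.inv j k y - g.inv j k x) * D j k| ≤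
          C * ‖z‖ * (b * (4 * a ^ 2 * |F2 p| * (d * C * ‖z‖) ^ 2 + 2 * a * |F1 p| * C)) := fun j _ => by
        rw [abs_mul]
        exact mul_le_mul (hg.inv_lipschitz j k y x) (hDle j k) (abs_nonneg _) (by positivity)
      refine (Finset.sum_le_sum this).trans_eq ?_
      simp
    · rw [abs_mul, abs_mul (2 * (a * b)), abs_mul (F1 p), abs_of_nonneg (by positivity : 0 ≤ 2 * (a * b))]
      have h3 := abs_flat_le hg x z k
      exact mul_le_mul (hg.drift_le k y) (by gcongr) (by positivity) hC.le
  refine (Finset.sum_le_sum hk).trans_eq ?_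
  simp
  ring

end radial

/-- A bump function at `x` at scale `r`, radial for the metric at `x`. -/
noncomputable def bump (g : Metric d) (x : Space d) (r : ℝ) (y : Space d) : ℝ :=
  (r ^ d)⁻¹ * profile ((r ^ 2)⁻¹ * g.quad x (y - x))

/-- The function whose frozen Laplacian is, up to the factor `r`, the derivative of `bump` in `r`. -/
noncomputable def bumpPot (g : Metric d) (x : Space d) (r : ℝ) (y : Space d) : ℝ :=
  (r ^ d)⁻¹ * potential ((r ^ 2)⁻¹ * g.quad x (y - x))

/-- The derivative of `bump` in `r`. -/
noncomputable def bumpDeriv (g : Metric d) (x : Space d) (r : ℝ) (y : Space d) : ℝ :=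
  -((r ^ d)⁻¹ * r⁻¹ * (d * profile ((r ^ 2)⁻¹ * g.quad x (y - x)) +
    2 * ((r ^ 2)⁻¹ * g.quad x (y - x) * deriv profile ((r ^ 2)⁻¹ * g.quad x (y - x)))))

lemma hasDerivAt_bump (x y : Space d) {r : ℝ} (hr : 0 < r) :
    HasDerivAt (fun r => g.bump x r y) (g.bumpDeriv x r y) r := by
  have h1 : HasDerivAt (fun r : ℝ => (r ^ d)⁻¹) (-((r ^ d)⁻¹ * r⁻¹ * d)) r := by
    have := (hasDerivAt_pow d r).inv (pow_pos hr d).ne'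
    refine this.congr_deriv ?_
    rcases Nat.eq_zero_or_pos d with h0 | h0
    · subst h0; simp
    · obtain ⟨n, rfl⟩ : ∃ n, d = n + 1 := ⟨d - 1, by omega⟩
      simp only [Nat.add_sub_cancel]
      field_simp
      ring
  have h2 : HasDerivAt (fun r : ℝ => (r ^ 2)⁻¹ * g.quad x (y - x))
      (-(2 * r⁻¹ * ((r ^ 2)⁻¹ * g.quad x (y - x)))) r := by
    have := ((hasDerivAt_pow 2 r).inv (pow_pos hr 2).ne').mul_const (g.quad x (y - x))
    refine this.congr_deriv ?_
    field_simp
    push_cast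
    ring
  have h3 := h1.mul ((hasDerivAt_profile _).comp r h2)
  refine h3.congr_deriv ?_
  simp only [bumpDeriv, Function.comp_apply]
  ring

section support

variable {C : ℝ}

lemma one_lt_of_lt_dist (hg : g.Bounds C) {x y : Space d} {r : ℝ} (hr : 0 < r) (h : C * r < dist y x) :
    1 < (r ^ 2)⁻¹ * g.quad x (y - x) := by
  by_contra hn
  rw [not_lt, inv_mul_le_iff₀ (by positivity), mul_one] at hn
  have := norm_le_of_quad_le hg hr.le hn
  rw [dist_eq_norm] at h
  linarith

lemma bump_eq_zero (hg : g.Bounds C) {x y : Space d} {r : ℝ} (hr : 0 < r) (h : C * r < dist y x) :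
    g.bump x r y = 0 := by
  rw [bump, profile_of_one_le (one_lt_of_lt_dist hg hr h).le, mul_zero]

lemma bumpPot_eq_zero (hg : g.Bounds C) {x y : Space d} {r : ℝ} (hr : 0 < r) (h : C * r < dist y x) :
    g.bumpPot x r y = 0 := by
  rw [bumpPot, potential_of_one_le (one_lt_of_lt_dist hg hr h).le, mul_zero]

lemma bumpDeriv_eq_zero (hg : g.Bounds C) {x y : Space d} {r : ℝ} (hr : 0 < r)
    (h : C * r < dist y x) : g.bumpDeriv x r y = 0 := by
  have := one_lt_of_lt_dist hg hr h
  rw [bumpDeriv, profile_of_one_le this.le, deriv_profile_of_one_lt this]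
  simp

lemma abs_bump_le (x y : Space d) {r : ℝ} (hr : 0 < r) : |g.bump x r y| ≤ (r ^ d)⁻¹ := by
  rw [bump, abs_mul, abs_of_pos (by positivity), abs_of_nonneg (profile_nonneg _)]
  exact mul_le_of_le_one_right (by positivity) (profile_le_one _)

lemma abs_bumpPot_le (hg : g.Bounds C) (x y : Space d) {r : ℝ} (hr : 0 < r) :
    |g.bumpPot x r y| ≤ (r ^ d)⁻¹ := by
  rw [bumpPot, abs_mul, abs_of_pos (by positivity)]
  exact mul_le_of_le_one_right (by positivity)
    (abs_potential_le (mul_nonneg (by positivity) (quad_nonneg hg _ _)))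

lemma exists_abs_bumpDeriv_le (hg : g.Bounds C) : ∃ B : ℝ, 0 < B ∧ ∀ x y : Space d, ∀ r, 0 < r →
    |g.bumpDeriv x r y| ≤ B * ((r ^ d)⁻¹ * r⁻¹) := by
  obtain ⟨c, hc, h⟩ := exists_abs_deriv_profile_le
  refine ⟨d + 2 * c, by positivity, fun x y r hr => ?_⟩
  rw [bumpDeriv, abs_neg, abs_mul, abs_of_pos (by positivity), mul_comm]
  refine mul_le_mul_of_nonneg_right ?_ (by positivity)
  set p := (r ^ 2)⁻¹ * g.quad x (y - x) with hp
  have hp0 : 0 ≤ p := mul_nonneg (by positivity) (quad_nonneg hg _ _)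
  refine (abs_add_le _ _).trans (add_le_add ?_ ?_)
  · rw [abs_mul, Nat.abs_cast, abs_of_nonneg (profile_nonneg _)]
    exact mul_le_of_le_one_right (by positivity) (profile_le_one _)
  · rw [abs_mul, abs_mul, abs_of_nonneg hp0, abs_two]
    rcases le_or_gt p 1 with h1 | h1
    · have := mul_le_mul h1 (h p) (abs_nonneg _) zero_le_one
      linarith
    · rw [deriv_profile_of_one_lt h1]; simp; exact hc.le

lemma contDiff_bumpPot (x : Space d) (r : ℝ) : ContDiff ℝ ∞ (g.bumpPot x r) :=
  contDiff_const.mul (contDiff_potential.comp (contDiff_const.mul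
    ((contDiff_quad x).comp (contDiff_id.sub contDiff_const))))

lemma continuous_bump (x : Space d) (r : ℝ) : Continuous (g.bump x r) :=
  continuous_const.mul (contDiff_profile.continuous.comp (continuous_const.mul
    ((contDiff_quad x).continuous.comp (continuous_id.sub continuous_const))))

lemma continuous_bumpDeriv (x : Space d) (r : ℝ) : Continuous (g.bumpDeriv x r) := by
  have h1 : Continuous fun y => (r ^ 2)⁻¹ * g.quad x (y - x) := continuous_const.mul
    ((contDiff_quad x).continuous.comp (continuous_id.sub continuous_const))
  have h2 : Continuous (deriv profile) := contDiff_profile.continuous_deriv (by simp)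
  exact (continuous_const.mul ((continuous_const.mul (contDiff_profile.continuous.comp h1)).add
    (continuous_const.mul (h1.mul (h2.comp h1))))).neg

lemma hasCompactSupport_of_dist {f : Space d → ℝ} {x : Space d} {R : ℝ}
    (h : ∀ y, R < dist y x → f y = 0) : HasCompactSupport f :=
  HasCompactSupport.intro (isCompact_closedBall x R) fun y hy =>
    h y (by rwa [Metric.mem_closedBall, not_le] at hy)

/-- The derivative of `bump` in `r` is nearly a Laplacian. -/
lemma exists_abs_laplace_sub_le (hg : g.Bounds C) : ∃ K : ℝ, 0 < K ∧ ∀ x y : Space d, ∀ r, 0 < r →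
    |r * g.laplace (g.bumpPot x r) y - g.bumpDeriv x r y| ≤ K * (r ^ d)⁻¹ := by
  obtain ⟨c, hc, h⟩ := exists_abs_deriv_profile_le
  have hC : 0 < C := by linarith [hg.one_le]
  refine ⟨d * (d * (C * C * (4 * c * (d * C * C) ^ 2 + 2 * C)) + C * (2 * (d * C * C))) + 1,
    by positivity, fun x y r hr => ?_⟩
  set p := (r ^ 2)⁻¹ * g.quad x (y - x) with hp
  have hF2 : ∀ p, HasDerivAt (fun p => -(profile p / 2)) (-(deriv profile p / 2)) p := fun p =>
    ((hasDerivAt_profile p).div_const 2).neg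
  have key := abs_laplace_radial_sub_le hg hasDerivAt_potential hF2 (a := (r ^ 2)⁻¹) (b := (r ^ d)⁻¹)
    (by positivity) (by positivity) x y
  rw [← hp] at key
  -- On radial functions of `p` the frozen Laplacian is `r⁻² (4 p F'' + 2 d F')`. With `F' =
  -- -profile/2` this is `-r⁻² (d profile + 2 p profile')`, exactly the expression in `bumpDeriv`;
  -- this explains the factor `1/2` in `potential`.
  have e1 : r * g.laplace (g.bumpPot x r) y - g.bumpDeriv x r y =
      r * (g.laplace (fun y => (r ^ d)⁻¹ * potential ((r ^ 2)⁻¹ * g.quad x (y - x))) y -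
        (r ^ d)⁻¹ * (4 * (r ^ 2)⁻¹ * (p * -(deriv profile p / 2)) +
          2 * (r ^ 2)⁻¹ * d * -(profile p / 2))) := by
    rw [mul_sub]
    congr 1
    rw [bumpDeriv, ← hp]
    field_simp
    ring
  rw [e1, abs_mul, abs_of_pos hr]
  refine (mul_le_mul_of_nonneg_left key hr.le).trans ?_
  rcases le_or_gt p 1 with h1 | h1
  · have hz : ‖y - x‖ ≤ C * r := by
      refine norm_le_of_quad_le (x := x) hg hr.le ?_
      rwa [hp, inv_mul_le_iff₀ (by positivity), mul_one] at h1
    have a1 : |-(profile p / 2)| ≤ 1 := by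
      rw [abs_neg, abs_of_nonneg (div_nonneg (profile_nonneg p) (by norm_num))]
      linarith [profile_le_one p]
    have a2 : |-(deriv profile p / 2)| ≤ c := by
      rw [abs_neg, abs_div, abs_two]
      linarith [h p, abs_nonneg (deriv profile p)]
    calc r * ((r ^ d)⁻¹ * (d * (d * (C * ‖y - x‖ * (4 * (r ^ 2)⁻¹ ^ 2 * |-(deriv profile p / 2)| *
          (d * C * ‖y - x‖) ^ 2 + 2 * (r ^ 2)⁻¹ * |-(profile p / 2)| * C)) +
          C * (2 * (r ^ 2)⁻¹ * |-(profile p / 2)| * (d * C * ‖y - x‖)))))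
        ≤ r * ((r ^ d)⁻¹ * (d * (d * (C * (C * r) * (4 * (r ^ 2)⁻¹ ^ 2 * c *
          (d * C * (C * r)) ^ 2 + 2 * (r ^ 2)⁻¹ * 1 * C)) +
          C * (2 * (r ^ 2)⁻¹ * 1 * (d * C * (C * r)))))) := by gcongr
      _ = (d * (d * (C * C * (4 * c * (d * C * C) ^ 2 + 2 * C)) + C * (2 * (d * C * C)))) *
          (r ^ d)⁻¹ := by field_simp
      _ ≤ _ := by gcongr; linarith
  · rw [profile_of_one_le h1.le, deriv_profile_of_one_lt h1]
    simp
    positivity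

end support

end Metric
end HeatKernel

/-! ### Continuous representatives of weak solutions -/

namespace HeatKernel

lemma norm_integral_le_of_dist {d : ℕ} {F : Space d → ℂ} {x : Space d} {R B : ℝ}
    (h1 : ∀ᵐ y, ‖F y‖ ≤ B) (h2 : ∀ y, R < dist y x → F y = 0) :
    ‖∫ y, F y‖ ≤ B * volume.real (Metric.closedBall x R) := by
  rw [← setIntegral_eq_integral_of_forall_compl_eq_zero (s := Metric.closedBall x R) fun y hy =>
    h2 y (by rwa [Metric.mem_closedBall, not_le] at hy)]
  exact norm_setIntegral_le_of_norm_le_const_ae measure_closedBall_lt_top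
    (ae_restrict_of_ae h1)

lemma volume_real_closedBall {d : ℕ} (x : Space d) {R : ℝ} (hR : 0 ≤ R) :
    volume.real (Metric.closedBall x R) = R ^ d * volume.real (Metric.ball (0 : Space d) 1) := by
  rw [Measure.real, Measure.addHaar_closedBall _ _ hR, finrank_euclideanSpace_fin,
    ENNReal.toReal_mul, ENNReal.toReal_ofReal (by positivity)]
  rfl

namespace Metric

variable {d : ℕ} {g : Metric d} {C : ℝ}

lemma continuous_quad_uncurry : Continuous fun p : Space d × Space d => g.quad p.1 p.2 := by
  simp only [quad]
  refine continuous_finsetSum _ fun j _ => continuous_finsetSum _ fun k _ => ?_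
  exact (((g.smooth j k).continuous.comp continuous_fst).mul
    ((contDiff_coord j).continuous.comp continuous_snd)).mul
    ((contDiff_coord k).continuous.comp continuous_snd)

/-- The integral of `bump`. -/
noncomputable def bumpMass (g : Metric d) (x : Space d) : ℝ := ∫ z, profile (g.quad x z)

lemma bump_eq_dilate (x y : Space d) (r : ℝ) :
    g.bump x r y = dilate r (fun z => profile (g.quad x z)) (y - x) := by
  rw [bump, dilate, quad_smul, inv_pow]

lemma integral_bump (x : Space d) {r : ℝ} (hr : 0 < r) : ∫ y, g.bump x r y = g.bumpMass x := by
  simp only [bump_eq_dilate]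
  rw [integral_sub_right_eq_self (dilate r fun z => profile (g.quad x z)) x, integral_dilate hr]
  rfl

lemma profile_quad_eq_zero (hg : g.Bounds C) {x z : Space d} (h : C < ‖z‖) :
    profile (g.quad x z) = 0 := by
  refine profile_of_one_le ?_
  by_contra hn
  rw [not_le] at hn
  have := norm_le_of_quad_le (x := x) (z := z) hg zero_le_one (by linarith)
  linarith

lemma bumpMass_pos (hg : g.Bounds C) (x : Space d) : 0 < g.bumpMass x := by
  have hc : Continuous fun z => profile (g.quad x z) :=
    contDiff_profile.continuous.comp (contDiff_quad x).continuous
  refine hc.integral_pos_of_hasCompactSupport_nonneg_nonzero (x := 0) ?_ (fun z => profile_nonneg _) ?_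
  · exact hasCompactSupport_of_dist (x := 0) (R := C) fun z hz =>
      profile_quad_eq_zero hg (by rwa [dist_zero_right] at hz)
  · have : g.quad x 0 = 0 := by simp [quad]
    rw [this, profile_zero]; exact one_ne_zero

lemma continuous_bumpMass (hg : g.Bounds C) : Continuous g.bumpMass := by
  have h : ∀ x : Space d, ∀ z, ‖profile (g.quad x z)‖ ≤
      (Metric.closedBall (0 : Space d) C).indicator (fun _ => (1 : ℝ)) z := fun x z => by
    by_cases hz : z ∈ Metric.closedBall (0 : Space d) C
    · rw [Set.indicator_of_mem hz, Real.norm_of_nonneg (profile_nonneg _)]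
      exact profile_le_one _
    · rw [mem_closedBall_zero_iff, not_le] at hz
      rw [profile_quad_eq_zero hg hz, norm_zero]
      exact Set.indicator_nonneg (fun _ _ => zero_le_one) _
  refine continuous_of_dominated (fun x => ?_) (fun x => Eventually.of_forall (h x)) ?_
    (Eventually.of_forall fun z => ?_)
  · exact (contDiff_profile.continuous.comp (contDiff_quad x).continuous).aestronglyMeasurable
  · exact (integrable_indicator_iff measurableSet_closedBall).2
      (integrableOn_const measure_closedBall_lt_top.ne)
  · exact contDiff_profile.continuous.comp
      (continuous_quad_uncurry.comp (continuous_id.prodMk continuous_const))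

lemma laplace_bumpPot_eq_zero (hg : g.Bounds C) {x y : Space d} {r : ℝ} (hr : 0 < r)
    (h : C * r < dist y x) : g.laplace (g.bumpPot x r) y = 0 := by
  have h0 : g.bumpPot x r =ᶠ[𝓝 y] fun _ => 0 := by
    filter_upwards [(isOpen_lt continuous_const (continuous_id.dist continuous_const)).mem_nhds h]
      with z hz
    exact bumpPot_eq_zero hg hr hz
  have h1 : ∀ k, partialDeriv k (g.bumpPot x r) =ᶠ[𝓝 y] fun _ => 0 := fun k => by
    filter_upwards [h0.eventuallyEq_nhds] with z hz
    rw [partialDeriv, hz.fderiv_eq]; simp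
  have h2 : ∀ j k, partialDeriv j (partialDeriv k (g.bumpPot x r)) y = 0 := fun j k => by
    rw [partialDeriv, (h1 k).fderiv_eq]; simp
  simp only [laplace, h2, (h1 _).eq_of_nhds]
  simp

lemma continuous_laplace {f : Space d → ℝ} (hf : ContDiff ℝ ∞ f) : Continuous (g.laplace f) := by
  refine continuous_finsetSum _ fun k _ => Continuous.add (continuous_finsetSum _ fun j _ => ?_) ?_
  · exact (g.contDiff_inv j k).continuous.mul
      (contDiff_partialDeriv_real j (contDiff_partialDeriv_real k hf)).continuous
  · exact (continuous_drift k).mul (contDiff_partialDeriv_real k hf).continuous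

/-- The average of `u` against `bump`. -/
noncomputable def avg (u : g.L2) (x : Space d) (r : ℝ) : ℂ := ∫ y, (g.bump x r y : ℂ) * dens u y

lemma norm_dens_le (hg : g.Bounds C) {u : g.L2} {M : ℝ} (hM : ∀ᵐ x ∂g.vol, ‖u x‖ ≤ M) :
    ∀ᵐ x, ‖dens u x‖ ≤ C * M := by
  filter_upwards [g.volume_absolutelyContinuous_vol.ae_le hM] with x hx
  rw [dens, norm_mul, Complex.norm_real, Real.norm_of_nonneg (g.density_pos x).le]
  exact mul_le_mul (hg.density_upper x) hx (norm_nonneg _) (by linarith [hg.one_le])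

lemma integrable_mul_dens (hg : g.Bounds C) (u : g.L2) {f : Space d → ℝ} (hf : Continuous f)
    {x : Space d} {R : ℝ} (h : ∀ y, R < dist y x → f y = 0) :
    Integrable fun y => (f y : ℂ) * dens u y := by
  have hs := hasCompactSupport_of_dist h
  have h1 : MemLp (fun y => (f y : ℂ)) 2 volume :=
    (Complex.continuous_ofReal.comp hf).memLp_of_hasCompactSupport
      (hs.comp_left (g := fun r : ℝ => (r : ℂ)) Complex.ofReal_zero)
  exact MemLp.integrable_mul h1 (memLp_dens hg u)

/-- The averages of a weak solution with bounded data are Lipschitz in the scale. -/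
lemma exists_hasDerivAt_avg (hg : g.Bounds C) : ∃ K : ℝ, 0 < K ∧ ∀ (u w : g.L2) (M : ℝ), 0 ≤ M →
    WeakEq u w → (∀ᵐ x ∂g.vol, ‖u x‖ ≤ M) → (∀ᵐ x ∂g.vol, ‖w x‖ ≤ M) → ∀ x r, 0 < r → r ≤ 1 →
    ∃ v, HasDerivAt (avg u x) v r ∧ ‖v‖ ≤ K * M := by
  have hC : 0 < C := by linarith [hg.one_le]
  obtain ⟨K, hK, hKl⟩ := exists_abs_laplace_sub_le hg
  obtain ⟨B, hB, hBd⟩ := exists_abs_bumpDeriv_le hg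
  set V := volume.real (Metric.ball (0 : Space d) 1) with hV
  have hV0 : 0 < V := ENNReal.toReal_pos (Metric.measure_ball_pos _ _ one_pos).ne'
    measure_ball_lt_top.ne
  refine ⟨(K + 1) * C * C ^ d * V, by positivity, fun u w M hM huw hu hw x r hr hr1 => ?_⟩
  have hdu := norm_dens_le hg hu
  have hdw := norm_dens_le hg hw
  refine ⟨∫ y, (g.bumpDeriv x r y : ℂ) * dens u y, ?_, ?_⟩
  · refine (hasDerivAt_integral_of_dominated_loc_of_deriv_le (s := Set.Ioo (r / 2) (2 * r))
      (F := fun s y => (g.bump x s y : ℂ) * dens u y)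
      (F' := fun s y => (g.bumpDeriv x s y : ℂ) * dens u y)
      (bound := (Metric.closedBall x (C * (2 * r))).indicator
        fun _ => B * (((r / 2) ^ d)⁻¹ * (r / 2)⁻¹) * (C * M))
      (Ioo_mem_nhds (by linarith) (by linarith)) ?_ ?_ ?_ ?_ ?_ ?_).2
    · exact Eventually.of_forall fun s => (Complex.continuous_ofReal.comp
        (continuous_bump x s)).aestronglyMeasurable.mul (memLp_dens hg u).1
    · exact integrable_mul_dens hg u (continuous_bump x r) fun y hy => bump_eq_zero hg hr hy
    · exact (Complex.continuous_ofReal.comp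
        (continuous_bumpDeriv x r)).aestronglyMeasurable.mul (memLp_dens hg u).1
    · filter_upwards [hdu] with y hy s hs
      have hs0 : 0 < s := by linarith [hs.1]
      by_cases hyx : y ∈ Metric.closedBall x (C * (2 * r))
      · rw [Set.indicator_of_mem hyx, norm_mul, Complex.norm_real]
        refine mul_le_mul ((hBd x y s hs0).trans ?_) hy (norm_nonneg _) (by positivity)
        have := hs.1.le
        gcongr
      · rw [Set.indicator_of_notMem hyx, bumpDeriv_eq_zero hg hs0, Complex.ofReal_zero, zero_mul,
          norm_zero]
        rw [Metric.mem_closedBall, not_le] at hyx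
        exact lt_of_le_of_lt (by gcongr; exact hs.2.le) hyx
    · exact (integrable_indicator_iff measurableSet_closedBall).2
        (integrableOn_const measure_closedBall_lt_top.ne)
    · refine Eventually.of_forall fun y s hs => ?_
      have hs0 : 0 < s := by linarith [hs.1]
      exact ((hasDerivAt_bump x y hs0).ofReal_comp).mul_const _
  · have hs := hasCompactSupport_of_dist (f := g.bumpPot x r) fun y hy => bumpPot_eq_zero hg hr hy
    have hweak := huw.integral_laplace (contDiff_bumpPot x r) hs
    have i1 : Integrable fun y => ((g.bumpDeriv x r y : ℝ) : ℂ) * dens u y :=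
      integrable_mul_dens hg u (continuous_bumpDeriv x r) fun y hy => bumpDeriv_eq_zero hg hr hy
    have i2 : Integrable fun y => ((g.laplace (g.bumpPot x r) y : ℝ) : ℂ) * dens u y :=
      integrable_mul_dens hg u (continuous_laplace (contDiff_bumpPot x r))
        fun y hy => laplace_bumpPot_eq_zero hg hr hy
    have i3 : Integrable fun y => (r : ℂ) * (((g.laplace (g.bumpPot x r) y : ℝ) : ℂ) * dens u y) :=
      i2.const_mul _
    -- Replace `bumpDeriv` by `r Δ_g bumpPot` up to the error of `exists_abs_laplace_sub_le`, and
    -- move `Δ_g` onto `u` by the weak equation.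
    have e1 : ∫ y, (g.bumpDeriv x r y : ℂ) * dens u y =
        -(∫ y, ((r * g.laplace (g.bumpPot x r) y - g.bumpDeriv x r y : ℝ) : ℂ) * dens u y) -
          r * ∫ y, (g.bumpPot x r y : ℂ) * dens w y := by
      have e2 : ∀ y, ((r * g.laplace (g.bumpPot x r) y - g.bumpDeriv x r y : ℝ) : ℂ) * dens u y =
          (r : ℂ) * (((g.laplace (g.bumpPot x r) y : ℝ) : ℂ) * dens u y) -
            (g.bumpDeriv x r y : ℂ) * dens u y := fun y => by push_cast; ring
      simp only [e2]
      rw [integral_sub i3 i1, integral_const_mul, hweak]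
      ring
    rw [e1]
    -- The volume of the support, of order `r^d`, cancels the factor `r^{-d}` in both terms, so the
    -- derivative stays bounded as `r → 0`.
    have hvol : volume.real (Metric.closedBall x (C * r)) = C ^ d * r ^ d * V := by
      rw [volume_real_closedBall x (by positivity), mul_pow]
    have n1 : ‖∫ y, ((r * g.laplace (g.bumpPot x r) y - g.bumpDeriv x r y : ℝ) : ℂ) * dens u y‖ ≤
        K * (r ^ d)⁻¹ * (C * M) * volume.real (Metric.closedBall x (C * r)) := by
      refine norm_integral_le_of_dist ?_ fun y hy => ?_
      · filter_upwards [hdu] with y hy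
        rw [norm_mul, Complex.norm_real]
        exact mul_le_mul (hKl x y r hr) hy (norm_nonneg _) (by positivity)
      · rw [laplace_bumpPot_eq_zero hg hr hy, bumpDeriv_eq_zero hg hr hy]; simp
    have n2 : ‖∫ y, (g.bumpPot x r y : ℂ) * dens w y‖ ≤
        (r ^ d)⁻¹ * (C * M) * volume.real (Metric.closedBall x (C * r)) := by
      refine norm_integral_le_of_dist ?_ fun y hy => ?_
      · filter_upwards [hdw] with y hy
        rw [norm_mul, Complex.norm_real]
        exact mul_le_mul (abs_bumpPot_le hg x y hr) hy (norm_nonneg _) (by positivity)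
      · rw [bumpPot_eq_zero hg hr hy]; simp
    rw [hvol] at n1 n2
    have hrd : 0 < r ^ d := by positivity
    have s1 : K * (r ^ d)⁻¹ * (C * M) * (C ^ d * r ^ d * V) = K * C * C ^ d * V * M := by field_simp
    have s2 : (r ^ d)⁻¹ * (C * M) * (C ^ d * r ^ d * V) = C * C ^ d * V * M := by field_simp
    rw [s1] at n1
    rw [s2] at n2
    refine (norm_sub_le _ _).trans ?_
    rw [norm_neg, norm_mul, Complex.norm_real, Real.norm_of_nonneg hr.le]
    have n3 := mul_le_mul hr1 n2 (norm_nonneg _) zero_le_one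
    nlinarith

lemma exists_norm_avg_sub_le (hg : g.Bounds C) : ∃ K : ℝ, 0 < K ∧ ∀ (u w : g.L2) (M : ℝ), 0 ≤ M →
    WeakEq u w → (∀ᵐ x ∂g.vol, ‖u x‖ ≤ M) → (∀ᵐ x ∂g.vol, ‖w x‖ ≤ M) → ∀ x,
    ∀ r ∈ Set.Ioc (0 : ℝ) 1, ∀ s ∈ Set.Ioc (0 : ℝ) 1, ‖avg u x r - avg u x s‖ ≤ K * M * |r - s| := by
  obtain ⟨K, hK, h⟩ := exists_hasDerivAt_avg hg
  refine ⟨K, hK, fun u w M hM huw hu hw x r hr s hs => ?_⟩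
  have h1 := h u w M hM huw hu hw x
  choose! v hv hvn using h1
  exact Convex.norm_image_sub_le_of_norm_hasDerivWithin_le (s := Set.Ioc (0 : ℝ) 1)
    (fun t ht => (hv t ht.1 ht.2).hasDerivWithinAt) (fun t ht => hvn t ht.1 ht.2)
    (convex_Ioc 0 1) hs hr

/-- The distance of two bump functions in `L¹`. -/
noncomputable def bumpDist (g : Metric d) (r : ℝ) (x x' : Space d) : ℝ :=
  ∫ y, |g.bump x' r y - g.bump x r y|

lemma tendsto_bumpDist (hg : g.Bounds C) {r : ℝ} (hr : 0 < r) (x : Space d) :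
    Tendsto (g.bumpDist r x) (𝓝 x) (𝓝 0) := by
  have h0 : ∫ y, |g.bump x r y - g.bump x r y| = 0 := by simp
  rw [← h0]
  refine tendsto_integral_filter_of_dominated_convergence
    ((Metric.closedBall x (C * r + 1)).indicator fun _ => (r ^ d)⁻¹ + (r ^ d)⁻¹)
    (Eventually.of_forall fun x' =>
      ((continuous_bump x' r).sub (continuous_bump x r)).abs.aestronglyMeasurable) ?_ ?_ ?_
  · filter_upwards [Metric.ball_mem_nhds x one_pos] with x' hx'
    refine Eventually.of_forall fun y => ?_
    rw [Real.norm_eq_abs, abs_abs, ← Real.norm_eq_abs]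
    by_cases hy : y ∈ Metric.closedBall x (C * r + 1)
    · rw [Set.indicator_of_mem hy]
      exact (norm_sub_le _ _).trans (add_le_add (abs_bump_le x' y hr) (abs_bump_le x y hr))
    · rw [Set.indicator_of_notMem hy]
      rw [Metric.mem_closedBall, not_le] at hy
      rw [Metric.mem_ball] at hx'
      rw [bump_eq_zero hg hr, bump_eq_zero hg hr, sub_zero, norm_zero]
      · linarith
      · linarith [dist_triangle y x' x]
  · exact (integrable_indicator_iff measurableSet_closedBall).2
      (integrableOn_const measure_closedBall_lt_top.ne)
  · refine Eventually.of_forall fun y => ?_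
    have hc : Continuous fun x' => g.bump x' r y :=
      continuous_const.mul (contDiff_profile.continuous.comp (continuous_const.mul
        (continuous_quad_uncurry.comp (continuous_id.prodMk (continuous_const.sub continuous_id)))))
    exact ((hc.sub continuous_const).abs).tendsto x

lemma norm_avg_sub_avg_le (hg : g.Bounds C) {u : g.L2} {M : ℝ} (hu : ∀ᵐ x ∂g.vol, ‖u x‖ ≤ M)
    {r : ℝ} (hr : 0 < r) (x x' : Space d) :
    ‖avg u x' r - avg u x r‖ ≤ C * M * g.bumpDist r x x' := by
  have i : ∀ x, Integrable fun y => (g.bump x r y : ℂ) * dens u y := fun x =>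
    integrable_mul_dens hg u (continuous_bump x r) fun y hy => bump_eq_zero hg hr hy
  have ib : ∀ x, Integrable (g.bump x r) := fun x =>
    (continuous_bump x r).integrable_of_hasCompactSupport
      (hasCompactSupport_of_dist fun y hy => bump_eq_zero hg hr hy)
  rw [avg, avg, ← integral_sub (i x') (i x), bumpDist, ← integral_const_mul]
  refine norm_integral_le_of_norm_le (((ib x').sub (ib x)).abs.const_mul _) ?_
  filter_upwards [norm_dens_le hg hu] with y hy
  rw [← sub_mul, ← Complex.ofReal_sub, norm_mul, Complex.norm_real, mul_comm]
  exact mul_le_mul_of_nonneg_right hy (abs_nonneg _)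

/-- The limits of the averages of a weak solution with bounded data. -/
lemma exists_limit_avg (hg : g.Bounds C) : ∃ K : ℝ, 0 < K ∧ ∀ (u w : g.L2) (M : ℝ), 0 ≤ M →
    WeakEq u w → (∀ᵐ x ∂g.vol, ‖u x‖ ≤ M) → (∀ᵐ x ∂g.vol, ‖w x‖ ≤ M) →
    ∃ V : Space d → ℂ, (∀ᵐ x, V x = g.bumpMass x * dens u x) ∧
      ∀ x, ∀ r ∈ Set.Ioc (0 : ℝ) 1, ‖avg u x r - V x‖ ≤ K * M * r := by
  obtain ⟨K, hK, h⟩ := exists_norm_avg_sub_le hg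
  refine ⟨K, hK, fun u w M hM huw hu hw => ?_⟩
  have hl := h u w M hM huw hu hw
  set ε : ℕ → ℝ := fun n => 1 / ((n : ℝ) + 1) with hε
  have hε0 : ∀ n, ε n ∈ Set.Ioc (0 : ℝ) 1 := fun n => by
    refine ⟨by simp only [hε]; positivity, ?_⟩
    simp only [hε]
    rw [div_le_one (by positivity)]
    linarith [Nat.cast_nonneg (α := ℝ) n]
  have hεl : Tendsto ε atTop (𝓝 0) := tendsto_one_div_add_atTop_nhds_zero_nat
  have hεt : Tendsto ε atTop (𝓝[>] 0) :=
    tendsto_nhdsWithin_iff.2 ⟨hεl, Eventually.of_forall fun n => (hε0 n).1⟩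
  have hcau : ∀ x, ∃ V, Tendsto (fun n => avg u x (ε n)) atTop (𝓝 V) := fun x => by
    refine cauchySeq_tendsto_of_complete (Metric.cauchySeq_iff.2 fun δ hδ => ?_)
    obtain ⟨N, hN⟩ := Metric.cauchySeq_iff.1 hεl.cauchySeq (δ / (K * M + 1)) (by positivity)
    refine ⟨N, fun m hm n hn => ?_⟩
    have h1 := hN m hm n hn
    rw [Real.dist_eq, lt_div_iff₀ (by positivity)] at h1
    rw [dist_eq_norm]
    refine (hl x _ (hε0 m) _ (hε0 n)).trans_lt ?_
    nlinarith [abs_nonneg (ε m - ε n)]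
  choose V hV using hcau
  refine ⟨V, ?_, fun x r hr => ?_⟩
  · have hC : 0 < C := by linarith [hg.one_le]
    filter_upwards [ae_tendsto_integral_kernel
      ((memLp_dens hg u).locallyIntegrable (by norm_num)) hC] with x hx
    have h1 := hx (fun r y => g.bump x r y) 1 (g.bumpMass x) (fun r _ => continuous_bump x r)
      (fun r hr y => by rw [one_mul]; exact abs_bump_le x y hr)
      (fun r hr y hy => bump_eq_zero hg hr hy) (fun r hr => integral_bump x hr)
    exact tendsto_nhds_unique (hV x) (h1.comp hεt)
  · have h1 : Tendsto (fun n => ‖avg u x r - avg u x (ε n)‖) atTop (𝓝 ‖avg u x r - V x‖) :=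
      ((hV x).const_sub _).norm
    have h2 : Tendsto (fun n => K * M * |r - ε n|) atTop (𝓝 (K * M * |r - 0|)) :=
      ((hεl.const_sub r).abs).const_mul _
    rw [sub_zero, abs_of_pos hr.1] at h2
    exact le_of_tendsto_of_tendsto' h1 h2 fun n => hl x r hr _ (hε0 n)

/-- Compare `V x'` and `V x` with the averages at a common scale `r`: the two limits cost `2 K M r`,
and moving the centre at fixed `r` costs `C M` times the `L¹` distance of the bumps. The
neighbourhoods depend on `x` and `ε` alone, not on the solution; the norm continuity of the
evaluation vectors rests on this. -/
lemma exists_equicontinuous_limit (hg : g.Bounds C) : ∃ N : Space d → ℝ → Set (Space d),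
    (∀ x ε, 0 < ε → N x ε ∈ 𝓝 x) ∧ ∀ (u w : g.L2) (M : ℝ), 0 ≤ M →
    WeakEq u w → (∀ᵐ x ∂g.vol, ‖u x‖ ≤ M) → (∀ᵐ x ∂g.vol, ‖w x‖ ≤ M) →
    ∃ V : Space d → ℂ, (∀ᵐ x, V x = g.bumpMass x * dens u x) ∧
      ∀ x ε, 0 < ε → ∀ x' ∈ N x ε, ‖V x' - V x‖ ≤ ε * M := by
  obtain ⟨K, hK, h⟩ := exists_limit_avg hg
  have hC : 0 < C := by linarith [hg.one_le]
  refine ⟨fun x ε => {x' | ∃ r ∈ Set.Ioc (0 : ℝ) 1, 2 * K * r + C * g.bumpDist r x x' ≤ ε},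
    fun x ε hε => ?_, fun u w M hM huw hu hw => ?_⟩
  · set r := min 1 (ε / (4 * K)) with hr
    have hr0 : 0 < r := lt_min one_pos (by positivity)
    have h1 : 2 * K * r ≤ ε / 2 := by
      calc 2 * K * r ≤ 2 * K * (ε / (4 * K)) := by gcongr; exact min_le_right _ _
        _ = ε / 2 := by field_simp; ring
    have h2 := (tendsto_bumpDist hg hr0 x).const_mul C
    rw [mul_zero] at h2
    filter_upwards [h2.eventually (gt_mem_nhds (half_pos hε))] with x' hx'
    exact ⟨r, ⟨hr0, min_le_left _ _⟩, by linarith⟩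
  · obtain ⟨V, hV, hVl⟩ := h u w M hM huw hu hw
    refine ⟨V, hV, fun x ε hε x' ⟨r, hr, hx'⟩ => ?_⟩
    have e : V x' - V x = (avg u x' r - avg u x r) - (avg u x' r - V x') + (avg u x r - V x) := by
      ring
    rw [e]
    refine (norm_add_le _ _).trans ?_
    have h1 := norm_sub_le (avg u x' r - avg u x r) (avg u x' r - V x')
    have h2 := norm_avg_sub_avg_le hg hu hr.1 x x'
    have h3 := hVl x r hr
    have h4 := hVl x' r hr
    have h5 := mul_le_mul_of_nonneg_right hx' hM
    linarith

/-- The density of the averages with respect to `u`. -/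
noncomputable def weight (g : Metric d) (x : Space d) : ℝ := g.bumpMass x * g.density x

lemma weight_pos (hg : g.Bounds C) (x : Space d) : 0 < g.weight x :=
  mul_pos (bumpMass_pos hg x) (g.density_pos x)

lemma continuous_weight (hg : g.Bounds C) : Continuous g.weight :=
  (continuous_bumpMass hg).mul g.contDiff_density.continuous

lemma forall_norm_le_of_ae {W : Space d → ℂ} (hW : Continuous W) {M : ℝ}
    (h : ∀ᵐ x, ‖W x‖ ≤ M) (x : Space d) : ‖W x‖ ≤ M := by
  by_contra hx
  have ho : IsOpen {x | M < ‖W x‖} := isOpen_lt continuous_const hW.norm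
  have h0 : volume {x | M < ‖W x‖} = 0 := by simpa [ae_iff] using h
  have := ho.eq_empty_of_measure_zero h0
  exact (Set.eq_empty_iff_forall_notMem.1 this x) (not_le.1 hx)

/-- Weak solutions with bounded data have continuous representatives, which are equicontinuous. -/
theorem exists_continuous_representative (hg : g.Bounds C) : ∃ N : Space d → ℝ → Set (Space d),
    (∀ x ε, 0 < ε → N x ε ∈ 𝓝 x) ∧ ∀ (u w : g.L2) (M : ℝ), 0 ≤ M →
    WeakEq u w → (∀ᵐ x ∂g.vol, ‖u x‖ ≤ M) → (∀ᵐ x ∂g.vol, ‖w x‖ ≤ M) →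
    ∃ W : Space d → ℂ, Continuous W ∧ W =ᵐ[g.vol] u ∧ (∀ x, ‖W x‖ ≤ M) ∧
      ∀ x ε, 0 < ε → ∀ x' ∈ N x ε, ‖W x' - W x‖ ≤ ε * M := by
  obtain ⟨N, hN, h⟩ := exists_equicontinuous_limit hg
  -- The representative is `V / weight`. Half of `ε` pays for the variation of `V`, the other half
  -- for the relative variation of the weight.
  refine ⟨fun x ε => N x (ε / 2 * g.weight x) ∩ {x' | |1 - g.weight x' / g.weight x| < ε / 2},
    fun x ε hε => inter_mem (hN x _ (mul_pos (half_pos hε) (weight_pos hg x))) ?_,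
    fun u w M hM huw hu hw => ?_⟩
  · have hc : ContinuousAt (fun x' => |1 - g.weight x' / g.weight x|) x :=
      (continuous_const.sub ((continuous_weight hg).div_const _)).abs.continuousAt
    refine hc.eventually (gt_mem_nhds ?_)
    change |1 - g.weight x / g.weight x| < ε / 2
    rw [div_self (weight_pos hg x).ne', sub_self, abs_zero]
    exact half_pos hε
  · obtain ⟨V, hV, hVN⟩ := h u w M hM huw hu hw
    have hVc : Continuous V := by
      refine continuous_iff_continuousAt.2 fun x => Metric.tendsto_nhds.2 fun ε hε => ?_
      filter_upwards [hN x (ε / (M + 1)) (by positivity)] with x' hx'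
      rw [dist_eq_norm]
      refine (hVN x _ (by positivity) x' hx').trans_lt ?_
      rw [div_mul_eq_mul_div, div_lt_iff₀ (by positivity)]
      nlinarith
    have hw0 : ∀ x, (g.weight x : ℂ) ≠ 0 := fun x =>
      Complex.ofReal_ne_zero.2 (weight_pos hg x).ne'
    have hWc : Continuous fun x => V x / g.weight x :=
      hVc.div₀ (Complex.continuous_ofReal.comp (continuous_weight hg)) hw0
    have hWu : ∀ᵐ x, V x / g.weight x = u x := by
      filter_upwards [hV] with x hx
      rw [hx, div_eq_iff (hw0 x), dens, weight]
      push_cast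
      ring
    have hWM := forall_norm_le_of_ae hWc (M := M) (by
      filter_upwards [hWu, g.volume_absolutelyContinuous_vol.ae_le hu] with x h1 h2
      rwa [h1])
    refine ⟨_, hWc, vol_absolutelyContinuous.ae_le hWu, hWM, fun x ε hε x' ⟨h1, h2⟩ => ?_⟩
    have hm := weight_pos hg x
    have e : V x' / g.weight x' - V x / g.weight x =
        V x' / g.weight x' * ((1 - g.weight x' / g.weight x : ℝ) : ℂ) +
          (V x' - V x) / g.weight x := by
      have := hw0 x
      have := hw0 x'
      push_cast
      field_simp
      ring
    rw [e]
    refine (norm_add_le _ _).trans ?_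
    rw [norm_mul, norm_div _ (g.weight x : ℂ), Complex.norm_real, Complex.norm_real,
      Real.norm_of_nonneg hm.le]
    have h3 : ‖V x' - V x‖ / g.weight x ≤ ε / 2 * M := by
      rw [div_le_iff₀ hm]
      have := hVN x _ (mul_pos (half_pos hε) hm) x' h1
      linarith
    have h4 := mul_le_mul (hWM x') (le_of_lt h2) (abs_nonneg _) hM
    rw [Real.norm_eq_abs]
    linarith

end Metric
end HeatKernel

/-! ### Evaluation vectors of the heat semigroup -/

namespace HeatKernel

local notation "⟪" x ", " y "⟫" => inner ℂ x y
open ComplexConjugate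

namespace Metric

variable {d : ℕ} {g : Metric d} {C : ℝ}

/-- A bound for the pairings of `w` with functions supported in `U`, in terms of their `L¹` norm,
bounds `w` on `U`. -/
lemma ae_norm_le_of_inner {w : g.L2} {U : Set (Space d)} (hU : MeasurableSet U) {M : ℝ} (hM : 0 ≤ M)
    (h : ∀ f : g.L2, (∀ᵐ x ∂g.vol, x ∉ U → f x = 0) → ∀ L : ℝ, 0 < L →
      ∫⁻ x, ‖f x‖ₑ ∂g.vol ≤ ENNReal.ofReal L → ‖⟪f, w⟫‖ ≤ M * L) :
    ∀ᵐ x ∂g.vol, x ∈ U → ‖w x‖ ≤ M := by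
  have hw : Measurable w := (Lp.stronglyMeasurable w).measurable
  -- Test with `w` itself, cut to the part of `{M < ‖w‖}` in `U` and in a ball of radius `n`. The
  -- hypothesis gives `∫ |w|² ≤ M ∫ |w|` over this set, which forces it to be null; the ball makes
  -- the integrals finite.
  have key : ∀ n : ℕ, ∀ᵐ x ∂g.vol, x ∉ U ∩ {x | M < ‖w x‖} ∩ Metric.ball 0 n := fun n => by
    set S := U ∩ {x | M < ‖w x‖} ∩ Metric.ball (0 : Space d) n with hS
    have hSm : MeasurableSet S :=
      (hU.inter (measurableSet_lt measurable_const hw.norm)).inter measurableSet_ball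
    have hfin : g.vol S < ⊤ := (measure_mono Set.inter_subset_right).trans_lt measure_ball_lt_top
    have hcut := cut_ae hSm w
    have i1 : Integrable (fun x => S.indicator (fun x => ‖w x‖) x) g.vol := by
      refine (integrable_indicator_iff hSm).2 ?_
      have : IsFiniteMeasure (g.vol.restrict S) := ⟨by simpa using hfin⟩
      exact (((Lp.memLp w).restrict S).integrable (by norm_num)).norm
    have i2 : Integrable (fun x => S.indicator (fun x => ‖w x‖ ^ 2) x) g.vol :=
      ((Lp.memLp w).integrable_norm_pow (p := 2) (by norm_num)).indicator hSm
    set J := ∫ x, S.indicator (fun x => ‖w x‖) x ∂g.vol with hJ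
    have hJ0 : 0 ≤ J := integral_nonneg fun x => Set.indicator_nonneg (fun _ _ => norm_nonneg _) x
    have e1 : ‖g.cut hSm w‖ ^ 2 = ∫ x, S.indicator (fun x => ‖w x‖ ^ 2) x ∂g.vol := by
      rw [norm_sq_eq_integral]
      refine integral_congr_ae ?_
      filter_upwards [hcut] with x hx
      rw [hx]
      by_cases hxS : x ∈ S <;> simp [hxS]
    have e2 : ∫⁻ x, ‖g.cut hSm w x‖ₑ ∂g.vol = ENNReal.ofReal J := by
      rw [hJ, ofReal_integral_eq_lintegral_ofReal i1
        (Eventually.of_forall fun x => Set.indicator_nonneg (fun _ _ => norm_nonneg _) x)]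
      refine lintegral_congr_ae ?_
      filter_upwards [hcut] with x hx
      rw [hx]
      by_cases hxS : x ∈ S <;> simp [hxS]
    have e3 : ‖g.cut hSm w‖ ^ 2 ≤ M * J := by
      -- The hypothesis requires `L > 0`, whereas `J` may vanish; hence the small increment.
      refine le_of_forall_pos_le_add fun η hη => ?_
      have hp : 0 < J + η / (M + 1) := by positivity
      have := h (g.cut hSm w) (by
        filter_upwards [cut_vanish hSm w] with x hx hxU
        exact hx fun hxS => hxU hxS.1.1) _ hp (e2.le.trans (ENNReal.ofReal_le_ofReal (by
          have : 0 ≤ η / (M + 1) := by positivity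
          linarith)))
      rw [inner_cut_self, norm_pow, Complex.norm_real, norm_norm] at this
      have h2 : M * (η / (M + 1)) ≤ η := by
        rw [mul_div_assoc', div_le_iff₀ (by positivity)]
        nlinarith
      linarith
    have hF0 : ∀ x, 0 ≤ S.indicator (fun x => ‖w x‖ ^ 2) x - M * S.indicator (fun x => ‖w x‖) x := by
      intro x
      by_cases hxS : x ∈ S
      · have h1 : M < ‖w x‖ := hxS.1.2
        simp only [Set.indicator_of_mem hxS]
        nlinarith
      · simp [hxS]
    have hF : ∫ x, (S.indicator (fun x => ‖w x‖ ^ 2) x - M * S.indicator (fun x => ‖w x‖) x) ∂g.vol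
        = 0 := by
      refine le_antisymm ?_ (integral_nonneg hF0)
      rw [integral_sub i2 (i1.const_mul M), integral_const_mul, ← e1]
      linarith
    have := (integral_eq_zero_iff_of_nonneg_ae (Eventually.of_forall hF0)
      (i2.sub (i1.const_mul M))).1 hF
    filter_upwards [this] with x hx hxS
    have h1 : M < ‖w x‖ := hxS.1.2
    simp only [Set.indicator_of_mem hxS, Pi.zero_apply] at hx
    nlinarith
  filter_upwards [ae_all_iff.2 key] with x hx hxU
  by_contra hn
  obtain ⟨n, hn'⟩ := exists_nat_gt ‖x‖
  exact hx n ⟨⟨hxU, not_le.1 hn⟩, by simpa using hn'⟩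

lemma norm_le_of_ae_of_isOpen {W : Space d → ℂ} (hW : Continuous W) {U : Set (Space d)}
    (hU : IsOpen U) {M : ℝ} (h : ∀ᵐ x ∂g.vol, x ∈ U → ‖W x‖ ≤ M) {x : Space d} (hx : x ∈ U) :
    ‖W x‖ ≤ M := by
  by_contra hn
  have ho : IsOpen (U ∩ {x | M < ‖W x‖}) := hU.inter (isOpen_lt continuous_const hW.norm)
  have h1 := g.volume_absolutelyContinuous_vol.ae_le h
  have h0 : volume (U ∩ {x | M < ‖W x‖}) = 0 := by
    refine measure_mono_null (fun y hy => ?_) (ae_iff.1 h1)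
    intro h2
    exact not_le.2 hy.2 (h2 hy.1)
  exact (Set.eq_empty_iff_forall_notMem.1 (ho.eq_empty_of_measure_zero h0) x) ⟨hx, not_le.1 hn⟩

lemma eq_of_ae_eq_vol {V W : Space d → ℂ} (hV : Continuous V) (hW : Continuous W)
    (h : V =ᵐ[g.vol] W) : V = W :=
  (hV.ae_eq_iff_eq volume hW).1 (g.volume_absolutelyContinuous_vol.ae_le h)

lemma inner_conjL (u v : g.L2) : ⟪g.conjL u, g.conjL v⟫ = conj ⟪u, v⟫ := by
  rw [L2.inner_def, L2.inner_def, ← integral_conj]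
  refine integral_congr_ae ?_
  filter_upwards [conjL_ae u, conjL_ae v] with x h1 h2
  rw [h1, h2]
  simp [RCLike.inner_apply]

lemma conjL_conjL (u : g.L2) : g.conjL (g.conjL u) = u := by
  refine Lp.ext ?_
  filter_upwards [conjL_ae u, conjL_ae (g.conjL u)] with x h1 h2
  rw [h2, h1, Complex.conj_conj]

end Metric

namespace IsHeatFlow

variable {d : ℕ} {g : Metric d} {T : ℝ → g.L2 →L[ℂ] g.L2}

/-- Vectors `k x` such that `T t u` is represented by `x ↦ ⟪k x, u⟫`. -/
structure IsEvaluation (g : Metric d) (S : g.L2 →L[ℂ] g.L2) (k : Space d → g.L2) : Prop where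
  continuous : Continuous k
  apply_ae : ∀ u, (fun x => ⟪k x, u⟫) =ᵐ[g.vol] S u

lemma IsEvaluation.continuous_inner {S : g.L2 →L[ℂ] g.L2} {k : Space d → g.L2}
    (hk : IsEvaluation g S k) (u : g.L2) : Continuous fun x => ⟪k x, u⟫ :=
  hk.continuous.inner continuous_const

/-- Write `T t = T (t/2) T (t/2)`. The dual of the Nash bound makes `T t u` bounded, and likewise `P
T t u = T (t/2) D u`, where `D = P T (t/2)` is bounded by smoothing. So `T t u` has a continuous
representative controlled by `‖u‖`, and the Riesz theorem represents its value at `x`. -/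
lemma exists_isEvaluation (hd : 2 ≤ d) {C : ℝ} (hg : g.Bounds C) (hT : IsHeatFlow g T) {t : ℝ}
    (ht : 0 < t) : ∃ k, IsEvaluation g (T t) k := by
  obtain ⟨A, hA, hAL⟩ := hT.exists_norm_le_lintegral hd hg
  have hsup : ∀ s, 0 < s → ∀ u : g.L2, ∀ᵐ x ∂g.vol, ‖T s u x‖ ≤ A * s ^ (-(d : ℝ) / 4) * ‖u‖ := by
    intro s hs u
    have := Metric.ae_norm_le_of_inner (w := T s u) MeasurableSet.univ
      (M := A * s ^ (-(d : ℝ) / 4) * ‖u‖) (by positivity) fun f _ L hL hfL => by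
        rw [← hT.symm]
        refine (norm_inner_le_norm _ _).trans ?_
        have := mul_le_mul_of_nonneg_right (hAL s hs f L hL hfL) (norm_nonneg u)
        linarith
    filter_upwards [this] with x hx using hx trivial
  obtain ⟨N, hN, hrep⟩ := Metric.exists_continuous_representative hg
  obtain ⟨D, hD⟩ := hT.smoothing (t / 2) (half_pos ht)
  set B := A * (t / 2) ^ (-(d : ℝ) / 4) with hB
  have hB0 : 0 < B := by positivity
  set M := B * (1 + ‖D‖) with hM
  have hM0 : 0 < M := by positivity
  have hBM : B ≤ M := le_mul_of_one_le_right hB0.le (by linarith [norm_nonneg D])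
  have hadd : ∀ u, T t u = T (t / 2) (T (t / 2) u) := fun u => by
    rw [← hT.add_apply (half_pos ht).le (half_pos ht).le, add_halves]
  have h1 : ∀ u : g.L2, ∃ W : Space d → ℂ, Continuous W ∧ W =ᵐ[g.vol] T t u ∧
      (∀ x, ‖W x‖ ≤ M * ‖u‖) ∧
      ∀ x ε, 0 < ε → ∀ x' ∈ N x ε, ‖W x' - W x‖ ≤ ε * (M * ‖u‖) := fun u => by
    refine hrep (T t u) (T (t / 2) (D u)) (M * ‖u‖) (by positivity) ?_ ?_ ?_
    · have := hT.map_graph (t / 2) _ (hD u)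
      rw [← hadd] at this
      exact Metric.weakEq_of_mem_graph this
    · filter_upwards [hsup (t / 2) (half_pos ht) (T (t / 2) u)] with x hx
      rw [hadd]
      refine hx.trans (mul_le_mul hBM (hT.norm_le _ u) (norm_nonneg _) hM0.le)
    · filter_upwards [hsup (t / 2) (half_pos ht) (D u)] with x hx
      refine hx.trans ?_
      rw [hM, mul_assoc B]
      refine mul_le_mul_of_nonneg_left ((D.le_opNorm u).trans ?_) hB0.le
      nlinarith [norm_nonneg u]
  choose W hWc hWu hWM hWN using h1
  have hWadd : ∀ u v, W (u + v) = fun x => W u x + W v x := fun u v => by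
    refine Metric.eq_of_ae_eq_vol (g := g) (hWc _) ((hWc u).add (hWc v)) ?_
    filter_upwards [hWu (u + v), hWu u, hWu v, Lp.coeFn_add (T t u) (T t v)] with x a1 a2 a3 a4
    rw [a1, a2, a3, map_add, a4, Pi.add_apply]
  have hWsmul : ∀ (c : ℂ) u, W (c • u) = fun x => c • W u x := fun c u => by
    refine Metric.eq_of_ae_eq_vol (g := g) (hWc _) ((hWc u).const_smul c) ?_
    filter_upwards [hWu (c • u), hWu u, Lp.coeFn_smul c (T t u)] with x a1 a2 a3
    rw [a1, a2, map_smul, a3, Pi.smul_apply]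
  let ev : Space d → g.L2 →L[ℂ] ℂ := fun x => LinearMap.mkContinuous
    { toFun := fun u => W u x
      map_add' := fun u v => congrFun (hWadd u v) x
      map_smul' := fun c u => congrFun (hWsmul c u) x } M fun u => hWM u x
  let k : Space d → g.L2 := fun x => (InnerProductSpace.toDual ℂ g.L2).symm (ev x)
  have hk : ∀ x u, ⟪k x, u⟫ = W u x := fun x u =>
    InnerProductSpace.toDual_symm_apply
  refine ⟨k, ?_, fun u => ?_⟩
  · refine continuous_iff_continuousAt.2 fun x => Metric.tendsto_nhds.2 fun ε hε => ?_
    filter_upwards [hN x (ε / (2 * M)) (by positivity)] with x' hx'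
    rw [dist_eq_norm]
    -- The modulus of continuity is uniform in `u`, so it applies to `u = k x' - k x`, where the
    -- increment of the representative is `‖k x' - k x‖²`.
    have h2 := hWN (k x' - k x) x (ε / (2 * M)) (by positivity) x' hx'
    rw [← hk, ← hk, ← inner_sub_left, inner_self_eq_norm_sq_to_K] at h2
    have e : ‖((‖k x' - k x‖ : ℝ) : ℂ) ^ 2‖ = ‖k x' - k x‖ ^ 2 := by
      rw [norm_pow, Complex.norm_real, norm_norm]
    erw [e] at h2
    have e3 : ε / (2 * M) * (M * ‖k x' - k x‖) = ε / 2 * ‖k x' - k x‖ := by field_simp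
    rw [e3] at h2
    by_contra hn
    rw [not_lt] at hn
    have : 0 < ‖k x' - k x‖ := hε.trans_le hn
    nlinarith
  · filter_upwards [hWu u] with x hx
    rw [hk, hx]

lemma IsEvaluation.conjL_eq (hT : IsHeatFlow g T) {t : ℝ} (ht : 0 < t) {k : Space d → g.L2}
    (hk : IsEvaluation g (T t) k) (x : Space d) : g.conjL (k x) = k x := by
  refine ext_inner_right ℂ fun u => ?_
  have h1 : (fun x => conj ⟪k x, g.conjL u⟫) = fun x => ⟪k x, u⟫ := by
    refine Metric.eq_of_ae_eq_vol (g := g) (Complex.continuous_conj.comp (hk.continuous_inner _))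
      (hk.continuous_inner _) ?_
    filter_upwards [hk.apply_ae u, hk.apply_ae (g.conjL u), Metric.conjL_ae (T t u)] with x a1 a2 a3
    rw [a1, a2, hT.map_conj t ht, a3, Complex.conj_conj]
  have h2 := Metric.inner_conjL (k x) (g.conjL u)
  rw [Metric.conjL_conjL] at h2
  rw [h2]
  exact congrFun h1 x

/-- Bounds for the evaluation vectors, and for their restrictions to half-spaces. -/
lemma exists_norm_cut_evaluation_le (hd : 2 ≤ d) {C : ℝ} (hg : g.Bounds C) (hT : IsHeatFlow g T) :
    ∃ A c : ℝ, 0 < A ∧ 0 < c ∧ ∀ t, 0 < t → ∀ k, IsEvaluation g (T t) k →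
      (∀ x, ‖k x‖ ≤ A * t ^ (-(d : ℝ) / 4)) ∧
      ∀ e : Space d, ‖e‖ = 1 → ∀ (x : Space d) (R : ℝ), inner ℝ e x < R →
      ∀ (S : Set (Space d)) (hS : MeasurableSet S), (∀ y ∈ S, R ≤ inner ℝ e y) →
      ‖g.cut hS (k x)‖ ≤
        A * t ^ (-(d : ℝ) / 4) * Real.exp (-(c * ((R - inner ℝ e x) ^ 2 / t))) := by
  obtain ⟨A₁, hA₁, hAL⟩ := hT.exists_norm_le_lintegral hd hg
  obtain ⟨A₂, c, hA₂, hc, hGL⟩ := hT.exists_norm_inner_le hd hg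
  refine ⟨max A₁ A₂, c / 4, lt_max_of_lt_left hA₁, by positivity, fun t ht k hk =>
    ⟨fun x => ?_, fun e he x R hxR S hS hSR => ?_⟩⟩
  · have h1 : ∀ᵐ y ∂g.vol, y ∈ (Set.univ : Set (Space d)) →
        ‖T t (k x) y‖ ≤ A₁ * t ^ (-(d : ℝ) / 4) * ‖k x‖ :=
      Metric.ae_norm_le_of_inner MeasurableSet.univ (by positivity) fun f _ L hL hfL => by
        rw [← hT.symm]
        refine (norm_inner_le_norm _ _).trans ?_
        have := mul_le_mul_of_nonneg_right (hAL t ht f L hL hfL) (norm_nonneg (k x))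
        linarith
    -- `‖k x‖²` is the value of `T t (k x)` at `x`; the bound from `L²` to `L^∞` makes it at most
    -- `A₁ t^{-d/4} ‖k x‖`.
    have h2 : ‖⟪k x, k x⟫‖ ≤ A₁ * t ^ (-(d : ℝ) / 4) * ‖k x‖ := by
      refine Metric.norm_le_of_ae_of_isOpen (g := g) (W := fun y => ⟪k y, k x⟫)
        (hk.continuous_inner _) isOpen_univ ?_ (Set.mem_univ x)
      filter_upwards [h1, hk.apply_ae (k x)] with y a1 a2
      rw [a2]; exact a1
    rw [inner_self_eq_norm_sq_to_K] at h2
    have e : ‖((‖k x‖ : ℝ) : ℂ) ^ 2‖ = ‖k x‖ ^ 2 := by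
      rw [norm_pow, Complex.norm_real, norm_norm]
    erw [e] at h2
    rcases (norm_nonneg (k x)).eq_or_lt with h0 | h0
    · rw [← h0]; positivity
    · have h3 : ‖k x‖ ≤ A₁ * t ^ (-(d : ℝ) / 4) := by
        rw [pow_two] at h2
        exact le_of_mul_le_mul_right h2 h0
      exact h3.trans (mul_le_mul_of_nonneg_right (le_max_left _ _) (by positivity))
  · set h := g.cut hS (k x) with hh
    set s := inner ℝ e x with hs
    -- The pairing bound controls `T t h` only almost everywhere, so an open half-space around `x`
    -- is needed. Stopping midway leaves it at distance `(R - s)/2` from `S`, which turns `c` into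
    -- `c/4`.
    set r := (s + R) / 2 with hr
    set δ := R - r with hδ
    have hδ0 : 0 < δ := by simp only [hδ, hr]; linarith
    set F := A₂ * t ^ (-(d : ℝ) / 4) * Real.exp (-(c * (δ ^ 2 / t))) with hF
    have hcont : Continuous fun y : Space d => (inner ℝ e y : ℝ) :=
      continuous_const.inner continuous_id
    have hUo : IsOpen {y : Space d | inner ℝ e y < r} := isOpen_lt hcont continuous_const
    have h1 : ∀ᵐ y ∂g.vol, y ∈ {y : Space d | inner ℝ e y < r} → ‖T t h y‖ ≤ F * ‖h‖ := by
      refine Metric.ae_norm_le_of_inner hUo.measurableSet (by positivity) fun f hf L hL hfL => ?_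
      rw [← hT.symm, ← inner_conj_symm, Complex.norm_conj]
      refine (hGL e he r δ hδ0 t ht f h L hL hfL ?_ ?_).trans_eq (by ring)
      · filter_upwards [hf] with y hy hry
        exact hy (not_lt.2 hry.le)
      · filter_upwards [Metric.cut_vanish hS (k x)] with y hy hry
        refine hy fun hyS => ?_
        have := hSR y hyS
        simp only [hδ] at hry
        linarith
    have h2 : ‖⟪k x, h⟫‖ ≤ F * ‖h‖ := by
      refine Metric.norm_le_of_ae_of_isOpen (g := g) (W := fun y => ⟪k y, h⟫)
        (hk.continuous_inner _) hUo ?_ (show s < r by simp only [hr]; linarith)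
      filter_upwards [h1, hk.apply_ae h] with y a1 a2 hy
      rw [a2]; exact a1 hy
    rw [← inner_conj_symm, Complex.norm_conj, hh, Metric.inner_cut_self, norm_pow,
      Complex.norm_real, norm_norm, ← hh] at h2
    have h3 : ‖h‖ ≤ F := by
      rcases (norm_nonneg h).eq_or_lt with h0 | h0
      · rw [← h0]; positivity
      · rw [pow_two] at h2
        exact le_of_mul_le_mul_right h2 h0
    refine h3.trans ?_
    have e1 : c * (δ ^ 2 / t) = c / 4 * ((R - s) ^ 2 / t) := by
      simp only [hδ, hr]; ring
    rw [hF, e1]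
    gcongr
    exact le_max_right _ _

/-- The bisecting hyperplane of the segment from `x` to `y` separates the points: `k x` is small on
the side of `y`, and `k y` on the side of `x`, each at distance `‖x - y‖/2`. On either side one
factor is small and the other is at most `A t^{-d/4}`. -/
lemma exists_norm_inner_evaluation_le (hd : 2 ≤ d) {C : ℝ} (hg : g.Bounds C) (hT : IsHeatFlow g T) :
    ∃ A c : ℝ, 0 < A ∧ 0 < c ∧ ∀ t, 0 < t → ∀ k, IsEvaluation g (T t) k → ∀ x y,
      ‖⟪k x, k y⟫‖ ≤ A * t ^ (-(d : ℝ) / 2) * Real.exp (-(c * (‖x - y‖ ^ 2 / t))) := by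
  obtain ⟨A, c, hA, hc, h⟩ := hT.exists_norm_cut_evaluation_le hd hg
  refine ⟨2 * A ^ 2, c / 4, by positivity, by positivity, fun t ht k hk x y => ?_⟩
  obtain ⟨h1, h2⟩ := h t ht k hk
  set B := A * t ^ (-(d : ℝ) / 4) with hB
  have hB0 : 0 < B := by positivity
  have hBB : 2 * A ^ 2 * t ^ (-(d : ℝ) / 2) = 2 * (B * B) := by
    have : t ^ (-(d : ℝ) / 2) = t ^ (-(d : ℝ) / 4) * t ^ (-(d : ℝ) / 4) := by
      rw [← Real.rpow_add ht]; ring_nf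
    rw [this]; ring
  rw [hBB]
  rcases eq_or_ne x y with rfl | hxy
  · simp only [sub_self, norm_zero, ne_eq, OfNat.ofNat_ne_zero, not_false_eq_true, zero_pow,
      zero_div, mul_zero, neg_zero, Real.exp_zero, mul_one]
    refine (norm_inner_le_norm _ _).trans ?_
    have := mul_le_mul (h1 x) (h1 x) (norm_nonneg _) hB0.le
    have : 0 < B * B := by positivity
    linarith
  · have hn : 0 < ‖y - x‖ := norm_pos_iff.2 (sub_ne_zero.2 hxy.symm)
    set e : Space d := ‖y - x‖⁻¹ • (y - x) with he
    have he1 : ‖e‖ = 1 := by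
      rw [he, norm_smul, norm_inv, norm_norm, inv_mul_cancel₀ hn.ne']
    have hexy : (inner ℝ e y : ℝ) - inner ℝ e x = ‖y - x‖ := by
      rw [← inner_sub_right, he, real_inner_smul_left, real_inner_self_eq_norm_sq]
      field_simp
    set R : ℝ := (inner ℝ e x + inner ℝ e y) / 2 with hR
    have hcont : Continuous fun y : Space d => (inner ℝ e y : ℝ) :=
      continuous_const.inner continuous_id
    have hS : MeasurableSet {z : Space d | R ≤ inner ℝ e z} :=
      (isClosed_le continuous_const hcont).measurableSet
    have hS' : MeasurableSet {z : Space d | inner ℝ e z ≤ R} :=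
      (isClosed_le hcont continuous_const).measurableSet
    set X := Real.exp (-(c / 4 * (‖x - y‖ ^ 2 / t))) with hX
    have b1 : ‖g.cut hS (k x)‖ ≤ B * X := by
      refine (h2 e he1 x R (by linarith) _ hS fun z hz => hz).trans_eq ?_
      have : R - inner ℝ e x = ‖x - y‖ / 2 := by rw [norm_sub_rev, ← hexy, hR]; ring
      rw [this, hX]; congr 3; ring
    have b2 : ‖g.cut hS' (k y)‖ ≤ B * X := by
      have := h2 (-e) (by rwa [norm_neg]) y (-R) (by rw [inner_neg_left]; linarith) _ hS'
        fun z hz => by rw [inner_neg_left]; exact neg_le_neg hz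
      refine this.trans_eq ?_
      have : -R - inner ℝ (-e) y = ‖x - y‖ / 2 := by
        rw [norm_sub_rev, ← hexy, hR, inner_neg_left]; ring
      rw [this, hX]; congr 3; ring
    have hz : ⟪k x - g.cut hS (k x), k y - g.cut hS' (k y)⟫ = 0 := by
      refine Metric.inner_eq_zero_of_vanish (Metric.sub_cut_vanish hS (k x)) ?_
      filter_upwards [Metric.sub_cut_vanish hS' (k y)] with z hz hzS
      exact hz (not_le.1 hzS).le
    -- The fourth term of the expansion vanishes because the two remainders have disjoint supports.
    have hsplit : ⟪k x, k y⟫ = ⟪g.cut hS (k x), k y⟫ + ⟪k x - g.cut hS (k x), g.cut hS' (k y)⟫ := by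
      rw [inner_sub_right, sub_eq_zero] at hz
      rw [← hz, inner_sub_left, add_sub_cancel]
    rw [hsplit]
    refine (norm_add_le _ _).trans ?_
    have n1 := (norm_inner_le_norm (𝕜 := ℂ) (g.cut hS (k x)) (k y)).trans
      (mul_le_mul b1 (h1 y) (norm_nonneg _) (by positivity))
    have n2 := (norm_inner_le_norm (𝕜 := ℂ) (k x - g.cut hS (k x)) (g.cut hS' (k y))).trans
      (mul_le_mul ((Metric.norm_sub_cut_le hS (k x)).trans (h1 x)) b2 (norm_nonneg _) hB0.le)
    linarith

end IsHeatFlow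
end HeatKernel

/-! ### The heat kernel -/

namespace HeatKernel

/-- A bounded continuous kernel defines an operator from `L¹` to `L^∞`. -/
lemma exists_integralOperator {d : ℕ} {K : Space d → Space d → ℝ}
    (hK : Continuous fun p : Space d × Space d => K p.1 p.2) {B : ℝ} (hB : ∀ x y, |K x y| ≤ B) :
    ∃ S : Lp ℂ 1 (volume : Measure (Space d)) →L[ℂ] Lp ℂ ⊤ (volume : Measure (Space d)),
      (∀ v, S v =ᵐ[volume] fun x => ∫ y, (K x y : ℂ) * v y) ∧ ‖S‖ ≤ B := by
  have hB0 : 0 ≤ B := (abs_nonneg _).trans (hB 0 0)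
  have hb : ∀ x y (z : ℂ), ‖(K x y : ℂ) * z‖ ≤ B * ‖z‖ := fun x y z => by
    rw [norm_mul, Complex.norm_real]
    exact mul_le_mul_of_nonneg_right (hB x y) (norm_nonneg _)
  have hm : ∀ (v : Lp ℂ 1 (volume : Measure (Space d))) (x : Space d),
      AEStronglyMeasurable (fun y => (K x y : ℂ) * v y) volume := fun v x =>
    (Complex.continuous_ofReal.comp (hK.comp (continuous_const.prodMk
      continuous_id))).aestronglyMeasurable.mul (Lp.aestronglyMeasurable v)
  have hi : ∀ (v : Lp ℂ 1 (volume : Measure (Space d))) (x : Space d),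
      Integrable (fun y => (K x y : ℂ) * v y) volume := fun v x =>
    ((L1.integrable_coeFn v).norm.const_mul B).mono' (hm v x) (Eventually.of_forall fun y => hb x y _)
  have hc : ∀ v : Lp ℂ 1 (volume : Measure (Space d)),
      Continuous fun x => ∫ y, (K x y : ℂ) * v y := fun v =>
    continuous_of_dominated (hm v) (fun x => Eventually.of_forall fun y => hb x y _)
      ((L1.integrable_coeFn v).norm.const_mul B) (Eventually.of_forall fun y =>
        (Complex.continuous_ofReal.comp (hK.comp (continuous_id.prodMk
          continuous_const))).mul continuous_const)
  have hle : ∀ (v : Lp ℂ 1 (volume : Measure (Space d))) x,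
      ‖∫ y, (K x y : ℂ) * v y‖ ≤ B * ‖v‖ := fun v x => by
    rw [L1.norm_eq_integral_norm, ← integral_const_mul]
    exact norm_integral_le_of_norm_le ((L1.integrable_coeFn v).norm.const_mul B)
      (Eventually.of_forall fun y => hb x y _)
  have hmem : ∀ v : Lp ℂ 1 (volume : Measure (Space d)),
      MemLp (fun x => ∫ y, (K x y : ℂ) * v y) ⊤ volume := fun v =>
    memLp_top_of_bound (hc v).aestronglyMeasurable _ (Eventually.of_forall (hle v))
  let S : Lp ℂ 1 (volume : Measure (Space d)) →ₗ[ℂ] Lp ℂ ⊤ (volume : Measure (Space d)) :=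
    { toFun := fun v => (hmem v).toLp
      map_add' := fun v w => by
        rw [← MemLp.toLp_add]
        refine MemLp.toLp_congr _ _ (Eventually.of_forall fun x => ?_)
        simp only [Pi.add_apply]
        rw [← integral_add (hi v x) (hi w x)]
        refine integral_congr_ae ?_
        filter_upwards [Lp.coeFn_add v w] with y hy
        rw [hy, Pi.add_apply, mul_add]
      map_smul' := fun c v => by
        rw [RingHom.id_apply, ← MemLp.toLp_const_smul]
        refine MemLp.toLp_congr _ _ (Eventually.of_forall fun x => ?_)
        simp only [Pi.smul_apply]
        rw [← integral_smul]
        refine integral_congr_ae ?_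
        filter_upwards [Lp.coeFn_smul c v] with y hy
        rw [hy, Pi.smul_apply, smul_eq_mul, smul_eq_mul]
        ring }
  refine ⟨S.mkContinuous B fun v => ?_, fun v => (hmem v).coeFn_toLp,
    LinearMap.mkContinuous_norm_le _ hB0 _⟩
  rw [Lp.norm_def, eLpNorm_exponent_top]
  refine ENNReal.toReal_le_of_le_ofReal (by positivity) (eLpNormEssSup_le_of_ae_bound ?_)
  filter_upwards [(hmem v).coeFn_toLp] with x hx
  change ‖(hmem v).toLp _ x‖ ≤ _
  rw [hx]; exact hle v x

local notation "⟪" x ", " y "⟫" => inner ℂ x y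
open ComplexConjugate

namespace Metric

variable {d : ℕ} {g : Metric d}

lemma integrable_vol_iff {f : Space d → ℂ} :
    Integrable f g.vol ↔ Integrable fun x => g.density x • f x := by
  rw [vol, integrable_withDensity_iff_integrable_smul'
    g.contDiff_density.continuous.measurable.ennreal_ofReal (by simp)]
  simp only [ENNReal.toReal_ofReal (g.density_pos _).le]

end Metric

namespace IsHeatFlow

variable {d : ℕ} {g : Metric d} {T : ℝ → g.L2 →L[ℂ] g.L2}

lemma IsEvaluation.ofReal_re_inner (hT : IsHeatFlow g T) {t : ℝ} (ht : 0 < t) {k : Space d → g.L2}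
    (hk : IsEvaluation g (T t) k) (x y : Space d) : ((⟪k x, k y⟫).re : ℂ) = ⟪k x, k y⟫ := by
  refine Complex.conj_eq_iff_re.1 ?_
  rw [← Metric.inner_conjL, hk.conjL_eq hT ht, hk.conjL_eq hT ht]

/-- By the semigroup law and symmetry, `T t u (x) = ⟪k x, T (t/2) u⟫ = ⟪T (t/2) (k x), u⟫`, and `T
(t/2) (k x)` has the value `⟪k y, k x⟫` at `y`. The density turns `d_g y` into `dy`. -/
lemma IsEvaluation.integral_eq (hT : IsHeatFlow g T) {t : ℝ} (ht : 0 < t) {k : Space d → g.L2}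
    (hk : IsEvaluation g (T (t / 2)) k) (u : g.L2) : ∀ᵐ x,
      Integrable (fun y => ((g.density y * (⟪k x, k y⟫).re : ℝ) : ℂ) * u y) ∧
      T t u x = ∫ y, ((g.density y * (⟪k x, k y⟫).re : ℝ) : ℂ) * u y := by
  have ht2 := half_pos ht
  have hadd : T t u = T (t / 2) (T (t / 2) u) := by
    rw [← hT.add_apply ht2.le ht2.le, add_halves]
  have h1 := hk.apply_ae (T (t / 2) u)
  rw [← hadd] at h1
  filter_upwards [g.volume_absolutelyContinuous_vol.ae_le h1] with x hx
  have h2 : (fun y => ⟪(T (t / 2) (k x)) y, u y⟫) =ᵐ[g.vol]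
      fun y => ((⟪k x, k y⟫).re : ℂ) * u y := by
    filter_upwards [hk.apply_ae (k x)] with y hy
    rw [RCLike.inner_apply, ← hy, inner_conj_symm, hk.ofReal_re_inner hT ht2, mul_comm]
  have h3 : ∀ y, ((g.density y * (⟪k x, k y⟫).re : ℝ) : ℂ) * u y =
      g.density y • (((⟪k x, k y⟫).re : ℂ) * u y) := fun y => by
    rw [Complex.real_smul]; push_cast; ring
  simp only [h3]
  refine ⟨Metric.integrable_vol_iff.1 ((integrable_congr h2).1 (L2.integrable_inner _ _)), ?_⟩
  rw [← Metric.integral_vol, ← integral_congr_ae h2, ← L2.inner_def, hT.symm, ← hx]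

/-- The heat kernel and its Gaussian bound. -/
theorem exists_kernel (hd : 2 ≤ d) {C₀ : ℝ} (hg : g.Bounds C₀) (hT : IsHeatFlow g T) :
    ∃ K : ℝ → Space d → Space d → ℝ, IsContinuousKernel g T K ∧
      ∃ C : ℝ, 0 < C ∧ ∀ t : ℝ, 0 < t → ∀ x y,
        |K t x y| ≤ C * t ^ (-(d : ℝ) / 2) * Real.exp (-‖x - y‖ ^ 2 / (C * t)) := by
  obtain ⟨A, c, hA, hc, h⟩ := hT.exists_norm_inner_evaluation_le hd hg
  have hk : ∀ t : ℝ, ∃ k, 0 < t → IsEvaluation g (T (t / 2)) k := fun t => by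
    by_cases ht : 0 < t
    · obtain ⟨k, hk⟩ := hT.exists_isEvaluation hd hg (half_pos ht)
      exact ⟨k, fun _ => hk⟩
    · exact ⟨fun _ => 0, fun h => absurd h ht⟩
  choose k hk using hk
  have hC₀ : 0 < C₀ := by linarith [hg.one_le]
  refine ⟨fun t x y => g.density y * (⟪k t x, k t y⟫).re, ⟨fun t ht => ?_, fun t ht u =>
    (hk t ht).integral_eq hT ht u⟩, ?_⟩
  · exact (g.contDiff_density.continuous.comp continuous_snd).mul (Complex.continuous_re.comp
      (((hk t ht).continuous.comp continuous_fst).inner ((hk t ht).continuous.comp continuous_snd)))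
  · set B := C₀ * (A * (1 / 2) ^ (-(d : ℝ) / 2)) with hB
    have hB0 : 0 < B := by positivity
    -- One constant serves twice: `C ≥ B` for the prefactor and `2 c C ≥ 1` for the exponent, the
    -- `2` coming from the time `t/2`.
    set C := B + 1 / (2 * c) with hC
    have hc2 : 0 < 1 / (2 * c) := by positivity
    have hC0 : 0 < C := by positivity
    refine ⟨C, hC0, fun t ht x y => ?_⟩
    have h1 := h (t / 2) (half_pos ht) (k t) (hk t ht) x y
    have e1 : (t / 2) ^ (-(d : ℝ) / 2) = (1 / 2) ^ (-(d : ℝ) / 2) * t ^ (-(d : ℝ) / 2) := by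
      rw [← Real.mul_rpow (by norm_num) ht.le]; congr 1; ring
    rw [abs_mul, abs_of_pos (g.density_pos y)]
    have h2 := mul_le_mul (hg.density_upper y) ((Complex.abs_re_le_norm _).trans h1) (abs_nonneg _)
      hC₀.le
    refine h2.trans ?_
    have e2 : C₀ * (A * (t / 2) ^ (-(d : ℝ) / 2) *
        Real.exp (-(c * (‖x - y‖ ^ 2 / (t / 2))))) =
        B * t ^ (-(d : ℝ) / 2) * Real.exp (-(c * (‖x - y‖ ^ 2 / (t / 2)))) := by
      rw [e1]; ring
    rw [e2]
    refine mul_le_mul (mul_le_mul_of_nonneg_right (by linarith) (by positivity))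
      (Real.exp_le_exp.2 ?_) (Real.exp_pos _).le (by positivity)
    rw [neg_div, neg_le_neg_iff, div_le_iff₀ (by positivity)]
    have h3 : 1 ≤ 2 * c * C := by
      have : 2 * c * (1 / (2 * c)) = 1 := by field_simp
      have : 0 < 2 * c * B := by positivity
      rw [hC]; linarith
    have e3 : c * (‖x - y‖ ^ 2 / (t / 2)) * (C * t) = 2 * c * C * ‖x - y‖ ^ 2 := by field_simp
    rw [e3]
    nlinarith [sq_nonneg ‖x - y‖]

end IsHeatFlow
end HeatKernel

/-! ### The main theorem -/

theorem mainTheorem9 (d : ℕ) (hd : 2 ≤ d) (g : HeatKernel.Metric d)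
    (hell : g.IsElliptic) (hlong : g.IsLongRange) :
    IsSelfAdjoint g.P ∧
    ∃ T : ℝ → g.L2 →L[ℂ] g.L2, HeatKernel.IsSemigroupGeneratedBy (-g.P) T ∧
    ∃ K : ℝ → HeatKernel.Space d → HeatKernel.Space d → ℝ,
      HeatKernel.IsContinuousKernel g T K ∧
      ∃ C : ℝ, 0 < C ∧ ∀ t : ℝ, 0 < t →
        (∀ x, K t x x ≤ C * t ^ (-(d : ℝ) / 2)) ∧
        (∀ x y, K t x y ≤ C * t ^ (-(d : ℝ) / 2) * Real.exp (-‖x - y‖ ^ 2 / (C * t))) ∧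
        ∃ S : Lp ℂ 1 (volume : Measure (HeatKernel.Space d)) →L[ℂ]
            Lp ℂ ∞ (volume : Measure (HeatKernel.Space d)),
          (∀ (v : Lp ℂ 1 (volume : Measure (HeatKernel.Space d))) (u : g.L2),
            v =ᵐ[volume] u → S v =ᵐ[volume] T t u) ∧
          ‖S‖ ≤ C * t ^ (-(d : ℝ) / 2) := by
  obtain ⟨C₀, hg⟩ := HeatKernel.Metric.exists_bounds hell hlong
  have hP := HeatKernel.Metric.isSelfAdjoint_P hg
  obtain ⟨l, hl, hsurj⟩ := HeatKernel.Metric.exists_P_surjective hg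
  obtain ⟨T, hT⟩ := HeatKernel.Metric.exists_heatFlow hg hP hl hsurj
  obtain ⟨K, hK, C, hC, h⟩ := hT.exists_kernel hd hg
  refine ⟨hP, T, hT.generated, K, hK, C, hC, fun t ht => ?_⟩
  -- Without its exponential the Gaussian bound is a uniform bound on the kernel, which gives both
  -- the diagonal estimate and the norm from `L¹` to `L^∞`.
  have hle : ∀ x y, |K t x y| ≤ C * t ^ (-(d : ℝ) / 2) := fun x y => by
    refine (h t ht x y).trans (mul_le_of_le_one_right (by positivity) (Real.exp_le_one_iff.2 ?_))
    exact div_nonpos_of_nonpos_of_nonneg (neg_nonpos.2 (sq_nonneg _)) (by positivity)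
  refine ⟨fun x => (le_abs_self _).trans (hle x x), fun x y => (le_abs_self _).trans (h t ht x y), ?_⟩
  obtain ⟨S, hS, hSn⟩ := HeatKernel.exists_integralOperator (hK.continuous t ht) hle
  refine ⟨S, fun v u hvu => ?_, hSn⟩
  filter_upwards [hS v, hK.integral_eq t ht u] with x h1 h2
  rw [h1, h2.2]
  refine integral_congr_ae ?_
  filter_upwards [hvu] with y hy
  rw [hy]
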